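/- Conventions. A definite or indefinite Kähler metric $g$ on a complex manifold is given by a smooth nondegenerate Hermitian form with components $h_{a\bar b}$ in holomorphic coordinates and closed Kähler form $\omega=\frac i2\sum h_{a\bar b}\,dz_a\wedge d\bar z_b$; the associated (pseudo-)Riemannian metric is $\mathrm{Re}\sum h_{a\bar b}\,dz_a\,d\bar z_b$. A definite or indefinite complex space form of holomorphic sectional curvature $\kappa$ is a complex manifold with such a metric, for which every non-null tangent vector has holomorphic sectional curvature $\kappa$. A Kähler immersion $\varphi:(M,g)\to(S,g_c)$ is a holomorphic map with $\varphi^*g_c=g$. The diastasis $D_p$ of $g$ at $p$ is the real analytic function near $p$ with $\omega=\frac i2\partial\bar\partial D_p$ near $p$ whose expansion $\sum a_{jk}z^j\bar z^k$ in every holomorphic coordinate system centered at $p$ satisfies $a_{j0}=a_{0j}=0$ for all multi-indices $j$. Bochner coordinates at $p$ are holomorphic coordinates $z_1,\dots,z_n$ centered at $p$ in which $D_p=|z|^2+\sum_{|j|,|k|\ge2}b_{jk}z^j\bar z^k$ near $p$. Finally, $\tilde\Lambda_p$ is the $\mathbb R$-algebra of germs at $p$ of functions $$a+\sum_{j=1}^{\ell}|\alpha_j|^2-\sum_{k=\ell+1}^{m}|\alpha_k|^2,$$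 where $a\in\mathbb R$, $m\ge1$, $0\le\ell\le m$, and $\alpha_1,\dots,\alpha_m$ are germs at $p$ of holomorphic functions vanishing at $p$; and $\tilde K_p$ is its field of fractions (a germ $f$ lies in $\tilde K_p$ if $fv=u$ for some $u,v\in\tilde\Lambda_p$, $v\ne0$). Proposition. Let $(M,g)$ be an $n$-dimensional Kähler manifold ($g$ positive definite) which admits a Kähler immersion into an $N$-dimensional definite or indefinite complex space form $(S,g_c)$ of constant holomorphic sectional curvature $2c$, $c\in\mathbb R$. Let $p\in M$, let $D_p$ be the diastasis of $g$ at $p$, and let $z_1,\dots,z_n$ be Bochner coordinates at $p$. Then, as germs at $p$, $$\det\left[\frac{\partial^2D_p}{\partial z_a\,\partial\bar z_b}\right]_{a,b=1}^{n}\in\tilde K_p,$$ and moreover $$D_p\in\tilde\Lambda_p\ \text{ if } c=0,\qquad e^{\frac c2D_p}\in\tilde\Lambda_p\ \text{ if } c\ne0.$$ -/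

import Mathlib

open scoped Manifold ContDiff Topology ComplexConjugate

noncomputable section

namespace KahlerImm

/-- The model space `ℂⁿ` of `n`-dimensional complex manifolds. -/
abbrev Cn (n : ℕ) : Type := Fin n → ℂ

/-! ### Wirtinger derivatives on `ℂⁿ` -/

/-- `∂f/∂z_a = (1/2)(∂f/∂x_a - i ∂f/∂y_a)`. -/
def dz {n : ℕ} (a : Fin n) (f : Cn n → ℂ) (z : Cn n) : ℂ :=
  (1 / 2) * (fderiv ℝ f z (Pi.single a 1) - Complex.I * fderiv ℝ f z (Pi.single a Complex.I))

/-- `∂f/∂z̄_a = (1/2)(∂f/∂x_a + i ∂f/∂y_a)`. -/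
def dzbar {n : ℕ} (a : Fin n) (f : Cn n → ℂ) (z : Cn n) : ℂ :=
  (1 / 2) * (fderiv ℝ f z (Pi.single a 1) + Complex.I * fderiv ℝ f z (Pi.single a Complex.I))

/-- The monomial `z^j z̄^k`, for multi-indices `j`, `k`. -/
def monomial {n : ℕ} (j k : Fin n → ℕ) (z : Cn n) : ℂ :=
  (∏ i, z i ^ j i) * ∏ i, conj (z i) ^ k i

/-! ### Definite and indefinite Kähler metrics -/

section Metric

variable {n : ℕ} {M : Type*} [TopologicalSpace M] [ChartedSpace (Cn n) M]

/-- In the coordinates `e`, the component `h(∂/∂z_a, ∂/∂z_b)`, usually written `h_{a b̄}`, of a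
Hermitian form `h` on the tangent bundle of `M` (antilinear in the first slot in Lean). -/
def coeff (h : ∀ x : M, TangentSpace 𝓘(ℂ, Cn n) x →ₗ⋆[ℂ] TangentSpace 𝓘(ℂ, Cn n) x →ₗ[ℂ] ℂ)
    (e : OpenPartialHomeomorph M (Cn n)) (a b : Fin n) (z : Cn n) : ℂ :=
  h (e.symm z) (mfderiv 𝓘(ℂ, Cn n) 𝓘(ℂ, Cn n) e.symm z (Pi.single b (1 : ℂ) : Cn n))
    (mfderiv 𝓘(ℂ, Cn n) 𝓘(ℂ, Cn n) e.symm z (Pi.single a (1 : ℂ) : Cn n))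

variable (n M) in
/-- A smooth, possibly indefinite, Kähler metric on an `n`-dimensional complex manifold `M`: a
nondegenerate Hermitian form `h` on the tangent bundle with smooth coefficients `h_{a b̄}` in
holomorphic coordinates, whose Kähler form `(i/2) ∑ h_{a b̄} dz_a ∧ dz̄_b` is closed, that is,
`∂h_{a b̄}/∂z_c = ∂h_{c b̄}/∂z_a`. The associated pseudo-Riemannian metric is `Re h`. -/
structure PseudoKahlerMetric where
  form : ∀ x : M, TangentSpace 𝓘(ℂ, Cn n) x →ₗ⋆[ℂ] TangentSpace 𝓘(ℂ, Cn n) x →ₗ[ℂ] ℂ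
  hermitian : ∀ (x : M) (v w : TangentSpace 𝓘(ℂ, Cn n) x), form x v w = conj (form x w v)
  nondegenerate : ∀ (x : M) (v : TangentSpace 𝓘(ℂ, Cn n) x), (∀ w, form x v w = 0) → v = 0
  smooth : ∀ e ∈ IsManifold.maximalAtlas 𝓘(ℂ, Cn n) ω M, ∀ a b : Fin n,
    ContDiffOn ℝ ∞ (coeff form e a b) e.target
  closed : ∀ e ∈ IsManifold.maximalAtlas 𝓘(ℂ, Cn n) ω M, ∀ z ∈ e.target, ∀ a b c : Fin n,
    dz c (coeff form e a b) z = dz a (coeff form e c b) z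

/-- The matrix of the functions `∂²D/∂z_a∂z̄_b` in the coordinates `e`. -/
def complexHessian (D : M → ℝ) (e : OpenPartialHomeomorph M (Cn n))
    (z : Cn n) : Matrix (Fin n) (Fin n) ℂ :=
  Matrix.of fun a b => dz a (dzbar b fun w => (D (e.symm w) : ℂ)) z

namespace PseudoKahlerMetric

/-- The metric is definite (a Kähler metric in the usual sense): `h(v, v) > 0` for `v ≠ 0`. -/
def IsKahler (g : PseudoKahlerMetric n M) : Prop :=
  ∀ (x : M) (v : TangentSpace 𝓘(ℂ, Cn n) x), v ≠ 0 → 0 < (g.form x v v).re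

/-- The matrix `(h_{a b̄})` in the coordinates `e`. -/
def matrix (g : PseudoKahlerMetric n M) (e : OpenPartialHomeomorph M (Cn n)) (z : Cn n) :
    Matrix (Fin n) (Fin n) ℂ :=
  Matrix.of fun a b => coeff g.form e a b z

/-- The curvature tensor in the coordinates `e`:
`R_{a b̄ c d̄} = -∂²h_{a b̄}/∂z_c∂z̄_d + ∑_{r,s} h^{r̄ s} (∂h_{a r̄}/∂z_c) (∂h_{s b̄}/∂z̄_d)`. -/
def curvature (g : PseudoKahlerMetric n M) (e : OpenPartialHomeomorph M (Cn n))
    (a b c d : Fin n) (z : Cn n) : ℂ :=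
  -dz c (dzbar d (coeff g.form e a b)) z +
    ∑ r, ∑ s, dz c (coeff g.form e a r) z * (g.matrix e z)⁻¹ r s * dzbar d (coeff g.form e s b) z

/-- The square norm `∑ h_{a b̄} v_a v̄_b` of the vector `∑ v_a ∂/∂z_a` at the point with
coordinates `z`. -/
def normSq (g : PseudoKahlerMetric n M) (e : OpenPartialHomeomorph M (Cn n)) (z v : Cn n) : ℂ :=
  ∑ a, ∑ b, coeff g.form e a b z * v a * conj (v b)

/-- The holomorphic sectional curvature of `Re h` (the sectional curvature of the plane spanned
by `v` and `i v`), for a non-null vector `v`: `2 R(v, v̄, v, v̄) / h(v, v)²`. In complex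
dimension one this is the Gauss curvature `-(2/h) ∂²(log |h|)/∂z∂z̄` of `h |dz|²`. -/
def holSecCurv (g : PseudoKahlerMetric n M) (e : OpenPartialHomeomorph M (Cn n))
    (z v : Cn n) : ℂ :=
  2 * (∑ a, ∑ b, ∑ c, ∑ d, g.curvature e a b c d z * v a * conj (v b) * v c * conj (v d)) /
    g.normSq e z v ^ 2

/-- `(M, g)` is a definite or indefinite complex space form of holomorphic sectional
curvature `κ`: every non-null vector has holomorphic sectional curvature `κ`. -/
def IsComplexSpaceForm (g : PseudoKahlerMetric n M) (κ : ℝ) : Prop :=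
  ∀ e ∈ IsManifold.maximalAtlas 𝓘(ℂ, Cn n) ω M, ∀ z ∈ e.target, ∀ v : Cn n,
    g.normSq e z v ≠ 0 → g.holSecCurv e z v = κ

/-- `D` is the diastasis of `g` at `p`, as a germ at `p`: a potential of `g`, that is
`h_{a b̄} = ∂²D/∂z_a∂z̄_b` near `p` (so the Kähler form is `(i/2)∂∂̄D`), which in every
coordinate system centered at `p` is the sum near `p` of a power series
`∑ A_{jk} z^j z̄^k` (so is real analytic) with `A_{j0} = A_{0j} = 0` for all `j`. -/
def IsDiastasis (g : PseudoKahlerMetric n M) (p : M) (D : M → ℝ) : Prop :=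
  ∀ e ∈ IsManifold.maximalAtlas 𝓘(ℂ, Cn n) ω M, p ∈ e.source → e p = 0 →
    (∀ᶠ z in 𝓝 (0 : Cn n), g.matrix e z = complexHessian D e z) ∧
    ∃ A : (Fin n → ℕ) → (Fin n → ℕ) → ℂ, (∀ j, A j 0 = 0 ∧ A 0 j = 0) ∧
      ∀ᶠ z in 𝓝 (0 : Cn n),
        HasSum (fun jk : (Fin n → ℕ) × (Fin n → ℕ) => A jk.1 jk.2 * monomial jk.1 jk.2 z)
          (D (e.symm z) : ℂ)

end PseudoKahlerMetric

/-- `e` is a system of Bochner coordinates at `p`, where `D` is the diastasis at `p`: holomorphic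
coordinates centered at `p` with `D = |z|² + ∑_{|j|,|k| ≥ 2} B_{jk} z^j z̄^k` near `p`. -/
def IsBochnerChart (p : M) (D : M → ℝ) (e : OpenPartialHomeomorph M (Cn n)) : Prop :=
  e ∈ IsManifold.maximalAtlas 𝓘(ℂ, Cn n) ω M ∧ p ∈ e.source ∧ e p = 0 ∧
    ∃ B : (Fin n → ℕ) → (Fin n → ℕ) → ℂ,
      (∀ j k, (∑ i, j i < 2 ∨ ∑ i, k i < 2) → B j k = 0) ∧
      ∀ᶠ z in 𝓝 (0 : Cn n),
        HasSum (fun jk : (Fin n → ℕ) × (Fin n → ℕ) => B jk.1 jk.2 * monomial jk.1 jk.2 z)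
          ((D (e.symm z) - ∑ i, ‖z i‖ ^ 2 : ℝ) : ℂ)

/-- A Kähler immersion `φ : (M, g) → (S, g')`: a holomorphic map with `φ^* g' = g`
(`dφ` is then injective because `g` is nondegenerate). -/
def IsKahlerImmersion {N : ℕ} {S : Type*} [TopologicalSpace S] [ChartedSpace (Cn N) S]
    (g : PseudoKahlerMetric n M) (g' : PseudoKahlerMetric N S) (φ : M → S) : Prop :=
  ContMDiff 𝓘(ℂ, Cn n) 𝓘(ℂ, Cn N) ω φ ∧
    ∀ (x : M) (v w : TangentSpace 𝓘(ℂ, Cn n) x),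
      g'.form (φ x) (mfderiv 𝓘(ℂ, Cn n) 𝓘(ℂ, Cn N) φ x v)
        (mfderiv 𝓘(ℂ, Cn n) 𝓘(ℂ, Cn N) φ x w) = g.form x v w

end Metric

/-! ### The algebra `Λ̃_p` and its field of fractions `K̃_p` -/

section Umehara

variable (n : ℕ) {M : Type*} [TopologicalSpace M] [ChartedSpace (Cn n) M]

/-- `f` is holomorphic near `p` and vanishes at `p`. -/
def IsHolVanishing (p : M) (f : M → ℂ) : Prop :=
  ContMDiffAt 𝓘(ℂ, Cn n) 𝓘(ℂ, ℂ) ω f p ∧ f p = 0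

/-- `⟨α, α⟩_ℓ = ∑_{j ≤ ℓ} |α_j|² - ∑_{k > ℓ} |α_k|²`. -/
def signedNormSq {M : Type*} {m : ℕ} (l : ℕ) (α : Fin m → M → ℂ) (x : M) : ℝ :=
  ∑ j : Fin m, if (j : ℕ) < l then ‖α j x‖ ^ 2 else -‖α j x‖ ^ 2

/-- Functions of the form `a + ⟨α, α⟩_ℓ`, with `a` a real constant and `α = (α_1, …, α_m)`,
`m ≥ 1`, `ℓ ≤ m`, a tuple of functions holomorphic near `p` and vanishing at `p`. -/
def IsTildeLambda (p : M) (F : M → ℂ) : Prop :=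
  ∃ (a : ℝ) (m : ℕ) (α : Fin m → M → ℂ) (l : ℕ), 1 ≤ m ∧ l ≤ m ∧
    (∀ j, IsHolVanishing n p (α j)) ∧ ∀ x, F x = ((a + signedNormSq l α x : ℝ) : ℂ)

variable {n}

theorem isHolVanishing_zero (p : M) :
    IsHolVanishing n p (fun _ => (0 : ℂ)) :=
  ⟨contMDiffAt_const, rfl⟩

theorem IsHolVanishing.mul {p : M} {f g : M → ℂ} (hf : IsHolVanishing n p f)
    (hg : IsHolVanishing n p g) : IsHolVanishing n p (fun x => f x * g x) := by
  refine ⟨?_, by simp [hf.2]⟩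
  have h : ContDiff ℂ ω (fun q : ℂ × ℂ => q.1 * q.2) := contDiff_fst.mul contDiff_snd
  exact h.contMDiff.contMDiffAt.comp p (hf.1.prodMk_space hg.1)

theorem IsHolVanishing.const_mul {p : M} {f : M → ℂ} (c : ℂ) (hf : IsHolVanishing n p f) :
    IsHolVanishing n p (fun x => c * f x) := by
  refine ⟨?_, by simp [hf.2]⟩
  have h : ContDiff ℂ ω (fun q : ℂ => c * q) := contDiff_const.mul contDiff_id
  exact h.contMDiff.contMDiffAt.comp p hf.1

theorem isTildeLambda_of_fin {p : M} (a : ℝ) {s t : ℕ} (β : Fin s → M → ℂ) (γ : Fin t → M → ℂ)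
    (hβ : ∀ i, IsHolVanishing n p (β i)) (hγ : ∀ i, IsHolVanishing n p (γ i)) :
    IsTildeLambda n p
      (fun x => ((a + (∑ i, ‖β i x‖ ^ 2 - ∑ i, ‖γ i x‖ ^ 2) : ℝ) : ℂ)) := by
  refine ⟨a, s + (t + 1), Fin.append β (Fin.snoc γ (fun _ => (0 : ℂ))), s, by omega, by omega,
    ?_, ?_⟩
  · intro j
    refine Fin.addCases (fun i => ?_) (fun i => ?_) j
    · simpa using hβ i
    · refine Fin.lastCases ?_ (fun i => ?_) i
      · rw [Fin.append_right, Fin.snoc_last]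
        exact isHolVanishing_zero p
      · simpa using hγ i
  · intro x
    simp [signedNormSq, Fin.sum_univ_add, Fin.sum_univ_castSucc (n := t), sub_eq_add_neg]

theorem isTildeLambda_iff {p : M} {F : M → ℂ} : IsTildeLambda n p F ↔
    ∃ (a : ℝ) (s t : ℕ) (β : Fin s → M → ℂ) (γ : Fin t → M → ℂ),
      (∀ i, IsHolVanishing n p (β i)) ∧ (∀ i, IsHolVanishing n p (γ i)) ∧
      F = fun x => ((a + (∑ i, ‖β i x‖ ^ 2 - ∑ i, ‖γ i x‖ ^ 2) : ℝ) : ℂ) := by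
  constructor
  · rintro ⟨a, m, α, l, -, hl, hα, hF⟩
    obtain ⟨t, rfl⟩ := Nat.exists_eq_add_of_le hl
    refine ⟨a, l, t, fun i => α (Fin.castAdd t i), fun i => α (Fin.natAdd l i),
      fun i => hα _, fun i => hα _, funext fun x => ?_⟩
    rw [hF]
    simp [signedNormSq, Fin.sum_univ_add, sub_eq_add_neg]
  · rintro ⟨a, s, t, β, γ, hβ, hγ, rfl⟩
    exact isTildeLambda_of_fin a β γ hβ hγ

variable (n) in
/-- Auxiliary: the functions `a + ⟨α, α⟩_ℓ` form an additive group. -/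
def tildeLambdaAdd (p : M) : AddSubgroup (M → ℂ) where
  carrier := {F | IsTildeLambda n p F}
  zero_mem' := by
    refine isTildeLambda_iff.2 ⟨0, 0, 0, Fin.elim0, Fin.elim0, fun i => i.elim0,
      fun i => i.elim0, funext fun x => ?_⟩
    simp
  add_mem' := by
    rintro F G hF hG
    obtain ⟨a, s, t, β, γ, hβ, hγ, rfl⟩ := isTildeLambda_iff.1 hF
    obtain ⟨a', s', t', β', γ', hβ', hγ', rfl⟩ := isTildeLambda_iff.1 hG
    refine isTildeLambda_iff.2 ⟨a + a', s + s', t + t', Fin.append β β', Fin.append γ γ',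
      fun j => ?_, fun j => ?_, funext fun x => ?_⟩
    · refine Fin.addCases (fun i => ?_) (fun i => ?_) j
      · simpa using hβ i
      · simpa using hβ' i
    · refine Fin.addCases (fun i => ?_) (fun i => ?_) j
      · simpa using hγ i
      · simpa using hγ' i
    · simp only [Pi.add_apply, Fin.sum_univ_add, Fin.append_left, Fin.append_right]
      push_cast
      ring
  neg_mem' := by
    rintro F hF
    obtain ⟨a, s, t, β, γ, hβ, hγ, rfl⟩ := isTildeLambda_iff.1 hF
    refine isTildeLambda_iff.2 ⟨-a, t, s, γ, β, hγ, hβ, funext fun x => ?_⟩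
    simp only [Pi.neg_apply]
    push_cast
    ring

theorem const_mem_tildeLambdaAdd (p : M) (a : ℝ) :
    (fun _ => (a : ℂ)) ∈ tildeLambdaAdd n p :=
  isTildeLambda_iff.2 ⟨a, 0, 0, Fin.elim0, Fin.elim0, fun i => i.elim0,
    fun i => i.elim0, funext fun x => by simp⟩

theorem normSq_mem_tildeLambdaAdd {p : M} {f : M → ℂ} (hf : IsHolVanishing n p f) :
    (fun x => ((‖f x‖ ^ 2 : ℝ) : ℂ)) ∈ tildeLambdaAdd n p :=
  isTildeLambda_iff.2 ⟨0, 1, 0, fun _ => f, Fin.elim0, fun _ => hf,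
    fun i => i.elim0, funext fun x => by simp⟩

theorem const_mul_normSq_mem_tildeLambdaAdd {p : M} {f : M → ℂ} (a : ℝ)
    (hf : IsHolVanishing n p f) :
    (fun x => ((a * ‖f x‖ ^ 2 : ℝ) : ℂ)) ∈ tildeLambdaAdd n p := by
  rcases le_total 0 a with ha | ha
  · convert normSq_mem_tildeLambdaAdd (hf.const_mul (Real.sqrt a : ℂ)) using 3 with x
    rw [norm_mul, mul_pow, Complex.norm_real, Real.norm_eq_abs, sq_abs, Real.sq_sqrt ha]
  · have := neg_mem (normSq_mem_tildeLambdaAdd (hf.const_mul (Real.sqrt (-a) : ℂ)))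
    convert this using 2 with x
    simp only [Pi.neg_apply]
    rw [norm_mul, mul_pow, Complex.norm_real, Real.norm_eq_abs, sq_abs,
      Real.sq_sqrt (by linarith)]
    push_cast
    ring

theorem tildeLambdaAdd_mul {p : M} {F G : M → ℂ} (hF : F ∈ tildeLambdaAdd n p)
    (hG : G ∈ tildeLambdaAdd n p) : F * G ∈ tildeLambdaAdd n p := by
  have key : ∀ f : M → ℂ, IsHolVanishing n p f → ∀ G ∈ tildeLambdaAdd n p,
      (fun x => ((‖f x‖ ^ 2 : ℝ) : ℂ)) * G ∈ tildeLambdaAdd n p := by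
    rintro f hf G hG
    obtain ⟨a, s, t, β, γ, hβ, hγ, rfl⟩ := isTildeLambda_iff.1 hG
    have h1 := const_mul_normSq_mem_tildeLambdaAdd a hf
    have h2 := sum_mem (t := Finset.univ) fun i (_ : i ∈ Finset.univ) =>
      normSq_mem_tildeLambdaAdd (hf.mul (hβ i))
    have h3 := sum_mem (t := Finset.univ) fun i (_ : i ∈ Finset.univ) =>
      normSq_mem_tildeLambdaAdd (hf.mul (hγ i))
    convert add_mem h1 (sub_mem h2 h3) using 1
    funext x
    simp only [Pi.mul_apply, Pi.add_apply, Pi.sub_apply, Finset.sum_apply, norm_mul, mul_pow]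
    push_cast
    simp only [← Finset.mul_sum]
    ring
  have key' : ∀ a : ℝ, ∀ G ∈ tildeLambdaAdd n p,
      (fun _ => (a : ℂ)) * G ∈ tildeLambdaAdd n p := by
    rintro a G hG
    obtain ⟨b, s, t, β, γ, hβ, hγ, rfl⟩ := isTildeLambda_iff.1 hG
    have h1 := const_mem_tildeLambdaAdd (n := n) p (a * b)
    have h2 := sum_mem (t := Finset.univ) fun i (_ : i ∈ Finset.univ) =>
      const_mul_normSq_mem_tildeLambdaAdd a (hβ i)
    have h3 := sum_mem (t := Finset.univ) fun i (_ : i ∈ Finset.univ) =>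
      const_mul_normSq_mem_tildeLambdaAdd a (hγ i)
    convert add_mem h1 (sub_mem h2 h3) using 1
    funext x
    simp only [Pi.mul_apply, Pi.add_apply, Pi.sub_apply, Finset.sum_apply]
    push_cast
    simp only [← Finset.mul_sum]
    ring
  obtain ⟨a, s, t, β, γ, hβ, hγ, rfl⟩ := isTildeLambda_iff.1 hF
  have h1 := key' a G hG
  have h2 := sum_mem (t := Finset.univ) fun i (_ : i ∈ Finset.univ) => key (β i) (hβ i) G hG
  have h3 := sum_mem (t := Finset.univ) fun i (_ : i ∈ Finset.univ) => key (γ i) (hγ i) G hG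
  convert add_mem h1 (sub_mem h2 h3) using 1
  funext x
  simp only [Pi.mul_apply, Pi.add_apply, Pi.sub_apply, Finset.sum_apply]
  push_cast
  simp only [← Finset.sum_mul]
  ring

variable (n)

/-- The algebra `Λ̃_p` of germs at `p` of functions `a + ⟨α, α⟩_ℓ`. Since it contains the real
constants, it is an `ℝ`-algebra. Germs are taken with values in `ℂ`; those in `Λ̃_p` are
real-valued. -/
def tildeLambda (p : M) : Subring (Filter.Germ (𝓝 p) ℂ) :=
  Subring.map (Filter.Germ.coeRingHom (𝓝 p))
    { tildeLambdaAdd n p with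
      mul_mem' := tildeLambdaAdd_mul
      one_mem' := by
        have h := const_mem_tildeLambdaAdd (n := n) p 1
        rwa [Complex.ofReal_one] at h }

/-- The germs at `p` that represent an element of the field of fractions `K̃_p` of `Λ̃_p`: germs
`f` such that `f = u / v`, that is `f v = u`, for some `u, v ∈ Λ̃_p` with `v` not the zero germ. -/
def tildeK (p : M) : Set (Filter.Germ (𝓝 p) ℂ) :=
  {f | ∃ u ∈ tildeLambda n p, ∃ v ∈ tildeLambda n p, v ≠ 0 ∧ f * v = u}

theorem mem_tildeLambda {p : M} {f : Filter.Germ (𝓝 p) ℂ} :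
    f ∈ tildeLambda n p ↔ ∃ F : M → ℂ, IsTildeLambda n p F ∧ (F : Filter.Germ (𝓝 p) ℂ) = f :=
  Iff.rfl

end Umehara

end KahlerImm

end

/-! Put k = c/2, so that S has holomorphic sectional curvature 4k, and let F₀(z, w) be the
polarisation of the diastasis in Bochner coordinates: D(z) = F₀(z, z̄). Everything rests on one
fact: the kernel F = (exp(k F₀) - 1)/k, read as F₀ when k = 0, is a finite sum of products f(z)
g(w).

Finite rank comes from a connection, not from a classification of space forms. The bundle ℂ ⊕ φ*TS
of rank 1 + N carries a connection (`connection`) and a compatible Hermitian form (`flatForm`) with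
conformal factor exp(k D). Constant holomorphic curvature makes ∂̄ of the Christoffel symbols an
explicit expression in the metric (`dzbar_christoffel`), and this cancels against the terms produced
by the summand ℂ, so covariant ∂-derivatives preserve holomorphic sections
(`SpaceFormData.isHolSection_connection`). The holomorphic sections V_a = (∂_a D, ∂_a φ) satisfy ∂_a
∂̄_b F(z, z̄) = ⟨V_a, V_b⟩, and each further ∂ acts on the left section only, each ∂̄ on the right
one only. The Taylor coefficients of F at 0 are therefore Gram products in a space of dimension 1 +
N (`SpaceFormData.isFiniteRank`), and an analytic kernel whose Taylor matrix has finite rank is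
itself of finite rank (`isFiniteRank_of_jets`).

A finite-rank kernel that is constant on both axes w = 0 and z = 0 can be written, up to that
constant, with factors vanishing at 0. Each product of a holomorphic function with a conjugate one
is a combination of squared moduli, so the restriction to w = z̄ lies in Λ̃ + iΛ̃
(`diag_mem_complexLambda`); if real-valued it lies in Λ̃ (`mem_tildeLambda_of_real`). This settles D
and exp(cD/2).

For the determinant, exp(2k F₀) ∂_a∂_b F₀ = (1 + kF) ∂_a∂_b F - k ∂_a F ∂_b F has finite rank, and
Bochner coordinates make ∂_a∂_b F₀ equal to δ_ab on both axes. Hence exp(cD/2)^(2n) times the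
determinant is a real element of Λ̃ + iΛ̃, which exhibits the determinant as a quotient. -/

open scoped Manifold ContDiff Topology ComplexConjugate

noncomputable section

namespace KahlerImm

/-! ### Wirtinger calculus -/

section Wirtinger

theorem two_le_infty : (1 + 1 : WithTop ℕ∞) ≤ ∞ := by
  have h : ((2 : ℕ∞) : WithTop ℕ∞) ≤ ((⊤ : ℕ∞) : WithTop ℕ∞) := WithTop.coe_le_coe.2 le_top
  rwa [one_add_one_eq_two]

variable {n : ℕ} {f g : Cn n → ℂ} {z : Cn n} {U : Set (Cn n)} (a b : Fin n)

theorem dz_congr (h : f =ᶠ[𝓝 z] g) : dz a f z = dz a g z := by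
  simp only [dz, h.fderiv_eq]

theorem dzbar_congr (h : f =ᶠ[𝓝 z] g) : dzbar a f z = dzbar a g z := by
  simp only [dzbar, h.fderiv_eq]

theorem dz_congr_on (hU : IsOpen U) (h : Set.EqOn f g U) : Set.EqOn (dz a f) (dz a g) U :=
  fun _ hz => dz_congr a (h.eventuallyEq_of_mem (hU.mem_nhds hz))

theorem dzbar_congr_on (hU : IsOpen U) (h : Set.EqOn f g U) :
    Set.EqOn (dzbar a f) (dzbar a g) U :=
  fun _ hz => dzbar_congr a (h.eventuallyEq_of_mem (hU.mem_nhds hz))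

theorem dz_const (w : ℂ) : dz a (fun _ : Cn n => w) z = 0 := by simp [dz]

theorem dzbar_const (w : ℂ) : dzbar a (fun _ : Cn n => w) z = 0 := by simp [dzbar]

theorem dz_add (hf : DifferentiableAt ℝ f z) (hg : DifferentiableAt ℝ g z) :
    dz a (fun w => f w + g w) z = dz a f z + dz a g z := by
  simp only [dz, fderiv_fun_add hf hg, add_apply]
  ring

theorem dzbar_add (hf : DifferentiableAt ℝ f z) (hg : DifferentiableAt ℝ g z) :
    dzbar a (fun w => f w + g w) z = dzbar a f z + dzbar a g z := by
  simp only [dzbar, fderiv_fun_add hf hg, add_apply]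
  ring

theorem dz_mul (hf : DifferentiableAt ℝ f z) (hg : DifferentiableAt ℝ g z) :
    dz a (fun w => f w * g w) z = dz a f z * g z + f z * dz a g z := by
  simp only [dz, fderiv_fun_mul hf hg, add_apply,
    smul_apply, smul_eq_mul]
  ring

theorem dzbar_mul (hf : DifferentiableAt ℝ f z) (hg : DifferentiableAt ℝ g z) :
    dzbar a (fun w => f w * g w) z = dzbar a f z * g z + f z * dzbar a g z := by
  simp only [dzbar, fderiv_fun_mul hf hg, add_apply,
    smul_apply, smul_eq_mul]
  ring

theorem dz_const_mul (w : ℂ) (hf : DifferentiableAt ℝ f z) :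
    dz a (fun y => w * f y) z = w * dz a f z := by
  rw [dz_mul a (differentiableAt_const w) hf, dz_const]
  ring

theorem dzbar_const_mul (w : ℂ) (hf : DifferentiableAt ℝ f z) :
    dzbar a (fun y => w * f y) z = w * dzbar a f z := by
  rw [dzbar_mul a (differentiableAt_const w) hf, dzbar_const]
  ring

theorem dz_sum {ι : Type*} (s : Finset ι) {F : ι → Cn n → ℂ}
    (hF : ∀ i ∈ s, DifferentiableAt ℝ (F i) z) :
    dz a (fun w => ∑ i ∈ s, F i w) z = ∑ i ∈ s, dz a (F i) z := by
  simp only [dz, fderiv_fun_sum hF, sum_apply, Finset.mul_sum,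
    ← Finset.sum_sub_distrib]

theorem dzbar_sum {ι : Type*} (s : Finset ι) {F : ι → Cn n → ℂ}
    (hF : ∀ i ∈ s, DifferentiableAt ℝ (F i) z) :
    dzbar a (fun w => ∑ i ∈ s, F i w) z = ∑ i ∈ s, dzbar a (F i) z := by
  simp only [dzbar, fderiv_fun_sum hF, sum_apply, Finset.mul_sum,
    ← Finset.sum_add_distrib]

theorem fderiv_conj_apply (hf : DifferentiableAt ℝ f z) (v : Cn n) :
    fderiv ℝ (fun w => conj (f w)) z v = conj (fderiv ℝ f z v) := by
  have := (Complex.conjCLE.toContinuousLinearMap.hasFDerivAt.comp z hf.hasFDerivAt).fderiv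
  have h2 : fderiv ℝ (fun w => conj (f w)) z =
      Complex.conjCLE.toContinuousLinearMap.comp (fderiv ℝ f z) := this
  rw [h2]
  rfl

theorem dz_conj (hf : DifferentiableAt ℝ f z) :
    dz a (fun w => conj (f w)) z = conj (dzbar a f z) := by
  simp only [dz, dzbar, fderiv_conj_apply hf, map_mul, map_add, Complex.conj_I, map_div₀, map_one,
    map_ofNat]
  ring

theorem dzbar_conj (hf : DifferentiableAt ℝ f z) :
    dzbar a (fun w => conj (f w)) z = conj (dz a f z) := by
  simp only [dz, dzbar, fderiv_conj_apply hf, map_mul, map_sub, Complex.conj_I, map_div₀, map_one,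
    map_ofNat]
  ring

/-- The real derivative in terms of the Wirtinger derivatives. -/
theorem fderiv_apply_eq_sum (v : Cn n) :
    fderiv ℝ f z v = ∑ i, (dz i f z * v i + dzbar i f z * conj (v i)) := by
  have hv : v = ∑ i, ((v i).re • (Pi.single i 1 : Cn n) +
      (v i).im • (Pi.single i Complex.I : Cn n)) := by
    ext k
    simp only [Finset.sum_apply, Pi.add_apply, Pi.smul_apply, Pi.single_apply]
    simp only [smul_ite, smul_zero, Finset.sum_add_distrib, Finset.sum_ite_eq, Finset.mem_univ,
      if_true, Complex.real_smul, mul_one]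
    exact (Complex.re_add_im _).symm
  conv_lhs => rw [hv]
  rw [map_sum]
  refine Finset.sum_congr rfl fun i _ => ?_
  rw [map_add, map_smul, map_smul]
  simp only [dz, dzbar, Complex.real_smul]
  have h1 : v i = (v i).re + (v i).im * Complex.I := (Complex.re_add_im _).symm
  have h2 : conj (v i) = (v i).re - (v i).im * Complex.I := by
    apply Complex.ext <;> simp
  rw [h2]
  conv_rhs => enter [1, 2]; rw [h1]
  ring_nf
  simp only [Complex.I_sq]
  ring

theorem contDiffOn_fderiv_apply (hU : IsOpen U) (hf : ContDiffOn ℝ ∞ f U) (v : Cn n) :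
    ContDiffOn ℝ ∞ (fun z => fderiv ℝ f z v) U :=
  (hf.fderiv_of_isOpen hU (by simp)).clm_apply contDiffOn_const

theorem contDiffOn_dz (hf : ContDiffOn ℝ ∞ f U) (hU : IsOpen U) :
    ContDiffOn ℝ ∞ (dz a f) U :=
  contDiffOn_const.mul ((contDiffOn_fderiv_apply hU hf _).sub
    (contDiffOn_const.mul (contDiffOn_fderiv_apply hU hf _)))

theorem contDiffOn_conj (hf : ContDiffOn ℝ ∞ f U) : ContDiffOn ℝ ∞ (fun z => conj (f z)) U :=
  Complex.conjCLE.contDiff.comp_contDiffOn hf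

theorem differentiableAt_of_contDiffOn (hf : ContDiffOn ℝ ∞ f U) (hU : IsOpen U)
    (hz : z ∈ U) : DifferentiableAt ℝ f z :=
  (hf.contDiffAt (hU.mem_nhds hz)).differentiableAt (by simp)

theorem fderiv_fderiv_apply_comm (hf : ContDiffAt ℝ ∞ f z) (v w : Cn n) :
    fderiv ℝ (fun y => fderiv ℝ f y v) z w = fderiv ℝ (fun y => fderiv ℝ f y w) z v := by
  have h : DifferentiableAt ℝ (fderiv ℝ f) z :=
    (hf.fderiv_right (m := 1) two_le_infty).differentiableAt (by simp)
  have key : ∀ v w : Cn n, fderiv ℝ (fun y => fderiv ℝ f y v) z w =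
      fderiv ℝ (fderiv ℝ f) z w v := by
    intro v w
    rw [fderiv_clm_apply h (differentiableAt_const v)]
    simp
  rw [key, key]
  exact (hf.isSymmSndFDerivAt (by simpa [one_add_one_eq_two] using two_le_infty)) w v

theorem differentiableAt_fderiv_apply (hf : ContDiffAt ℝ ∞ f z) (v : Cn n) :
    DifferentiableAt ℝ (fun y => fderiv ℝ f y v) z :=
  ((hf.fderiv_right (m := 1) two_le_infty).differentiableAt (by simp)).clm_apply
    (differentiableAt_const v)

theorem fderiv_dz_apply (hf : ContDiffAt ℝ ∞ f z) (v : Cn n) :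
    fderiv ℝ (dz a f) z v = (1 / 2) * (fderiv ℝ (fun y => fderiv ℝ f y (Pi.single a 1)) z v
      - Complex.I * fderiv ℝ (fun y => fderiv ℝ f y (Pi.single a Complex.I)) z v) := by
  have h1 := differentiableAt_fderiv_apply hf (Pi.single a 1)
  have h2 := differentiableAt_fderiv_apply hf (Pi.single a Complex.I)
  have : dz a f = fun z => (1 / 2) * (fderiv ℝ f z (Pi.single a 1)
      - Complex.I * fderiv ℝ f z (Pi.single a Complex.I)) := rfl
  rw [this, fderiv_const_mul (h1.fun_sub (h2.const_mul _)), fderiv_fun_sub h1 (h2.const_mul _),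
    fderiv_const_mul h2]
  simp

theorem fderiv_dzbar_apply (hf : ContDiffAt ℝ ∞ f z) (v : Cn n) :
    fderiv ℝ (dzbar a f) z v = (1 / 2) * (fderiv ℝ (fun y => fderiv ℝ f y (Pi.single a 1)) z v
      + Complex.I * fderiv ℝ (fun y => fderiv ℝ f y (Pi.single a Complex.I)) z v) := by
  have h1 := differentiableAt_fderiv_apply hf (Pi.single a 1)
  have h2 := differentiableAt_fderiv_apply hf (Pi.single a Complex.I)
  have : dzbar a f = fun z => (1 / 2) * (fderiv ℝ f z (Pi.single a 1)
      + Complex.I * fderiv ℝ f z (Pi.single a Complex.I)) := rfl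
  rw [this, fderiv_const_mul (h1.fun_add (h2.const_mul _)), fderiv_fun_add h1 (h2.const_mul _),
    fderiv_const_mul h2]
  simp [mul_add]

theorem dz_dzbar_comm (hf : ContDiffAt ℝ ∞ f z) :
    dz a (dzbar b f) z = dzbar b (dz a f) z := by
  rw [dz, dzbar, fderiv_dzbar_apply b hf, fderiv_dzbar_apply b hf, fderiv_dz_apply a hf,
    fderiv_dz_apply a hf, fderiv_fderiv_apply_comm hf (Pi.single a 1) (Pi.single b 1),
    fderiv_fderiv_apply_comm hf (Pi.single a 1) (Pi.single b Complex.I),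
    fderiv_fderiv_apply_comm hf (Pi.single a Complex.I) (Pi.single b 1),
    fderiv_fderiv_apply_comm hf (Pi.single a Complex.I) (Pi.single b Complex.I)]
  ring

/-- The Wirtinger derivatives of a composition with a holomorphic map. -/
theorem dz_comp {N : ℕ} {H : Cn N → ℂ} {ψ : Cn n → Cn N} (hH : DifferentiableAt ℝ H (ψ z))
    (hψ : DifferentiableAt ℂ ψ z) :
    dz a (fun w => H (ψ w)) z = ∑ i, dz i H (ψ z) * fderiv ℂ ψ z (Pi.single a 1) i ∧
    dzbar a (fun w => H (ψ w)) z =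
      ∑ i, dzbar i H (ψ z) * conj (fderiv ℂ ψ z (Pi.single a 1) i) := by
  have h1 : fderiv ℝ (fun w => H (ψ w)) z =
      (fderiv ℝ H (ψ z)).comp ((fderiv ℂ ψ z).restrictScalars ℝ) :=
    (hH.hasFDerivAt.comp z (hψ.hasFDerivAt.restrictScalars ℝ)).fderiv
  have h2 : (Pi.single a Complex.I : Cn n) = Complex.I • (Pi.single a 1 : Cn n) := by
    rw [← Pi.single_smul]; simp
  have h3 : fderiv ℂ ψ z (Pi.single a Complex.I) =
      Complex.I • fderiv ℂ ψ z (Pi.single a 1) := by rw [h2, map_smul]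
  constructor
  · rw [dz, h1]
    simp only [ContinuousLinearMap.comp_apply, ContinuousLinearMap.coe_restrictScalars', h3,
      fderiv_apply_eq_sum (f := H), Pi.smul_apply, smul_eq_mul, map_mul, Complex.conj_I,
      Finset.mul_sum, ← Finset.sum_sub_distrib]
    refine Finset.sum_congr rfl fun i _ => ?_
    ring_nf
    simp only [Complex.I_sq]
    ring
  · rw [dzbar, h1]
    simp only [ContinuousLinearMap.comp_apply, ContinuousLinearMap.coe_restrictScalars', h3,
      fderiv_apply_eq_sum (f := H), Pi.smul_apply, smul_eq_mul, map_mul, Complex.conj_I,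
      Finset.mul_sum, ← Finset.sum_add_distrib]
    refine Finset.sum_congr rfl fun i _ => ?_
    ring_nf
    simp only [Complex.I_sq]
    ring

theorem dz_of_differentiableAt (hf : DifferentiableAt ℂ f z) :
    dz a f z = fderiv ℂ f z (Pi.single a 1) ∧ dzbar a f z = 0 := by
  have h1 : fderiv ℝ f z = (fderiv ℂ f z).restrictScalars ℝ :=
    (hf.hasFDerivAt.restrictScalars ℝ).fderiv
  have h2 : (Pi.single a Complex.I : Cn n) = Complex.I • (Pi.single a 1 : Cn n) := by
    rw [← Pi.single_smul]; simp
  simp only [dz, dzbar, h1, ContinuousLinearMap.coe_restrictScalars', h2, map_smul, smul_eq_mul]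
  constructor <;> ring_nf <;> simp only [Complex.I_sq] <;> ring

end Wirtinger

/-! ### Power series built from products of linear functionals -/

section PowerSeries

variable {E : Type*} [NormedAddCommGroup E] [NormedSpace ℂ E]

theorem norm_prod_map_le (l : List (E →L[ℂ] ℂ)) (hl : ∀ u ∈ l, ‖u‖ ≤ 1) (x : E) :
    ‖(l.map fun u => u x).prod‖ ≤ ‖x‖ ^ l.length := by
  induction l with
  | nil => simp
  | cons u l ih =>
    simp only [List.map_cons, List.prod_cons, List.length_cons, norm_mul, pow_succ']
    refine mul_le_mul ?_ (ih fun v hv => hl v (List.mem_cons_of_mem _ hv)) (norm_nonneg _)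
      (norm_nonneg _)
    exact (u.le_of_opNorm_le (hl u List.mem_cons_self) x).trans (by simp)

/-- The multilinear form with diagonal restriction `∏ u ∈ l, u x`, for a list `l` of length `m`. -/
def listForm (l : List (E →L[ℂ] ℂ)) (m : ℕ) : ContinuousMultilinearMap ℂ (fun _ : Fin m => E) ℂ :=
  (ContinuousMultilinearMap.mkPiAlgebraFin ℂ m ℂ).compContinuousLinearMap
    -- The default value `0` keeps the norm bound true for every `m`; evaluation is only used when
    -- `m` is the length of `l`.
    fun i => l.getD i 0

theorem norm_listForm_le (l : List (E →L[ℂ] ℂ)) (hl : ∀ u ∈ l, ‖u‖ ≤ 1) (m : ℕ) :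
    ‖listForm l m‖ ≤ 1 := by
  refine (ContinuousMultilinearMap.norm_compContinuousLinearMap_le _ _).trans ?_
  have h : ∀ i : Fin m, ‖l.getD i 0‖ ≤ 1 := by
    intro i
    rcases lt_or_ge (i : ℕ) l.length with hi | hi
    · rw [List.getD_eq_getElem _ _ hi]
      exact hl _ (List.getElem_mem hi)
    · rw [List.getD_eq_default _ _ hi]
      simp
  have h1 : ‖ContinuousMultilinearMap.mkPiAlgebraFin ℂ m ℂ‖ = 1 :=
    ContinuousMultilinearMap.norm_mkPiAlgebraFin
  rw [h1, one_mul]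
  exact Finset.prod_le_one (fun i _ => norm_nonneg _) fun i _ => h i

theorem listForm_apply (l : List (E →L[ℂ] ℂ)) {m : ℕ} (hm : l.length = m) (x : E) :
    listForm l m (fun _ => x) = (l.map fun u => u x).prod := by
  subst hm
  simp only [listForm, ContinuousMultilinearMap.compContinuousLinearMap_apply,
    ContinuousMultilinearMap.mkPiAlgebraFin_apply]
  congr 1
  apply List.ext_getElem
  · simp
  · intro i h1 h2
    simp

/-- Grouping the indices by the length of `L α` gives the homogeneous parts of a formal multilinear
series, and absolute convergence at radius `r` bounds all of them. It will be applied to the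
monomials z^j w^k with z and w independent. -/
theorem analyticOnNhd_tsum_prod {A : Type*} (L : A → List (E →L[ℂ] ℂ))
    (hL : ∀ α, ∀ u ∈ L α, ‖u‖ ≤ 1) (C : A → ℂ) {r : ℝ} (hr : 0 < r)
    (hs : Summable fun α => ‖C α‖ * r ^ (L α).length) :
    AnalyticOnNhd ℂ (fun x => ∑' α, C α * ((L α).map fun u => u x).prod) (Metric.ball 0 r) := by
  have hsub : ∀ m, Summable fun α : {α // (L α).length = m} => ‖C α‖ * r ^ m := by
    intro m
    have := hs.comp_injective (Subtype.val_injective (p := fun α => (L α).length = m))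
    refine this.congr fun α => ?_
    simp [α.2]
  have hsub' : ∀ m, Summable fun α : {α // (L α).length = m} => ‖C α‖ := by
    intro m
    refine ((hsub m).mul_right (r ^ m)⁻¹).congr fun α => ?_
    field_simp
  have hq : ∀ m (α : {α // (L α).length = m}), ‖C α • listForm (L α) m‖ ≤ ‖C α‖ := by
    intro m α
    rw [norm_smul]
    exact mul_le_of_le_one_right (norm_nonneg _) (norm_listForm_le _ (hL _) _)
  have hqs : ∀ m, Summable fun α : {α // (L α).length = m} => C α • listForm (L α) m := fun m =>
    Summable.of_norm_bounded (hsub' m) (hq m)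
  let p : FormalMultilinearSeries ℂ E ℂ := fun m =>
    ∑' α : {α // (L α).length = m}, C α • listForm (L α) m
  have hp : ∀ m, ‖p m‖ * r ^ m ≤ ∑' α, ‖C α‖ * r ^ (L α).length := by
    intro m
    have h1 : ‖p m‖ ≤ ∑' α : {α // (L α).length = m}, ‖C α‖ :=
      tsum_of_norm_bounded (hsub' m).hasSum (hq m)
    calc ‖p m‖ * r ^ m ≤ (∑' α : {α // (L α).length = m}, ‖C α‖) * r ^ m := by gcongr
      _ = ∑' α : {α // (L α).length = m}, ‖C α‖ * r ^ (L α).length := by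
        rw [← tsum_mul_right]
        exact tsum_congr fun α => by rw [α.2]
      _ ≤ _ := by
        refine Summable.tsum_subtype_le (fun α => ‖C α‖ * r ^ (L α).length)
          {α | (L α).length = m} (fun α => by positivity) hs
  have hball : HasFPowerSeriesOnBall (fun x => ∑' α, C α * ((L α).map fun u => u x).prod) p 0
      (ENNReal.ofReal r) := by
    refine ⟨?_, by simpa using hr, ?_⟩
    · have := p.le_radius_of_bound (r := r.toNNReal) (∑' α, ‖C α‖ * r ^ (L α).length)
        (by simpa [hr.le] using hp)
      exact this
    · intro y hy
      have hy' : ‖y‖ < r := by simpa [hr] using hy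
      have hsum : Summable fun α => C α * ((L α).map fun u => u y).prod := by
        refine Summable.of_norm_bounded hs fun α => ?_
        rw [norm_mul]
        gcongr
        exact (norm_prod_map_le _ (hL α) y).trans (by gcongr)
      have h1 := (Equiv.sigmaFiberEquiv fun α => (L α).length).hasSum_iff.2 hsum.hasSum
      rw [zero_add]
      refine h1.sigma fun m => ?_
      have h2 := (hqs m).hasSum.mapL (ContinuousMultilinearMap.apply ℂ (fun _ : Fin m => E) ℂ
        fun _ => y)
      have h3 : (fun α : {α // (L α).length = m} => ContinuousMultilinearMap.apply ℂ
          (fun _ : Fin m => E) ℂ (fun _ => y) (C α • listForm (L α) m)) =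
          fun α : {α // (L α).length = m} => C α * ((L α).map fun u => u y).prod := by
        funext α
        simp [listForm_apply (L α) α.2 y]
      rw [h3] at h2
      exact h2
  have := hball.analyticOnNhd
  rwa [Metric.eball_ofReal] at this

end PowerSeries

/-! ### Iterated directional derivatives and the identity theorem -/

section Jets

variable {E : Type*} [NormedAddCommGroup E] [NormedSpace ℂ E]

/-- The derivative of `f` in the direction `v`. -/
def dirDeriv (v : E) (f : E → ℂ) : E → ℂ := fun x => fderiv ℂ f x v

/-- The iterated derivative of `f` in the directions of the list, the head first. -/
def iterDir : List E → (E → ℂ) → E → ℂ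
  | [], f => f
  | v :: l, f => iterDir l (dirDeriv v f)

theorem iterDir_append (l k : List E) (f : E → ℂ) :
    iterDir (l ++ k) f = iterDir k (iterDir l f) := by
  induction l generalizing f with
  | nil => rfl
  | cons v l ih => exact ih _

theorem dirDeriv_congr_on {U : Set E} (hU : IsOpen U) {f g : E → ℂ} (h : Set.EqOn f g U) (v : E) :
    Set.EqOn (dirDeriv v f) (dirDeriv v g) U := fun _ hz => by
  simp only [dirDeriv, (h.eventuallyEq_of_mem (hU.mem_nhds hz)).fderiv_eq]

theorem iterDir_congr_on {U : Set E} (hU : IsOpen U) (l : List E) {f g : E → ℂ}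
    (h : Set.EqOn f g U) : Set.EqOn (iterDir l f) (iterDir l g) U := by
  induction l generalizing f g with
  | nil => exact h
  | cons v l ih => exact ih (dirDeriv_congr_on hU h v)

theorem analyticOnNhd_dirDeriv {U : Set E} {f : E → ℂ} (hf : AnalyticOnNhd ℂ f U) (v : E) :
    AnalyticOnNhd ℂ (dirDeriv v f) U := fun x hx =>
  ((ContinuousLinearMap.apply ℂ ℂ v).analyticAt _).comp (hf.fderiv x hx)

theorem analyticOnNhd_iterDir {U : Set E} (l : List E) {f : E → ℂ} (hf : AnalyticOnNhd ℂ f U) :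
    AnalyticOnNhd ℂ (iterDir l f) U := by
  induction l generalizing f with
  | nil => exact hf
  | cons v l ih => exact ih (analyticOnNhd_dirDeriv hf v)

theorem dirDeriv_comm {f : E → ℂ} {x : E} (hf : AnalyticAt ℂ f x) (v w : E) :
    dirDeriv v (dirDeriv w f) x = dirDeriv w (dirDeriv v f) x := by
  have h : DifferentiableAt ℂ (fderiv ℂ f) x := hf.fderiv.differentiableAt
  have key : ∀ v w : E, dirDeriv v (dirDeriv w f) x = fderiv ℂ (fderiv ℂ f) x v w := by
    intro v w
    have h3 : dirDeriv w f = fun y => fderiv ℂ f y w := rfl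
    rw [h3, dirDeriv, fderiv_clm_apply h (differentiableAt_const w)]
    simp
  rw [key, key]
  have h2 : ContDiffAt ℂ 2 f x := hf.contDiffAt
  exact (h2.isSymmSndFDerivAt (by simp)) v w

theorem dirDeriv_iterDir_comm {U : Set E} (hU : IsOpen U) {f : E → ℂ} (hf : AnalyticOnNhd ℂ f U)
    (v : E) (l : List E) :
    Set.EqOn (dirDeriv v (iterDir l f)) (iterDir l (dirDeriv v f)) U := by
  induction l generalizing f with
  | nil => exact fun _ _ => rfl
  | cons w l ih =>
    intro x hx
    rw [iterDir, iterDir, ih (analyticOnNhd_dirDeriv hf w) hx]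
    exact iterDir_congr_on hU l (fun y hy => dirDeriv_comm (hf y hy) v w) hx

theorem dirDeriv_finsetSum {ι : Type*} (s : Finset ι) (c : ι → ℂ) {F : ι → E → ℂ} {x : E}
    (hF : ∀ i ∈ s, AnalyticAt ℂ (F i) x) (v : E) :
    dirDeriv v (fun y => ∑ i ∈ s, c i * F i y) x = ∑ i ∈ s, c i * dirDeriv v (F i) x := by
  simp only [dirDeriv]
  rw [fderiv_fun_sum fun i hi => ((hF i hi).differentiableAt.const_mul _)]
  rw [sum_apply]
  refine Finset.sum_congr rfl fun i hi => ?_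
  rw [fderiv_const_mul (hF i hi).differentiableAt]
  simp

theorem iterDir_finsetSum {U : Set E} (hU : IsOpen U) {ι : Type*} (s : Finset ι) (c : ι → ℂ)
    (l : List E) {F : ι → E → ℂ} (hF : ∀ i ∈ s, AnalyticOnNhd ℂ (F i) U) :
    Set.EqOn (iterDir l fun y => ∑ i ∈ s, c i * F i y) (fun x => ∑ i ∈ s, c i * iterDir l (F i) x)
      U := by
  induction l generalizing F with
  | nil => exact fun _ _ => rfl
  | cons v l ih =>
    intro x hx
    rw [iterDir, iterDir_congr_on hU l
      (fun y hy => dirDeriv_finsetSum s c (fun i hi => hF i hi y hy) v) hx,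
      ih (fun i hi => analyticOnNhd_dirDeriv (hF i hi) v) hx]
    rfl

/-- The identity theorem for directional derivatives along the vectors of a basis. -/
theorem eqOn_zero_of_iterDir {ι : Type*} [Finite ι] (b : Module.Basis ι ℂ E) {f : E → ℂ}
    {r : ℝ} (hr : 0 < r) (hf : AnalyticOnNhd ℂ f (Metric.ball 0 r))
    (h : ∀ l : List ι, iterDir (l.map b) f 0 = 0) : Set.EqOn f 0 (Metric.ball 0 r) := by
  have h0 : (0 : E) ∈ Metric.ball (0 : E) r := Metric.mem_ball_self hr
  -- The values of the Fréchet derivatives on basis vectors are iterated directional derivatives,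
  -- and a multilinear map is determined by its values on basis vectors.
  have key : ∀ (m : ℕ) (idx : Fin m → ι), ∃ l : List ι, ∀ x ∈ Metric.ball (0 : E) r,
      iteratedFDeriv ℂ m f x (fun i => b (idx i)) = iterDir (l.map b) f x := by
    intro m
    induction m with
    | zero => exact fun _ => ⟨[], fun x _ => by simp [iterDir]⟩
    | succ m ih =>
      intro idx
      obtain ⟨l, hl⟩ := ih (fun i => idx i.succ)
      -- The outermost derivative is the one in direction `idx 0`, while `iterDir` applies the end
      -- of its list last; hence the append.
      refine ⟨l ++ [idx 0], fun x hx => ?_⟩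
      have hd : DifferentiableAt ℂ (iteratedFDeriv ℂ m f) x :=
        (hf.iteratedFDeriv m x hx).differentiableAt
      rw [hd.iteratedFDeriv_succ_apply_left', List.map_append, iterDir_append]
      exact dirDeriv_congr_on Metric.isOpen_ball hl (b (idx 0)) hx
  have hz : ∀ m, iteratedFDeriv ℂ m f 0 = 0 := by
    intro m
    apply ContinuousMultilinearMap.toMultilinearMap_injective
    refine Module.Basis.ext_multilinear (fun _ => b) fun idx => ?_
    obtain ⟨l, hl⟩ := key m idx
    simpa [h l] using hl 0 h0
  obtain ⟨p, R, hp⟩ := hf 0 h0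
  refine hf.eqOn_zero_of_preconnected_of_eventuallyEq_zero
    (convex_ball _ _).isPreconnected h0 ?_
  have : Metric.eball (0 : E) R ∈ 𝓝 0 := Metric.eball_mem_nhds _ hp.r_pos
  filter_upwards [this] with y hy
  have h1 := hp.hasSum_sub hy
  have h2 : ∀ m, p m (fun _ => y - 0) = 0 := by
    intro m
    have := hp.factorial_smul (y - 0) m
    rw [hz m] at this
    simpa [Nat.factorial_ne_zero] using this
  simp only [h2] at h1
  exact h1.unique hasSum_zero

end Jets

/-! ### Analytic kernels of finite rank -/

/-- A family in a finite-dimensional space is recovered from finitely many of its members. -/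
theorem exists_finite_recovery {V X : Type*} [AddCommGroup V] [Module ℂ V]
    [FiniteDimensional ℂ V] (c : X → V) :
    ∃ (d : ℕ) (x : Fin d → X) (u : Fin d → V →ₗ[ℂ] ℂ), ∀ y, c y = ∑ s, u s (c y) • c (x s) := by
  -- Members of the family are chosen to form a basis of its span; `u s` extends the coordinate
  -- functional of index `s` to the whole space.
  obtain ⟨f, hf, hspan, hli⟩ := Submodule.exists_fun_fin_finrank_span_eq ℂ (Set.range c)
  choose x hx using hf
  have hex : ∀ s, ∃ u : V →ₗ[ℂ] ℂ, u ∘ₗ (Submodule.span ℂ (Set.range f)).subtype =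
      Finsupp.lapply s ∘ₗ hli.repr := fun s => LinearMap.exists_extend _
  choose u hu using hex
  refine ⟨_, x, u, fun y => ?_⟩
  have hy : c y ∈ Submodule.span ℂ (Set.range f) := by
    rw [hspan]
    exact Submodule.subset_span ⟨y, rfl⟩
  have h1 := hli.linearCombination_repr ⟨c y, hy⟩
  rw [Finsupp.linearCombination_apply, Finsupp.sum_fintype _ _ (by simp)] at h1
  refine h1.symm.trans (Finset.sum_congr rfl fun s _ => ?_)
  rw [hx s]
  congr 1
  exact (LinearMap.congr_fun (hu s) ⟨c y, hy⟩).symm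

section Kernel

variable {n : ℕ}

/-- The vector `∂/∂z_a` of `ℂⁿ × ℂⁿ`. -/
def vz (a : Fin n) : Cn n × Cn n := (Pi.single a 1, 0)

/-- The vector `∂/∂w_a` of `ℂⁿ × ℂⁿ`. -/
def vw (a : Fin n) : Cn n × Cn n := (0, Pi.single a 1)

theorem mem_ball_prod {r : ℝ} {z w : Cn n} :
    (z, w) ∈ Metric.ball (0 : Cn n × Cn n) r ↔ z ∈ Metric.ball 0 r ∧ w ∈ Metric.ball 0 r := by
  simp [Prod.norm_def]

theorem analyticOnNhd_left {r : ℝ} {F : Cn n × Cn n → ℂ}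
    (hF : AnalyticOnNhd ℂ F (Metric.ball 0 r)) {w : Cn n} (hw : w ∈ Metric.ball 0 r) :
    AnalyticOnNhd ℂ (fun z => F (z, w)) (Metric.ball 0 r) := fun z hz =>
  (hF (z, w) (mem_ball_prod.2 ⟨hz, hw⟩)).comp (f := fun z => (z, w))
    (analyticAt_id.prod analyticAt_const)

theorem analyticOnNhd_right {r : ℝ} {F : Cn n × Cn n → ℂ}
    (hF : AnalyticOnNhd ℂ F (Metric.ball 0 r)) {z : Cn n} (hz : z ∈ Metric.ball 0 r) :
    AnalyticOnNhd ℂ (fun w => F (z, w)) (Metric.ball 0 r) := fun w hw =>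
  (hF (z, w) (mem_ball_prod.2 ⟨hz, hw⟩)).comp (f := fun w => (z, w))
    (analyticAt_const.prod analyticAt_id)

theorem dirDeriv_left {F : Cn n × Cn n → ℂ} {z w : Cn n} (hF : AnalyticAt ℂ F (z, w))
    (v : Cn n) : dirDeriv v (fun z => F (z, w)) z = dirDeriv (v, 0) F (z, w) := by
  have h1 : HasFDerivAt (fun z : Cn n => (z, w)) (ContinuousLinearMap.inl ℂ (Cn n) (Cn n)) z :=
    (hasFDerivAt_id z).prodMk (hasFDerivAt_const w z)
  have h2 := (hF.differentiableAt.hasFDerivAt.comp z h1).fderiv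
  exact congrArg (fun L : Cn n →L[ℂ] ℂ => L v) h2

theorem dirDeriv_right {F : Cn n × Cn n → ℂ} {z w : Cn n} (hF : AnalyticAt ℂ F (z, w))
    (v : Cn n) : dirDeriv v (fun w => F (z, w)) w = dirDeriv (0, v) F (z, w) := by
  have h1 : HasFDerivAt (fun w : Cn n => (z, w)) (ContinuousLinearMap.inr ℂ (Cn n) (Cn n)) w :=
    (hasFDerivAt_const z w).prodMk (hasFDerivAt_id w)
  have h2 := (hF.differentiableAt.hasFDerivAt.comp w h1).fderiv
  exact congrArg (fun L : Cn n →L[ℂ] ℂ => L v) h2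

theorem iterDir_left {r : ℝ} {F : Cn n × Cn n → ℂ} (hF : AnalyticOnNhd ℂ F (Metric.ball 0 r))
    {w : Cn n} (hw : w ∈ Metric.ball 0 r) (l : List (Fin n)) :
    Set.EqOn (iterDir (l.map fun a => Pi.single a 1) fun z => F (z, w))
      (fun z => iterDir (l.map vz) F (z, w)) (Metric.ball 0 r) := by
  induction l generalizing F with
  | nil => exact fun _ _ => rfl
  | cons a l ih =>
    intro z hz
    rw [List.map_cons, iterDir, iterDir_congr_on Metric.isOpen_ball _ (fun y hy =>
      dirDeriv_left (hF (y, w) (mem_ball_prod.2 ⟨hy, hw⟩)) (Pi.single a 1)) hz]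
    exact ih (analyticOnNhd_dirDeriv hF _) hz

theorem iterDir_right {r : ℝ} {F : Cn n × Cn n → ℂ} (hF : AnalyticOnNhd ℂ F (Metric.ball 0 r))
    {z : Cn n} (hz : z ∈ Metric.ball 0 r) (l : List (Fin n)) :
    Set.EqOn (iterDir (l.map fun a => Pi.single a 1) fun w => F (z, w))
      (fun w => iterDir (l.map vw) F (z, w)) (Metric.ball 0 r) := by
  induction l generalizing F with
  | nil => exact fun _ _ => rfl
  | cons a l ih =>
    intro w hw
    rw [List.map_cons, iterDir, iterDir_congr_on Metric.isOpen_ball _ (fun y hy =>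
      dirDeriv_right (hF (z, y) (mem_ball_prod.2 ⟨hz, hy⟩)) (Pi.single a 1)) hw]
    exact ih (analyticOnNhd_dirDeriv hF _) hw

theorem eqOn_zero_of_jets {r : ℝ} (hr : 0 < r) {f : Cn n → ℂ}
    (hf : AnalyticOnNhd ℂ f (Metric.ball 0 r))
    (h : ∀ l : List (Fin n), iterDir (l.map fun a => Pi.single a 1) f 0 = 0) :
    Set.EqOn f 0 (Metric.ball 0 r) := by
  refine eqOn_zero_of_iterDir (Pi.basisFun ℂ (Fin n)) hr hf fun l => ?_
  convert h l using 3
  funext a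
  simp

/-- The kernel `F(z, w)` is a finite sum of products `f(z) g(w)` of analytic functions. -/
def IsFiniteRank (r : ℝ) (F : Cn n × Cn n → ℂ) : Prop :=
  ∃ (m : ℕ) (f g : Fin m → Cn n → ℂ), (∀ i, AnalyticOnNhd ℂ (f i) (Metric.ball 0 r)) ∧
    (∀ i, AnalyticOnNhd ℂ (g i) (Metric.ball 0 r)) ∧
    ∀ z ∈ Metric.ball (0 : Cn n) r, ∀ w ∈ Metric.ball (0 : Cn n) r, F (z, w) = ∑ i, f i z * g i w

theorem isFiniteRank_of_fintype {r : ℝ} {F : Cn n × Cn n → ℂ} {ι : Type*} [Fintype ι]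
    (f g : ι → Cn n → ℂ) (hf : ∀ i, AnalyticOnNhd ℂ (f i) (Metric.ball 0 r))
    (hg : ∀ i, AnalyticOnNhd ℂ (g i) (Metric.ball 0 r))
    (h : ∀ z ∈ Metric.ball (0 : Cn n) r, ∀ w ∈ Metric.ball (0 : Cn n) r,
      F (z, w) = ∑ i, f i z * g i w) : IsFiniteRank r F := by
  refine ⟨_, fun i => f ((Fintype.equivFin ι).symm i), fun i => g ((Fintype.equivFin ι).symm i),
    fun i => hf _, fun i => hg _, fun z hz w hw => ?_⟩
  rw [h z hz w hw]
  exact ((Fintype.equivFin ι).symm.sum_comp fun i => f i z * g i w).symm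

/-- An analytic kernel whose matrix of Taylor coefficients has finite rank has finite rank. -/
theorem isFiniteRank_of_jets {r : ℝ} (hr : 0 < r) {F : Cn n × Cn n → ℂ}
    (hF : AnalyticOnNhd ℂ F (Metric.ball 0 r)) {ι : Type*} [Fintype ι]
    (x y : List (Fin n) → ι → ℂ)
    (h : ∀ l k, iterDir (l.map vz) (iterDir (k.map vw) F) 0 = ∑ i, x l i * y k i) :
    IsFiniteRank r F := by
  have h0 : (0 : Cn n) ∈ Metric.ball (0 : Cn n) r := Metric.mem_ball_self hr
  -- For fixed z, the w-jet of F(z, ·) at 0 is to depend on `y k` alone, linearly. This holds as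
  -- soon as every linear relation among the vectors `y k` is also a relation among the
  -- w-derivatives of F at (z, 0).
  let T : (List (Fin n) →₀ ℂ) →ₗ[ℂ] (ι → ℂ) := Finsupp.linearCombination ℂ y
  have hη : ∀ z : Metric.ball (0 : Cn n) r, ∃ η : Module.Dual ℂ (ι → ℂ), ∀ k : List (Fin n),
      iterDir (k.map vw) F (z, 0) = η (y k) := by
    intro z
    let u : Module.Dual ℂ (List (Fin n) →₀ ℂ) :=
      Finsupp.linearCombination ℂ fun k => iterDir (k.map vw) F ((z : Cn n), 0)
    have hu : u ∈ T.ker.dualAnnihilator := by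
      rw [Submodule.mem_dualAnnihilator]
      intro c hc
      have hc' : ∑ k ∈ c.support, c k • y k = 0 := hc
      -- A relation `c` among the `y k` makes this function of z have zero Taylor coefficients at 0,
      -- so it vanishes on the whole ball.
      have hz := eqOn_zero_of_jets hr
        (f := fun z => ∑ k ∈ c.support, c k * iterDir (k.map vw) F (z, 0)) ?_ ?_ z.2
      · exact hz
      · exact Finset.analyticOnNhd_fun_sum _ fun k _ => analyticOnNhd_const.mul
          (analyticOnNhd_left (analyticOnNhd_iterDir _ hF) h0)
      · intro l
        rw [iterDir_finsetSum Metric.isOpen_ball c.support c _ (fun k _ => analyticOnNhd_left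
          (analyticOnNhd_iterDir (k.map vw) hF) h0) h0]
        have h1 : ∀ k ∈ c.support, c k * iterDir (l.map fun a => Pi.single a 1)
            (fun z => iterDir (k.map vw) F (z, 0)) 0 = ∑ i, x l i * (c k * y k i) := by
          intro k _
          rw [iterDir_left (analyticOnNhd_iterDir (k.map vw) hF) h0 l h0]
          have := h l k
          rw [← Prod.mk_zero_zero] at this
          simp only [this, Finset.mul_sum]
          exact Finset.sum_congr rfl fun i _ => by ring
        refine (Finset.sum_congr rfl h1).trans ?_
        rw [Finset.sum_comm]
        refine Finset.sum_eq_zero fun i _ => ?_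
        rw [← Finset.mul_sum]
        have := congrFun hc' i
        simp only [Finset.sum_apply, Pi.smul_apply, smul_eq_mul, Pi.zero_apply] at this
        rw [this, mul_zero]
    rw [← LinearMap.range_dualMap_eq_dualAnnihilator_ker] at hu
    obtain ⟨η, hη⟩ := hu
    refine ⟨η, fun k => ?_⟩
    have := LinearMap.congr_fun hη (Finsupp.single k 1)
    simpa [T, u] using this.symm
  choose η hη using hη
  -- The functionals `η z` live in a finite-dimensional dual, so finitely many points `zs` suffice
  -- to express all the functions F(z, ·).
  obtain ⟨d, zs, u, hu⟩ := exists_finite_recovery η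
  have hz : ∀ z : Metric.ball (0 : Cn n) r, ∀ w : Metric.ball (0 : Cn n) r,
      F (z, w) = ∑ s, u s (η z) * F (zs s, w) := by
    intro z w
    -- The index `none` stands for z itself, so that a single sum is the difference of the two
    -- sides.
    have hs : ∀ s ∈ (Finset.univ : Finset (Option (Fin d))), AnalyticOnNhd ℂ
        (fun w => F (((s.elim z zs : Metric.ball (0 : Cn n) r) : Cn n), w)) (Metric.ball 0 r) :=
      fun s _ => analyticOnNhd_right hF (s.elim z zs).2
    have key := eqOn_zero_of_jets hr (f := fun w => ∑ s : Option (Fin d),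
      (s.elim 1 fun s => - u s (η z)) * F (((s.elim z zs : Metric.ball (0 : Cn n) r) : Cn n), w))
      ?_ ?_ w.2
    · simp only [Fintype.sum_option, Option.elim, one_mul, neg_mul, Finset.sum_neg_distrib,
        Pi.zero_apply] at key
      exact add_neg_eq_zero.1 key
    · exact Finset.analyticOnNhd_fun_sum _ fun s hs' => analyticOnNhd_const.mul (hs s hs')
    · intro k
      rw [iterDir_finsetSum Metric.isOpen_ball _ _ _ hs h0]
      have h1 : ∀ z : Metric.ball (0 : Cn n) r, iterDir (k.map fun a => Pi.single a 1)
          (fun w => F ((z : Cn n), w)) 0 = η z (y k) := fun z => by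
        
        rw [iterDir_right hF z.2 k h0, ← hη]
      simp only [h1, Fintype.sum_option, Option.elim, one_mul, neg_mul, Finset.sum_neg_distrib]
      have := LinearMap.congr_fun (hu z) (y k)
      rw [this]
      simp
  -- The coefficients `u s (η z)` are not known to be analytic in z. A second recovery, now in w,
  -- replaces them by the functions F(z, ws t), which are.
  obtain ⟨d', ws, v, hv⟩ := exists_finite_recovery
    fun (w : Metric.ball (0 : Cn n) r) (s : Fin d) => F ((zs s : Cn n), (w : Cn n))
  refine isFiniteRank_of_fintype (fun t z => F (z, ws t))
    (fun t w => ∑ s, v t (Pi.single s 1) * F (zs s, w))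
    (fun t => analyticOnNhd_left hF (ws t).2)
    (fun t => Finset.analyticOnNhd_fun_sum _ fun s _ => analyticOnNhd_const.mul
      (analyticOnNhd_right hF (zs s).2)) fun z hz' w hw' => ?_
  have h1 := hz ⟨z, hz'⟩ ⟨w, hw'⟩
  have h2 := hv ⟨w, hw'⟩
  have h3 : ∀ t, v t (fun s => F ((zs s : Cn n), w)) =
      ∑ s, v t (Pi.single s 1) * F (zs s, w) := by
    intro t
    rw [LinearMap.pi_apply_eq_sum_univ (v t)]
    refine Finset.sum_congr rfl fun s _ => ?_
    rw [smul_eq_mul, mul_comm]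
    congr 2
    funext i
    simp [Pi.single_apply, eq_comm]
  simp only at h1 h2
  rw [h1]
  have h4 : ∀ s, F ((zs s : Cn n), w) =
      ∑ t, v t (fun s => F ((zs s : Cn n), w)) * F (zs s, ws t) := by
    intro s
    have := congrFun h2 s
    simpa using this
  have h5 : ∀ t, F (z, ws t) = ∑ s, u s (η ⟨z, hz'⟩) * F (zs s, ws t) := fun t =>
    hz ⟨z, hz'⟩ (ws t)
  simp only [← h3, h5, Finset.sum_mul]
  rw [Finset.sum_comm]
  refine Finset.sum_congr rfl fun s _ => ?_
  conv_lhs => rw [h4 s, Finset.mul_sum]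
  exact Finset.sum_congr rfl fun t _ => by ring

end Kernel

/-! ### Operations on finite-rank kernels -/

section KernelAlgebra

variable {n : ℕ} {r : ℝ} {F G : Cn n × Cn n → ℂ}

theorem IsFiniteRank.add (hF : IsFiniteRank r F) (hG : IsFiniteRank r G) :
    IsFiniteRank r (fun x => F x + G x) := by
  obtain ⟨m, f, g, hf, hg, h⟩ := hF
  obtain ⟨m', f', g', hf', hg', h'⟩ := hG
  refine isFiniteRank_of_fintype (Sum.elim f f') (Sum.elim g g')
    (by rintro (i | i); exacts [hf i, hf' i]) (by rintro (i | i); exacts [hg i, hg' i])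
    fun z hz w hw => ?_
  simp [h z hz w hw, h' z hz w hw]

theorem IsFiniteRank.mul (hF : IsFiniteRank r F) (hG : IsFiniteRank r G) :
    IsFiniteRank r (fun x => F x * G x) := by
  obtain ⟨m, f, g, hf, hg, h⟩ := hF
  obtain ⟨m', f', g', hf', hg', h'⟩ := hG
  refine isFiniteRank_of_fintype (fun i : Fin m × Fin m' => fun z => f i.1 z * f' i.2 z)
    (fun i => fun w => g i.1 w * g' i.2 w) (fun i => (hf _).mul (hf' _))
    (fun i => (hg _).mul (hg' _)) fun z hz w hw => ?_
  rw [h z hz w hw, h' z hz w hw, Finset.sum_mul_sum, Fintype.sum_prod_type]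
  exact Finset.sum_congr rfl fun i _ => Finset.sum_congr rfl fun j _ => by ring

theorem isFiniteRank_const (c : ℂ) : IsFiniteRank r (fun _ : Cn n × Cn n => c) :=
  isFiniteRank_of_fintype (fun _ : Unit => fun _ => c) (fun _ => fun _ => 1)
    (fun _ => analyticOnNhd_const) (fun _ => analyticOnNhd_const) (by simp)

theorem IsFiniteRank.congr (hF : IsFiniteRank r F)
    (h : Set.EqOn G F (Metric.ball 0 r)) : IsFiniteRank r G := by
  obtain ⟨m, f, g, hf, hg, h'⟩ := hF
  exact ⟨m, f, g, hf, hg, fun z hz w hw => by rw [h (mem_ball_prod.2 ⟨hz, hw⟩), h' z hz w hw]⟩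

theorem IsFiniteRank.dirDeriv_vz (hF : IsFiniteRank r F)
    (hFa : AnalyticOnNhd ℂ F (Metric.ball 0 r)) (a : Fin n) :
    IsFiniteRank r (dirDeriv (vz a) F) := by
  obtain ⟨m, f, g, hf, hg, h⟩ := hF
  refine ⟨m, fun i => dirDeriv (Pi.single a 1) (f i), g,
    fun i => analyticOnNhd_dirDeriv (hf i) _, hg, fun z hz w hw => ?_⟩
  rw [vz, ← dirDeriv_left (hFa _ (mem_ball_prod.2 ⟨hz, hw⟩)),
    dirDeriv_congr_on Metric.isOpen_ball (g := fun z => ∑ i, g i w * f i z)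
      (fun y hy => by simp only [h y hy w hw, mul_comm]) _ hz,
    dirDeriv_finsetSum _ _ fun i _ => hf i z hz]
  exact Finset.sum_congr rfl fun i _ => mul_comm _ _

theorem IsFiniteRank.dirDeriv_vw (hF : IsFiniteRank r F)
    (hFa : AnalyticOnNhd ℂ F (Metric.ball 0 r)) (a : Fin n) :
    IsFiniteRank r (dirDeriv (vw a) F) := by
  obtain ⟨m, f, g, hf, hg, h⟩ := hF
  refine ⟨m, f, fun i => dirDeriv (Pi.single a 1) (g i), hf,
    fun i => analyticOnNhd_dirDeriv (hg i) _, fun z hz w hw => ?_⟩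
  rw [vw, ← dirDeriv_right (hFa _ (mem_ball_prod.2 ⟨hz, hw⟩)),
    dirDeriv_congr_on Metric.isOpen_ball (g := fun w => ∑ i, f i z * g i w)
      (fun y hy => h z hz y hy) _ hw,
    dirDeriv_finsetSum _ _ fun i _ => hg i w hw]

/-- A kernel of finite rank without pure terms is, up to a constant, a finite sum of products of
functions vanishing at the origin. -/
theorem IsFiniteRank.exists_vanishing (hr : 0 < r) (hF : IsFiniteRank r F)
    (h1 : ∀ z ∈ Metric.ball (0 : Cn n) r, F (z, 0) = F 0)
    (h2 : ∀ w ∈ Metric.ball (0 : Cn n) r, F (0, w) = F 0) :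
    ∃ (m : ℕ) (f g : Fin m → Cn n → ℂ), (∀ i, AnalyticOnNhd ℂ (f i) (Metric.ball 0 r)) ∧
      (∀ i, AnalyticOnNhd ℂ (g i) (Metric.ball 0 r)) ∧ (∀ i, f i 0 = 0) ∧ (∀ i, g i 0 = 0) ∧
      ∀ z ∈ Metric.ball (0 : Cn n) r, ∀ w ∈ Metric.ball (0 : Cn n) r,
        F (z, w) = F 0 + ∑ i, f i z * g i w := by
  obtain ⟨m, f, g, hf, hg, h⟩ := hF
  have h0 : (0 : Cn n) ∈ Metric.ball (0 : Cn n) r := Metric.mem_ball_self hr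
  -- Expanding the products of differences, the three correction terms are F(z, 0), F(0, w) and F(0,
  -- 0), all equal to `F 0`.
  refine ⟨m, fun i z => f i z - f i 0, fun i w => g i w - g i 0,
    fun i => (hf i).sub analyticOnNhd_const, fun i => (hg i).sub analyticOnNhd_const,
    fun i => sub_self _, fun i => sub_self _, fun z hz w hw => ?_⟩
  have e1 := h1 z hz
  have e2 := h2 w hw
  have e3 : F 0 = ∑ i, f i 0 * g i 0 := h 0 h0 0 h0
  rw [h z hz 0 h0] at e1
  rw [h 0 h0 w hw] at e2
  have : ∑ i, (f i z - f i 0) * (g i w - g i 0) = ∑ i, f i z * g i w - ∑ i, f i z * g i 0 -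
      ∑ i, f i 0 * g i w + ∑ i, f i 0 * g i 0 := by
    simp only [← Finset.sum_sub_distrib, ← Finset.sum_add_distrib]
    exact Finset.sum_congr rfl fun i _ => by ring
  rw [this, h z hz w hw, e1, e2, ← e3]
  ring

end KernelAlgebra

/-! ### Restriction of kernels to w = z̄ -/

section Diagonal

variable {n : ℕ} {r : ℝ} {F G : Cn n × Cn n → ℂ}

/-- The restriction `F(z, z̄)` of a kernel. -/
def diag (F : Cn n × Cn n → ℂ) (z : Cn n) : ℂ := F (z, star z)

theorem mem_ball_diag {z : Cn n} (hz : z ∈ Metric.ball 0 r) :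
    (z, star z) ∈ Metric.ball (0 : Cn n × Cn n) r := by
  rw [mem_ball_prod]
  exact ⟨hz, by simpa using hz⟩

/-- The real derivative of the restriction along v is the complex derivative of F along (v, v̄).
Combining v = e_a and v = i e_a separates the two slots, so z and z̄ behave as independent
variables. -/
theorem dz_diag {z : Cn n} (hF : AnalyticAt ℂ F (z, star z)) (a : Fin n) :
    dz a (diag F) z = diag (dirDeriv (vz a) F) z ∧
      dzbar a (diag F) z = diag (dirDeriv (vw a) F) z := by
  have h1 : HasFDerivAt (fun z : Cn n => (z, star z)) ((ContinuousLinearMap.id ℝ (Cn n)).prod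
      (starL' ℝ : Cn n ≃L[ℝ] Cn n).toContinuousLinearMap) z :=
    (hasFDerivAt_id z).prodMk (starL' ℝ : Cn n ≃L[ℝ] Cn n).toContinuousLinearMap.hasFDerivAt
  have h2 : fderiv ℝ (diag F) z = _ :=
    ((hF.differentiableAt.hasFDerivAt.restrictScalars ℝ).comp z h1).fderiv
  have h3 : ∀ v, fderiv ℝ (diag F) z v = fderiv ℂ F (z, star z) (v, star v) := fun v => by
    rw [h2]; rfl
  have h4 : (((Pi.single a 1 : Cn n), star (Pi.single a 1 : Cn n)) : Cn n × Cn n) =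
      vz a + vw a := by
    simp [vz, vw]
  have h5 : (((Pi.single a Complex.I : Cn n), star (Pi.single a Complex.I : Cn n)) :
      Cn n × Cn n) = Complex.I • vz a - Complex.I • vw a := by
    simp [vz, vw, ← Pi.single_smul, Pi.single_neg]
  simp only [dz, dzbar, h3, h4, h5, map_add, map_sub, map_smul, smul_eq_mul, diag, dirDeriv]
  constructor <;> ring_nf <;> simp only [Complex.I_sq] <;> ring

theorem contDiffOn_diag (hF : AnalyticOnNhd ℂ F (Metric.ball 0 r)) :
    ContDiffOn ℝ ∞ (diag F) (Metric.ball 0 r) := by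
  have h1 : ContDiffOn ℝ ∞ F (Metric.ball 0 r) :=
    ((hF.analyticOn.contDiffOn (n := ∞) (Metric.isOpen_ball.uniqueDiffOn))).restrict_scalars ℝ
  have h2 : ContDiff ℝ ∞ fun z : Cn n => (z, star z) :=
    contDiff_id.prodMk (starL' ℝ : Cn n ≃L[ℝ] Cn n).contDiff
  exact h1.comp h2.contDiffOn fun z hz => mem_ball_diag hz

end Diagonal

/-! ### Polarisation of a Bochner expansion -/

section BochnerKernel

variable {n : ℕ}

/-- The coordinate functionals, with multiplicities, of the monomial `z^j w^k`. -/
def monomialList (jk : (Fin n → ℕ) × (Fin n → ℕ)) : List (Cn n × Cn n →L[ℂ] ℂ) :=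
  ((Finset.univ : Finset (Fin n)).toList.flatMap fun i => List.replicate (jk.1 i)
    ((ContinuousLinearMap.proj i).comp (ContinuousLinearMap.fst ℂ (Cn n) (Cn n)))) ++
  ((Finset.univ : Finset (Fin n)).toList.flatMap fun i => List.replicate (jk.2 i)
    ((ContinuousLinearMap.proj i).comp (ContinuousLinearMap.snd ℂ (Cn n) (Cn n))))

theorem monomialList_length (jk : (Fin n → ℕ) × (Fin n → ℕ)) :
    (monomialList jk).length = ∑ i, jk.1 i + ∑ i, jk.2 i := by
  simp [monomialList, List.length_flatMap]

theorem monomialList_prod (jk : (Fin n → ℕ) × (Fin n → ℕ)) (x : Cn n × Cn n) :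
    ((monomialList jk).map fun u => u x).prod = (∏ i, x.1 i ^ jk.1 i) * ∏ i, x.2 i ^ jk.2 i := by
  simp [monomialList, List.flatMap_def, List.prod_flatten, Function.comp_def]

theorem norm_le_one_of_mem_monomialList (jk : (Fin n → ℕ) × (Fin n → ℕ)) :
    ∀ u ∈ monomialList jk, ‖u‖ ≤ 1 := by
  intro u hu
  simp only [monomialList, List.mem_append, List.mem_flatMap, List.mem_replicate] at hu
  rcases hu with ⟨i, -, -, rfl⟩ | ⟨i, -, -, rfl⟩
  · refine ContinuousLinearMap.opNorm_le_bound _ zero_le_one fun x => ?_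
    rw [one_mul]
    exact (norm_le_pi_norm x.1 i).trans (norm_fst_le x)
  · refine ContinuousLinearMap.opNorm_le_bound _ zero_le_one fun x => ?_
    rw [one_mul]
    exact (norm_le_pi_norm x.2 i).trans (norm_snd_le x)

theorem norm_prod_pow_le (j : Fin n → ℕ) (z : Cn n) : ‖∏ i, z i ^ j i‖ ≤ ‖z‖ ^ ∑ i, j i := by
  rw [norm_prod, ← Finset.prod_pow_eq_pow_sum]
  refine Finset.prod_le_prod (fun i _ => norm_nonneg _) fun i _ => ?_
  rw [norm_pow]
  exact pow_le_pow_left₀ (norm_nonneg _) (norm_le_pi_norm z i) _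

/-- The remainder of a Bochner expansion, polarised. -/
theorem exists_remainder_kernel {f : Cn n → ℂ} {B : (Fin n → ℕ) → (Fin n → ℕ) → ℂ}
    (hB : ∀ j k, (∑ i, j i < 2 ∨ ∑ i, k i < 2) → B j k = 0)
    (hf : ∀ᶠ z in 𝓝 (0 : Cn n), HasSum
      (fun jk : (Fin n → ℕ) × (Fin n → ℕ) => B jk.1 jk.2 * monomial jk.1 jk.2 z) (f z)) :
    ∃ r > 0, ∃ R : Cn n × Cn n → ℂ, AnalyticOnNhd ℂ R (Metric.ball 0 r) ∧
      (∀ z ∈ Metric.ball (0 : Cn n) r, f z = diag R z) ∧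
      ∃ K : ℝ, ∀ x ∈ Metric.ball (0 : Cn n × Cn n) r,
        ‖R x‖ ≤ K * ‖x.1‖ ^ 2 ∧ ‖R x‖ ≤ K * ‖x.2‖ ^ 2 := by
  obtain ⟨ε, hε, hε'⟩ := Metric.eventually_nhds_iff_ball.1 hf
  set r := ε / 2 with hr
  have hr0 : 0 < r := by positivity
  -- At the real point (r, …, r) the monomial of index (j, k) equals r^(|j| + |k|); convergence
  -- there is absolute and controls the polarised series on the ball of radius r.
  have hz0 : (fun _ => (r : ℂ) : Cn n) ∈ Metric.ball (0 : Cn n) ε := by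
    rw [mem_ball_zero_iff, pi_norm_lt_iff hε]
    intro i
    rw [Complex.norm_real, Real.norm_of_nonneg hr0.le]
    linarith
  have hs : Summable fun jk : (Fin n → ℕ) × (Fin n → ℕ) =>
      ‖B jk.1 jk.2‖ * r ^ (∑ i, jk.1 i + ∑ i, jk.2 i) := by
    refine (hε' _ hz0).summable.norm.congr fun jk => ?_
    rw [norm_mul, monomial, norm_mul, norm_prod, norm_prod]
    simp only [Complex.conj_ofReal, norm_pow, Complex.norm_real, Real.norm_of_nonneg hr0.le,
      Finset.prod_pow_eq_pow_sum]
    rw [pow_add]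
  refine ⟨r, hr0, fun x => ∑' jk : (Fin n → ℕ) × (Fin n → ℕ), B jk.1 jk.2 *
    ((monomialList jk).map fun u => u x).prod, ?_, ?_, ?_⟩
  · exact analyticOnNhd_tsum_prod monomialList norm_le_one_of_mem_monomialList
      (fun jk => B jk.1 jk.2) hr0 (by simpa only [monomialList_length] using hs)
  · intro z hz
    rw [diag, ← (hε' z (Metric.ball_subset_ball (by linarith) hz)).tsum_eq]
    refine tsum_congr fun jk => ?_
    rw [monomialList_prod]
    rfl
  · refine ⟨(∑' jk : (Fin n → ℕ) × (Fin n → ℕ),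
      ‖B jk.1 jk.2‖ * r ^ (∑ i, jk.1 i + ∑ i, jk.2 i)) / r ^ 2, fun x hx => ?_⟩
    obtain ⟨h1, h2⟩ := mem_ball_prod.1 hx
    rw [mem_ball_zero_iff] at h1 h2
    -- Since |j|, |k| ≥ 2 in every nonzero term, two factors can be split off in either variable.
    -- The resulting quadratic bounds say that the remainder and its first derivative across each
    -- axis vanish on that axis.
    have key : ∀ (s t : ℝ), 0 ≤ s → s ≤ r → 0 ≤ t → t ≤ r → ∀ p q : ℕ, 2 ≤ p →
        s ^ p * t ^ q ≤ s ^ 2 / r ^ 2 * r ^ (p + q) := by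
      intro s t hs0 hsr ht0 htr p q hp
      obtain ⟨p, rfl⟩ := Nat.exists_eq_add_of_le hp
      calc s ^ (2 + p) * t ^ q = s ^ 2 * (s ^ p * t ^ q) := by ring
        _ ≤ s ^ 2 * (r ^ p * r ^ q) := by gcongr
        _ = _ := by field_simp; ring
    have hterm : ∀ jk : (Fin n → ℕ) × (Fin n → ℕ),
        ‖B jk.1 jk.2 * ((monomialList jk).map fun u => u x).prod‖ ≤
          (‖B jk.1 jk.2‖ * r ^ (∑ i, jk.1 i + ∑ i, jk.2 i)) * (‖x.1‖ ^ 2 / r ^ 2) ∧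
        ‖B jk.1 jk.2 * ((monomialList jk).map fun u => u x).prod‖ ≤
          (‖B jk.1 jk.2‖ * r ^ (∑ i, jk.1 i + ∑ i, jk.2 i)) * (‖x.2‖ ^ 2 / r ^ 2) := by
      intro jk
      by_cases hjk : ∑ i, jk.1 i < 2 ∨ ∑ i, jk.2 i < 2
      · simp [hB _ _ hjk]
      · push Not at hjk
        have hle : ‖((monomialList jk).map fun u => u x).prod‖ ≤
            ‖x.1‖ ^ (∑ i, jk.1 i) * ‖x.2‖ ^ (∑ i, jk.2 i) := by
          rw [monomialList_prod, norm_mul]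
          exact mul_le_mul (norm_prod_pow_le _ _) (norm_prod_pow_le _ _) (norm_nonneg _)
            (by positivity)
        rw [norm_mul]
        constructor
        · refine (mul_le_mul_of_nonneg_left (hle.trans (key _ _ (norm_nonneg _) h1.le
            (norm_nonneg _) h2.le _ _ hjk.1)) (norm_nonneg _)).trans (le_of_eq (by ring))
        · rw [mul_comm (‖x.1‖ ^ _)] at hle
          refine (mul_le_mul_of_nonneg_left (hle.trans (key _ _ (norm_nonneg _) h2.le
            (norm_nonneg _) h1.le _ _ hjk.2)) (norm_nonneg _)).trans (le_of_eq (by ring))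
    constructor
    · refine (tsum_of_norm_bounded (hs.hasSum.mul_right _) fun jk => (hterm jk).1).trans
        (le_of_eq (by ring))
    · refine (tsum_of_norm_bounded (hs.hasSum.mul_right _) fun jk => (hterm jk).2).trans
        (le_of_eq (by ring))

theorem dirDeriv_eq_zero_of_bound {r K : ℝ} (hr : 0 < r) {f : Cn n → ℂ}
    (h : ∀ w ∈ Metric.ball (0 : Cn n) r, ‖f w‖ ≤ K * ‖w‖ ^ 2) (v : Cn n) :
    dirDeriv v f 0 = 0 := by
  have h1 : f =O[𝓝 0] fun w : Cn n => ‖w - 0‖ ^ 2 := by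
    refine Asymptotics.IsBigO.of_bound K ?_
    filter_upwards [Metric.ball_mem_nhds 0 hr] with w hw
    simpa using h w hw
  rw [dirDeriv, (h1.hasFDerivAt one_lt_two).fderiv]
  rfl

theorem dirDeriv_sum_mul (y v x : Cn n) :
    dirDeriv v (fun w : Cn n => ∑ i, y i * w i) x = ∑ i, y i * v i := by
  have h : (fun w : Cn n => ∑ i, y i * w i) =
      (∑ i, y i • (ContinuousLinearMap.proj i : Cn n →L[ℂ] ℂ) : Cn n →L[ℂ] ℂ) := by
    funext w
    simp [sum_apply]
  rw [dirDeriv, h, ContinuousLinearMap.fderiv]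
  simp [sum_apply]

/-- The polarisation `F(z, w)` of a function with a Bochner expansion
`|z|² + ∑_{|j|,|k| ≥ 2} B_{jk} z^j z̄^k`. -/
theorem exists_bochner_kernel {f : Cn n → ℂ} {B : (Fin n → ℕ) → (Fin n → ℕ) → ℂ}
    (hB : ∀ j k, (∑ i, j i < 2 ∨ ∑ i, k i < 2) → B j k = 0)
    (hf : ∀ᶠ z in 𝓝 (0 : Cn n), HasSum
      (fun jk : (Fin n → ℕ) × (Fin n → ℕ) => B jk.1 jk.2 * monomial jk.1 jk.2 z)
      (f z - ∑ i, z i * conj (z i))) :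
    ∃ r > 0, ∃ F : Cn n × Cn n → ℂ, AnalyticOnNhd ℂ F (Metric.ball 0 r) ∧
      (∀ z ∈ Metric.ball (0 : Cn n) r, f z = diag F z) ∧
      (∀ z ∈ Metric.ball (0 : Cn n) r, F (z, 0) = 0 ∧ F (0, z) = 0 ∧
        ∀ a, dirDeriv (vw a) F (z, 0) = z a ∧ dirDeriv (vz a) F (0, z) = z a) := by
  obtain ⟨r, hr, R, hR, hd, K, hK⟩ := exists_remainder_kernel hB hf
  have h0 : (0 : Cn n) ∈ Metric.ball (0 : Cn n) r := Metric.mem_ball_self hr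
  have hQ : AnalyticOnNhd ℂ (fun x : Cn n × Cn n => ∑ i, x.1 i * x.2 i) (Metric.ball 0 r) :=
    Finset.analyticOnNhd_fun_sum _ fun i _ => fun x _ =>
      (((ContinuousLinearMap.proj i).comp (ContinuousLinearMap.fst ℂ (Cn n) (Cn n))).analyticAt
        x).mul
      (((ContinuousLinearMap.proj i).comp (ContinuousLinearMap.snd ℂ (Cn n) (Cn n))).analyticAt x)
  have hS : AnalyticOnNhd ℂ (fun x : Cn n × Cn n => ∑ i, x.1 i * x.2 i + R x)
      (Metric.ball 0 r) := hQ.add hR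
  refine ⟨r, hr, fun x => ∑ i, x.1 i * x.2 i + R x, hS, ?_, fun z hz => ⟨?_, ?_, ?_⟩⟩
  · intro z hz
    have := hd z hz
    simp only [diag] at this ⊢
    rw [← this]
    simp
  · have := (hK (z, 0) (mem_ball_prod.2 ⟨hz, h0⟩)).2
    simpa using this
  · have := (hK (0, z) (mem_ball_prod.2 ⟨h0, hz⟩)).1
    simpa using this
  · intro a
    constructor
    · have hm := mem_ball_prod.2 ⟨hz, h0⟩
      rw [vw, ← dirDeriv_right (hS _ hm)]
      have h1 := dirDeriv_eq_zero_of_bound hr (f := fun w => R (z, w))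
        (fun w hw => (hK (z, w) (mem_ball_prod.2 ⟨hz, hw⟩)).2) (Pi.single a 1)
      have h2 := dirDeriv_sum_mul z (Pi.single a 1) 0
      have h3 : dirDeriv (Pi.single a 1) (fun w => ∑ i, z i * w i + R (z, w)) 0 = _ :=
        congrArg (fun L : Cn n →L[ℂ] ℂ => L (Pi.single a 1))
          (fderiv_fun_add (analyticOnNhd_right hQ hz 0 h0).differentiableAt
            (analyticOnNhd_right hR hz 0 h0).differentiableAt)
      rw [h3, add_apply]
      change dirDeriv (Pi.single a 1) (fun w => ∑ i, z i * w i) 0 +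
        dirDeriv (Pi.single a 1) (fun w => R (z, w)) 0 = _
      rw [h1, h2]
      simp [Pi.single_apply]
    · have hm := mem_ball_prod.2 ⟨h0, hz⟩
      rw [vz, ← dirDeriv_left (hS _ hm)]
      have h1 := dirDeriv_eq_zero_of_bound hr (f := fun w => R (w, z))
        (fun w hw => (hK (w, z) (mem_ball_prod.2 ⟨hw, hz⟩)).1) (Pi.single a 1)
      have h2 := dirDeriv_sum_mul z (Pi.single a 1) 0
      have h3 : dirDeriv (Pi.single a 1) (fun w => ∑ i, w i * z i + R (w, z)) 0 = _ :=
        congrArg (fun L : Cn n →L[ℂ] ℂ => L (Pi.single a 1))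
          (fderiv_fun_add (analyticOnNhd_left hQ hz 0 h0).differentiableAt
            (analyticOnNhd_left hR hz 0 h0).differentiableAt)
      rw [h3, add_apply]
      change dirDeriv (Pi.single a 1) (fun w => ∑ i, w i * z i) 0 +
        dirDeriv (Pi.single a 1) (fun w => R (w, z)) 0 = _
      rw [h1]
      simp only [mul_comm _ (z _)]
      rw [h2]
      simp [Pi.single_apply]

end BochnerKernel

/-! ### Polarisation of (2, 2)-forms and density of non-null vectors -/

section Polarization

/-- A form of bidegree `(2, 2)`, symmetric in its linear and in its antilinear arguments, that
vanishes on the diagonal is zero. -/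
theorem eq_zero_of_diagonal {E : Type*} [AddCommGroup E] [Module ℂ E] (T : E → E → E → E → ℂ)
    (a1 : ∀ x x' y u v, T (x + x') y u v = T x y u v + T x' y u v)
    (a2 : ∀ x y y' u v, T x (y + y') u v = T x y u v + T x y' u v)
    (s1 : ∀ (t : ℂ) x y u v, T (t • x) y u v = t * T x y u v)
    (s2 : ∀ (t : ℂ) x y u v, T x (t • y) u v = conj t * T x y u v)
    (c1 : ∀ x y u v, T x y u v = T u y x v) (c2 : ∀ x y u v, T x y u v = T x v u y)
    (h : ∀ x, T x x x x = 0) (x y u v : E) : T x y u v = 0 := by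
  have a3 : ∀ x y u u' v, T x y (u + u') v = T x y u v + T x y u' v := fun x y u u' v => by
    rw [c1, a1, c1 u, c1 u']
  have a4 : ∀ x y u v v', T x y u (v + v') = T x y u v + T x y u v' := fun x y u v v' => by
    rw [c2, a2, c2 x v, c2 x v']
  have s3 : ∀ (t : ℂ) x y u v, T x y (t • u) v = t * T x y u v := fun t x y u v => by
    rw [c1, s1, c1 u]
  have s4 : ∀ (t : ℂ) x y u v, T x y u (t • v) = conj t * T x y u v := fun t x y u v => by
    rw [c2, s2, c2 x v]
  -- In the expansion at x + t y, the sum over t = ±1 minus the sum over t = ±i kills every term t^p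
  -- t̄^q except those with p - q = ±2.
  have hsum : ∀ x y, T x y x y + T y x y x = 0 := by
    intro x y
    have e1 := h (x + (1 : ℂ) • y)
    have e2 := h (x + (-1 : ℂ) • y)
    have e3 := h (x + Complex.I • y)
    have e4 := h (x + (-Complex.I) • y)
    simp only [a1, a2, a3, a4, s1, s2, s3, s4, map_one, map_neg, Complex.conj_I] at e1 e2 e3 e4
    linear_combination (exp := 1) (e1 + e2 - e3 - e4) / 4 + (T x y x y / 2 + T y x y x / 2 + (T x x y y + T x y y x + T y x x y + T y y x x) * (-1 / 2)
      + T y y y y * (Complex.I ^ 2 - 1) / 2) * Complex.I_sq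
  -- Replacing y by (1 + i) y multiplies the two terms by (1 - i)² = -2i and (1 + i)² = 2i, which
  -- separates them.
  have hdiag : ∀ x y, T x y x y = 0 := by
    intro x y
    have e1 := hsum x y
    have e2 := hsum x ((1 + Complex.I) • y)
    simp only [s1, s2, s3, s4, map_add, map_one, Complex.conj_I] at e2
    have hI : (2 * Complex.I) * (T y x y x - T x y x y) = 0 := by
      linear_combination e2 - (T x y x y + T y x y x) * Complex.I_sq
    have := (mul_eq_zero.1 hI).resolve_left (by simp)
    linear_combination e1 / 2 - this / 2
  -- What remains is ordinary polarisation of symmetric forms, in the linear arguments here and in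
  -- the antilinear ones after.
  have hx : ∀ x u y, T x y u y = 0 := by
    intro x u y
    have e := hdiag (x + u) y
    simp only [a1, a3, hdiag, c1 u y x y] at e
    linear_combination e / 2
  have e := hx x u (y + v)
  simp only [a2, a4, hx, c2 x v u y] at e
  linear_combination e / 2

variable {N : ℕ}

/-- The form of bidegree `(2, 2)` with coefficients `T`. -/
def quartic (T : Fin N → Fin N → Fin N → Fin N → ℂ) (x y u v : Cn N) : ℂ :=
  ∑ a, ∑ b, ∑ c, ∑ d, T a b c d * x a * conj (y b) * u c * conj (v d)

theorem quartic_eq_zero {T : Fin N → Fin N → Fin N → Fin N → ℂ}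
    (h1 : ∀ a b c d, T a b c d = T c b a d) (h2 : ∀ a b c d, T a b c d = T a d c b)
    (h : ∀ x, quartic T x x x x = 0) (a b c d : Fin N) : T a b c d = 0 := by
  have key := eq_zero_of_diagonal (quartic T) ?_ ?_ ?_ ?_ ?_ ?_ h (Pi.single a 1) (Pi.single b 1)
    (Pi.single c 1) (Pi.single d 1)
  · rw [quartic, Finset.sum_eq_single a _ (by simp), Finset.sum_eq_single b _ (by simp),
      Finset.sum_eq_single c _ (by simp), Finset.sum_eq_single d _ (by simp)] at key
    · simpa using key
    all_goals
      intro i _ hi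
      simp [hi]
  · intro x x' y u v
    simp only [quartic, ← Finset.sum_add_distrib, Pi.add_apply]
    refine Finset.sum_congr rfl fun a _ => Finset.sum_congr rfl fun b _ =>
      Finset.sum_congr rfl fun c _ => Finset.sum_congr rfl fun d _ => by ring
  · intro x y y' u v
    simp only [quartic, ← Finset.sum_add_distrib, Pi.add_apply, map_add]
    refine Finset.sum_congr rfl fun a _ => Finset.sum_congr rfl fun b _ =>
      Finset.sum_congr rfl fun c _ => Finset.sum_congr rfl fun d _ => by ring
  · intro t x y u v
    simp only [quartic, Finset.mul_sum, Pi.smul_apply, smul_eq_mul]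
    refine Finset.sum_congr rfl fun a _ => Finset.sum_congr rfl fun b _ =>
      Finset.sum_congr rfl fun c _ => Finset.sum_congr rfl fun d _ => by ring
  · intro t x y u v
    simp only [quartic, Finset.mul_sum, Pi.smul_apply, smul_eq_mul, map_mul]
    refine Finset.sum_congr rfl fun a _ => Finset.sum_congr rfl fun b _ =>
      Finset.sum_congr rfl fun c _ => Finset.sum_congr rfl fun d _ => by ring
  · intro x y u v
    simp only [quartic]
    have e : ∀ a : Fin N, ∑ b, ∑ c, ∑ d, T a b c d * x a * conj (y b) * u c * conj (v d) =
        ∑ c, ∑ b, ∑ d, T a b c d * x a * conj (y b) * u c * conj (v d) := fun a =>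
      Finset.sum_comm
    have e' : ∀ a : Fin N, ∑ b, ∑ c, ∑ d, T a b c d * u a * conj (y b) * x c * conj (v d) =
        ∑ c, ∑ b, ∑ d, T a b c d * u a * conj (y b) * x c * conj (v d) := fun a =>
      Finset.sum_comm
    simp only [e, e']
    rw [Finset.sum_comm]
    refine Finset.sum_congr rfl fun a _ => Finset.sum_congr rfl fun b _ =>
      Finset.sum_congr rfl fun c _ => Finset.sum_congr rfl fun d _ => by rw [h1]; ring
  · intro x y u v
    simp only [quartic]
    refine Finset.sum_congr rfl fun a _ => ?_
    have e : ∀ b : Fin N, ∑ c, ∑ d, T a b c d * x a * conj (y b) * u c * conj (v d) =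
        ∑ d, ∑ c, T a b c d * x a * conj (y b) * u c * conj (v d) := fun a =>
      Finset.sum_comm
    have e' : ∀ b : Fin N, ∑ c, ∑ d, T a b c d * x a * conj (v b) * u c * conj (y d) =
        ∑ d, ∑ c, T a b c d * x a * conj (v b) * u c * conj (y d) := fun a =>
      Finset.sum_comm
    simp only [e, e']
    rw [Finset.sum_comm]
    refine Finset.sum_congr rfl fun b _ => Finset.sum_congr rfl fun c _ =>
      Finset.sum_congr rfl fun d _ => by rw [h2]; ring

/-- The non-null vectors of a nondegenerate Hermitian form are dense away from the origin. -/
theorem mem_closure_nonnull {H : Matrix (Fin N) (Fin N) ℂ} (hH : ∀ a b, H a b = conj (H b a))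
    (hdet : IsUnit H.det) {v : Cn N} (hv : v ≠ 0) :
    v ∈ closure {v : Cn N | ∑ a, ∑ b, H a b * v a * conj (v b) ≠ 0} := by
  let Q : Cn N → Cn N → ℂ := fun v w => ∑ a, ∑ b, H a b * v a * conj (w b)
  have hadd1 : ∀ v v' w, Q (v + v') w = Q v w + Q v' w := fun v v' w => by
    simp only [Q, ← Finset.sum_add_distrib, Pi.add_apply]
    exact Finset.sum_congr rfl fun a _ => Finset.sum_congr rfl fun b _ => by ring
  have hadd2 : ∀ v w w', Q v (w + w') = Q v w + Q v w' := fun v w w' => by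
    simp only [Q, ← Finset.sum_add_distrib, Pi.add_apply, map_add]
    exact Finset.sum_congr rfl fun a _ => Finset.sum_congr rfl fun b _ => by ring
  have hsm1 : ∀ (t : ℂ) v w, Q (t • v) w = t * Q v w := fun t v w => by
    simp only [Q, Finset.mul_sum, Pi.smul_apply, smul_eq_mul]
    exact Finset.sum_congr rfl fun a _ => Finset.sum_congr rfl fun b _ => by ring
  have hsm2 : ∀ (t : ℂ) v w, Q v (t • w) = conj t * Q v w := fun t v w => by
    simp only [Q, Finset.mul_sum, Pi.smul_apply, smul_eq_mul, map_mul]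
    exact Finset.sum_congr rfl fun a _ => Finset.sum_congr rfl fun b _ => by ring
  have hconj : ∀ v w, Q w v = conj (Q v w) := fun v w => by
    simp only [Q, map_sum, map_mul, Complex.conj_conj]
    rw [Finset.sum_comm]
    exact Finset.sum_congr rfl fun a _ => Finset.sum_congr rfl fun b _ => by rw [← hH]; ring
  by_contra hcl
  have hev : ∀ᶠ x in 𝓝 v, Q x x = 0 := by
    have := isClosed_closure.isOpen_compl.mem_nhds hcl
    filter_upwards [this] with x hx
    by_contra h
    exact hx (subset_closure h)
  -- If the form vanishes near v, comparing its values at v ± t w isolates the part linear in t.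
  -- Using both w and i w then gives `Q v w = 0`, so v lies in the radical, against nondegeneracy.
  have hre : ∀ w, Q v w + Q w v = 0 := by
    intro w
    have ht : Filter.Tendsto (fun t : ℂ => v + t • w) (𝓝 0) (𝓝 v) := by
      have : Continuous fun t : ℂ => v + t • w := by fun_prop
      simpa using this.tendsto 0
    have ht' : Filter.Tendsto (fun t : ℂ => v + (-t) • w) (𝓝 0) (𝓝 v) := by
      have : Continuous fun t : ℂ => v + (-t) • w := by fun_prop
      simpa using this.tendsto 0
    obtain ⟨ε, hε, he⟩ := Metric.eventually_nhds_iff_ball.1 ((ht.eventually hev).and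
      (ht'.eventually hev))
    have hm : ((ε / 2 : ℝ) : ℂ) ∈ Metric.ball (0 : ℂ) ε := by
      rw [mem_ball_zero_iff, Complex.norm_real, Real.norm_of_nonneg (by positivity)]
      linarith
    obtain ⟨e1, e2⟩ := he _ hm
    simp only [hadd1, hadd2, hsm1, hsm2, map_neg, Complex.conj_ofReal] at e1 e2
    have hne : (2 * ((ε / 2 : ℝ) : ℂ)) ≠ 0 := by
      simpa using hε.ne'
    apply (mul_eq_zero.1 (?_ : (2 * ((ε / 2 : ℝ) : ℂ)) * (Q v w + Q w v) = 0)).resolve_left hne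
    linear_combination e1 - e2
  have hz : ∀ w, Q v w = 0 := by
    intro w
    have e1 := hre w
    have e2 := hre (Complex.I • w)
    rw [hsm1, hsm2, Complex.conj_I] at e2
    have : Complex.I * (Q w v - Q v w) = 0 := by linear_combination e2
    have := (mul_eq_zero.1 this).resolve_left Complex.I_ne_zero
    linear_combination e1 / 2 - this / 2
  apply hv
  have hvec : Matrix.vecMul v H = 0 := by
    funext b
    have := hz (Pi.single b 1)
    simp only [Q] at this
    rw [Finset.sum_comm, Finset.sum_eq_single b (by intro i _ hi; simp [hi]) (by simp)] at this
    rw [Matrix.vecMul, dotProduct]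
    simpa [mul_comm] using this
  have hinj := Matrix.vecMul_injective_of_isUnit ((Matrix.isUnit_iff_isUnit_det H).2 hdet)
  exact hinj (by simpa using hvec)

end Polarization

/-! ### Smoothness of determinants and inverse matrices -/

section SmoothMatrix

variable {n : ℕ} {m : Type*} [Fintype m] [DecidableEq m] {U : Set (Cn n)}
  {A : Cn n → Matrix m m ℂ}

theorem contDiffOn_det (hA : ∀ i j, ContDiffOn ℝ ∞ (fun z => A z i j) U) :
    ContDiffOn ℝ ∞ (fun z => (A z).det) U := by
  simp only [Matrix.det_apply]
  refine ContDiffOn.sum fun σ _ => ContDiffOn.const_smul _ ?_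
  exact contDiffOn_prod fun i _ => hA _ _

theorem contDiffOn_inv_apply (hA : ∀ i j, ContDiffOn ℝ ∞ (fun z => A z i j) U)
    (hdet : ∀ z ∈ U, IsUnit (A z).det) (i j : m) :
    ContDiffOn ℝ ∞ (fun z => (A z)⁻¹ i j) U := by
  simp only [Matrix.inv_def, Matrix.smul_apply, Matrix.adjugate_apply, Ring.inverse_eq_inv',
    smul_eq_mul]
  refine ((contDiffOn_det hA).inv fun z hz => (hdet z hz).ne_zero).mul (contDiffOn_det ?_)
  intro k l
  simp only [Matrix.updateRow_apply]
  split_ifs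
  · exact contDiffOn_const
  · exact hA k l

end SmoothMatrix

/-! ### Curvature tensor and Christoffel symbols of a space form -/

section Curvature

variable {n : ℕ} {M : Type*} [TopologicalSpace M] [ChartedSpace (Cn n) M]
  (g : PseudoKahlerMetric n M) {e : OpenPartialHomeomorph M (Cn n)}

theorem coeff_conj (a b : Fin n) (z : Cn n) :
    coeff g.form e a b z = conj (coeff g.form e b a z) := g.hermitian _ _ _

theorem form_mfderiv_symm (z v w : Cn n) :
    g.form (e.symm z) (mfderiv 𝓘(ℂ, Cn n) 𝓘(ℂ, Cn n) e.symm z w)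
      (mfderiv 𝓘(ℂ, Cn n) 𝓘(ℂ, Cn n) e.symm z v) =
    ∑ a, ∑ b, coeff g.form e a b z * v a * conj (w b) := by
  have hsum : ∀ v : Cn n, v = ∑ a, v a • (Pi.single a 1 : Cn n) := fun v => by
    ext k
    simp [Pi.single_apply]
  let A : Cn n →L[ℂ] TangentSpace 𝓘(ℂ, Cn n) (e.symm z) :=
    mfderiv 𝓘(ℂ, Cn n) 𝓘(ℂ, Cn n) e.symm z
  have hA : ∀ v : Cn n, A v = ∑ a, v a • A (Pi.single a 1) := fun v => by
    conv_lhs => rw [hsum v, map_sum]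
    simp only [map_smul]
  change g.form (e.symm z) (A w) (A v) = _
  rw [hA v, hA w]
  simp only [map_sum, LinearMap.sum_apply, map_smul, LinearMap.map_smulₛₗ, LinearMap.smul_apply,
    smul_eq_mul, Finset.mul_sum]
  refine Finset.sum_congr rfl fun a _ => Finset.sum_congr rfl fun b _ => ?_
  simp only [coeff]
  change v a * (conj (w b) * g.form (e.symm z) (A (Pi.single b 1)) (A (Pi.single a 1))) =
    g.form (e.symm z) (A (Pi.single b 1)) (A (Pi.single a 1)) * v a * conj (w b)
  ring

theorem mdifferentiable_of_mem_maximalAtlas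
    (he : e ∈ IsManifold.maximalAtlas 𝓘(ℂ, Cn n) ω M) :
    e.MDifferentiable 𝓘(ℂ, Cn n) 𝓘(ℂ, Cn n) :=
  ⟨(contMDiffOn_of_mem_maximalAtlas he).mdifferentiableOn (by simp),
    (contMDiffOn_symm_of_mem_maximalAtlas he).mdifferentiableOn (by simp)⟩

theorem isUnit_det_matrix (he : e ∈ IsManifold.maximalAtlas 𝓘(ℂ, Cn n) ω M) {z : Cn n}
    (hz : z ∈ e.target) : IsUnit (g.matrix e z).det := by
  rw [← Matrix.isUnit_iff_isUnit_det, ← Matrix.vecMul_injective_iff_isUnit]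
  have hm := (mdifferentiable_of_mem_maximalAtlas he).symm
  refine (injective_iff_map_eq_zero (g.matrix e z).vecMulLinear).2 fun v hv => ?_
  have hv' : ∀ b, ∑ a, coeff g.form e a b z * v a = 0 := fun b => by
    have := congrFun hv b
    simpa [Matrix.vecMul, dotProduct, PseudoKahlerMetric.matrix, mul_comm] using this
  have h1 : mfderiv 𝓘(ℂ, Cn n) 𝓘(ℂ, Cn n) e.symm z v = 0 := by
    refine g.nondegenerate _ _ fun w => ?_
    obtain ⟨w, rfl⟩ := hm.mfderiv_surjective hz w
    have h2 := form_mfderiv_symm g (e := e) z v w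
    rw [Finset.sum_comm] at h2
    simp only [← Finset.sum_mul, hv', zero_mul, Finset.sum_const_zero] at h2
    exact (g.hermitian _ _ _).trans ((congrArg conj h2).trans (map_zero _))
  exact hm.mfderiv_injective hz (h1.trans (map_zero _).symm)

variable (e) in
/-- The Christoffel symbol `Γ^c_{da} = ∑_r (∂h_{a r̄}/∂z_d) h^{r̄ c}`. -/
def christoffel (d a c : Fin n) (z : Cn n) : ℂ :=
  ∑ r, dz d (coeff g.form e a r) z * (g.matrix e z)⁻¹ r c

theorem contDiffOn_christoffel (he : e ∈ IsManifold.maximalAtlas 𝓘(ℂ, Cn n) ω M)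
    (d a c : Fin n) : ContDiffOn ℝ ∞ (christoffel g e d a c) e.target :=
  ContDiffOn.sum fun r _ => (contDiffOn_dz _ (g.smooth e he a r) e.open_target).mul
    (contDiffOn_inv_apply (fun i j => g.smooth e he i j) (fun _ hz => isUnit_det_matrix g he hz)
      r c)

theorem sum_christoffel_mul_coeff (he : e ∈ IsManifold.maximalAtlas 𝓘(ℂ, Cn n) ω M) {z : Cn n}
    (hz : z ∈ e.target) (d a b : Fin n) :
    ∑ c, christoffel g e d a c z * coeff g.form e c b z = dz d (coeff g.form e a b) z := by
  have h := Matrix.nonsing_inv_mul _ (isUnit_det_matrix g he hz)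
  simp only [christoffel, Finset.sum_mul]
  rw [Finset.sum_comm]
  have h1 : ∀ r, ∑ c, dz d (coeff g.form e a r) z * (g.matrix e z)⁻¹ r c * coeff g.form e c b z =
      dz d (coeff g.form e a r) z * (1 : Matrix (Fin n) (Fin n) ℂ) r b := fun r => by
    rw [← h, Matrix.mul_apply, Finset.mul_sum]
    exact Finset.sum_congr rfl fun c _ => by simp [PseudoKahlerMetric.matrix, mul_assoc]
  simp [h1, Matrix.one_apply]

theorem dzbar_coeff (he : e ∈ IsManifold.maximalAtlas 𝓘(ℂ, Cn n) ω M) {z : Cn n}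
    (hz : z ∈ e.target) (a b d : Fin n) :
    dzbar d (coeff g.form e a b) z = dzbar b (coeff g.form e a d) z := by
  have h : ∀ b, coeff g.form e a b = fun z => conj (coeff g.form e b a z) := fun b =>
    funext fun z => coeff_conj g a b z
  have hd : ∀ b, DifferentiableAt ℝ (coeff g.form e b a) z := fun b =>
    differentiableAt_of_contDiffOn (g.smooth e he b a) e.open_target hz
  rw [h b, h d, dzbar_conj _ (hd b), dzbar_conj _ (hd d), g.closed e he z hz]

theorem curvature_symm_left (he : e ∈ IsManifold.maximalAtlas 𝓘(ℂ, Cn n) ω M) {z : Cn n}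
    (hz : z ∈ e.target) (a b c d : Fin n) :
    g.curvature e a b c d z = g.curvature e c b a d z := by
  have hs : ∀ a b, ContDiffAt ℝ ∞ (coeff g.form e a b) z := fun a b =>
    (g.smooth e he a b).contDiffAt (e.open_target.mem_nhds hz)
  have h1 : dz c (dzbar d (coeff g.form e a b)) z = dz a (dzbar d (coeff g.form e c b)) z := by
    rw [dz_dzbar_comm _ _ (hs a b), dz_dzbar_comm _ _ (hs c b)]
    exact dzbar_congr_on d e.open_target (fun y hy => g.closed e he y hy a b c) hz
  simp only [PseudoKahlerMetric.curvature, h1, g.closed e he z hz a _ c]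

theorem curvature_symm_right (he : e ∈ IsManifold.maximalAtlas 𝓘(ℂ, Cn n) ω M) {z : Cn n}
    (hz : z ∈ e.target) (a b c d : Fin n) :
    g.curvature e a b c d z = g.curvature e a d c b z := by
  have h1 : dz c (dzbar d (coeff g.form e a b)) z = dz c (dzbar b (coeff g.form e a d)) z :=
    dz_congr_on c e.open_target (fun y hy => dzbar_coeff g he hy a b d) hz
  simp only [PseudoKahlerMetric.curvature, h1, dzbar_coeff g he hz _ b d]

/-- The curvature tensor of a complex space form. -/
theorem curvature_eq {k : ℝ} (hg : g.IsComplexSpaceForm (2 * (2 * k)))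
    (he : e ∈ IsManifold.maximalAtlas 𝓘(ℂ, Cn n) ω M) {z : Cn n}
    (hz : z ∈ e.target) (a b c d : Fin n) :
    g.curvature e a b c d z = k * (coeff g.form e a b z * coeff g.form e c d z +
      coeff g.form e a d z * coeff g.form e c b z) := by
  let T : Fin n → Fin n → Fin n → Fin n → ℂ := fun a b c d => g.curvature e a b c d z -
    k * (coeff g.form e a b z * coeff g.form e c d z +
      coeff g.form e a d z * coeff g.form e c b z)
  have hT : ∀ v, quartic T v v v v = ∑ a, ∑ b, ∑ c, ∑ d,
      g.curvature e a b c d z * v a * conj (v b) * v c * conj (v d) -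
      2 * k * g.normSq e z v ^ 2 := by
    intro v
    have e1 : g.normSq e z v ^ 2 = ∑ a, ∑ b, ∑ c, ∑ d, coeff g.form e a b z *
        coeff g.form e c d z * v a * conj (v b) * v c * conj (v d) := by
      rw [sq, PseudoKahlerMetric.normSq, Finset.sum_mul]
      refine Finset.sum_congr rfl fun a _ => ?_
      rw [Finset.sum_mul]
      refine Finset.sum_congr rfl fun b _ => ?_
      rw [Finset.mul_sum]
      refine Finset.sum_congr rfl fun c _ => ?_
      rw [Finset.mul_sum]
      exact Finset.sum_congr rfl fun d _ => by ring
    have e2 : g.normSq e z v ^ 2 = ∑ a, ∑ b, ∑ c, ∑ d, coeff g.form e a d z *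
        coeff g.form e c b z * v a * conj (v b) * v c * conj (v d) := by
      rw [e1]
      refine Finset.sum_congr rfl fun a _ => ?_
      rw [Finset.sum_comm]
      conv_rhs => rw [Finset.sum_comm]
      refine Finset.sum_congr rfl fun c _ => ?_
      rw [Finset.sum_comm]
      exact Finset.sum_congr rfl fun d _ => Finset.sum_congr rfl fun b _ => by ring
    have e3 : 2 * (k : ℂ) * g.normSq e z v ^ 2 =
        k * g.normSq e z v ^ 2 + k * g.normSq e z v ^ 2 := by ring
    rw [e3]
    conv_rhs => enter [2, 1]; rw [e1]
    conv_rhs => enter [2, 2]; rw [e2]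
    simp only [quartic, T, Finset.mul_sum, ← Finset.sum_add_distrib, ← Finset.sum_sub_distrib]
    exact Finset.sum_congr rfl fun a _ => Finset.sum_congr rfl fun b _ =>
      Finset.sum_congr rfl fun c _ => Finset.sum_congr rfl fun d _ => by ring
  -- Sectional curvature 2 R(v, v̄, v, v̄)/h(v, v)² = 4k means R(v, v̄, v, v̄) = 2k h(v, v)².
  have hnn : ∀ v, g.normSq e z v ≠ 0 → quartic T v v v v = 0 := by
    intro v hv
    have h1 := hg e he z hz v hv
    rw [PseudoKahlerMetric.holSecCurv, div_eq_iff (pow_ne_zero 2 hv)] at h1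
    rw [hT]
    push_cast at h1
    linear_combination h1 / 2
  have hcont : Continuous fun v => quartic T v v v v := by
    simp only [quartic]
    fun_prop
  have key := quartic_eq_zero (T := T) (fun a b c d => ?_) (fun a b c d => ?_) (fun v => ?_) a b c d
  · exact sub_eq_zero.1 key
  · simp only [T]
    rw [curvature_symm_left g he hz]
    ring
  · simp only [T]
    rw [curvature_symm_right g he hz]
    ring
  · by_cases hv : v = 0
    · simp [hv, quartic]
    -- The curvature hypothesis is silent on null vectors; they are reached by continuity from
    -- non-null ones.
    · have hcl := mem_closure_nonnull (H := g.matrix e z) (fun a b => coeff_conj g a b z)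
        (isUnit_det_matrix g he hz) hv
      have hclosed : IsClosed {v | quartic T v v v v = 0} :=
        isClosed_singleton.preimage hcont
      exact hclosed.closure_subset_iff.2 (fun v hv => hnn v hv) hcl

/-- The `∂̄`-derivative of the Christoffel symbols of a complex space form. -/
theorem dzbar_christoffel {k : ℝ} (hg : g.IsComplexSpaceForm (2 * (2 * k)))
    (he : e ∈ IsManifold.maximalAtlas 𝓘(ℂ, Cn n) ω M) {z : Cn n}
    (hz : z ∈ e.target) (d a c f : Fin n) :
    dzbar f (christoffel g e d a c) z = -k * ((if c = a then 1 else 0) * coeff g.form e d f z +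
      (if c = d then 1 else 0) * coeff g.form e a f z) := by
  have hs : ∀ a b, ContDiffAt ℝ ∞ (coeff g.form e a b) z := fun a b =>
    (g.smooth e he a b).contDiffAt (e.open_target.mem_nhds hz)
  have hsd : ∀ a b, DifferentiableAt ℝ (coeff g.form e a b) z := fun a b =>
    differentiableAt_of_contDiffOn (g.smooth e he a b) e.open_target hz
  have hcd : ∀ c, DifferentiableAt ℝ (christoffel g e d a c) z := fun c =>
    differentiableAt_of_contDiffOn (contDiffOn_christoffel g he d a c) e.open_target hz
  -- Applying ∂̄_f to Γ·h = ∂h and comparing with the definition of R gives (∂̄_f Γ)·h = -R; the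
  -- invertible matrix h is cancelled afterwards.
  have key : ∀ b, ∑ c, dzbar f (christoffel g e d a c) z * coeff g.form e c b z =
      -k * (coeff g.form e a b z * coeff g.form e d f z +
      coeff g.form e a f z * coeff g.form e d b z) := by
    intro b
    have h1 := dzbar_congr_on f e.open_target
      (fun y hy => sum_christoffel_mul_coeff g he hy d a b) hz
    rw [dzbar_sum _ _ fun c _ => (hcd c).fun_mul (hsd c b)] at h1
    simp only [dzbar_mul _ (hcd _) (hsd _ b), Finset.sum_add_distrib] at h1
    have h2 := curvature_eq g hg he hz a b d f
    rw [PseudoKahlerMetric.curvature, dz_dzbar_comm _ _ (hs a b)] at h2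
    have h3 : ∑ c, christoffel g e d a c z * dzbar f (coeff g.form e c b) z =
        ∑ r, ∑ s, dz d (coeff g.form e a r) z * (g.matrix e z)⁻¹ r s *
          dzbar f (coeff g.form e s b) z := by
      rw [Finset.sum_comm]
      simp only [christoffel, Finset.sum_mul]
    change _ = dzbar f (dz d (coeff g.form e a b)) z at h1
    linear_combination h1 - h2 - h3
  have hinj := Matrix.vecMul_injective_of_isUnit
    ((Matrix.isUnit_iff_isUnit_det _).2 (isUnit_det_matrix g he hz))
  have h4 : (fun c => dzbar f (christoffel g e d a c) z) = fun c =>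
      -k * ((if c = a then 1 else 0) * coeff g.form e d f z +
      (if c = d then 1 else 0) * coeff g.form e a f z) := by
    apply hinj
    funext b
    simp only [Matrix.vecMul, dotProduct, PseudoKahlerMetric.matrix, Matrix.of_apply]
    rw [key]
    simp only [mul_add, add_mul, Finset.sum_add_distrib, mul_ite, ite_mul, mul_zero,
      one_mul, zero_mul, Finset.sum_ite_eq', Finset.mem_univ, if_true]
    ring
  exact congrFun h4 c

end Curvature

/-! ### The connection on ℂ ⊕ φ*TS and its Gram matrices -/

section FlatBundle

variable {n N : ℕ}

/-- The Hermitian pairing `∑ H_{c d̄} ξ_c η̄_d`. -/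
def pairing (H : Fin N → Fin N → Cn n → ℂ) (ξ η : Fin N → Cn n → ℂ) (z : Cn n) : ℂ :=
  ∑ c, ∑ d, H c d z * ξ c z * conj (η d z)

/-- The local data of a holomorphic map into a complex space form of holomorphic sectional
curvature `4k`: the pulled back metric `H` and connection `Γ`, the derivatives `ψ` of the map, a
potential `D` of the induced metric, and `Q = exp (k D)`. -/
structure SpaceFormData (k : ℝ) (U : Set (Cn n)) (H : Fin N → Fin N → Cn n → ℂ)
    (Γ : Fin n → Fin N → Fin N → Cn n → ℂ) (ψ : Fin n → Fin N → Cn n → ℂ) (D Q : Cn n → ℂ) :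
    Prop where
  isOpen : IsOpen U
  smooth_H : ∀ c d, ContDiffOn ℝ ∞ (H c d) U
  smooth_Γ : ∀ a e c, ContDiffOn ℝ ∞ (Γ a e c) U
  smooth_ψ : ∀ a c, ContDiffOn ℝ ∞ (ψ a c) U
  smooth_D : ContDiffOn ℝ ∞ D U
  smooth_Q : ContDiffOn ℝ ∞ Q U
  conj_H : ∀ c d z, H c d z = conj (H d c z)
  conj_Q : ∀ z ∈ U, conj (Q z) = Q z
  dz_H : ∀ a c d, ∀ z ∈ U, dz a (H c d) z = ∑ e, Γ a c e z * H e d z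
  dzbar_Γ : ∀ a b e c, ∀ z ∈ U, dzbar b (Γ a e c) z =
    -k * ((if c = e then 1 else 0) * pairing H (ψ a) (ψ b) z +
      ψ a c z * ∑ f, H e f z * conj (ψ b f z))
  dzbar_ψ : ∀ a b c, ∀ z ∈ U, dzbar b (ψ a c) z = 0
  dz_dzbar_D : ∀ a b, ∀ z ∈ U, dz a (dzbar b D) z = pairing H (ψ a) (ψ b) z
  dz_Q : ∀ a, ∀ z ∈ U, dz a Q z = k * dz a D z * Q z

/-- Sections of the trivial bundle of rank `1 + N`. -/
abbrev Section (n N : ℕ) : Type := (Cn n → ℂ) × (Fin N → Cn n → ℂ)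

/-- The `(1, 0)`-part of the flat connection. -/
def connection (k : ℝ) (Γ : Fin n → Fin N → Fin N → Cn n → ℂ) (ψ : Fin n → Fin N → Cn n → ℂ)
    (D : Cn n → ℂ) (a : Fin n) (V : Section n N) : Section n N :=
  (fun z => dz a V.1 z + k * dz a D z * V.1 z,
    fun c z => dz a (V.2 c) z + ∑ e, Γ a e c z * V.2 e z + k * dz a D z * V.2 c z +
      k * V.1 z * ψ a c z)

/-- Smooth sections that are holomorphic for the flat connection. -/
structure IsHolSection (U : Set (Cn n)) (H : Fin N → Fin N → Cn n → ℂ)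
    (ψ : Fin n → Fin N → Cn n → ℂ) (V : Section n N) : Prop where
  smooth_fst : ContDiffOn ℝ ∞ V.1 U
  smooth_snd : ∀ c, ContDiffOn ℝ ∞ (V.2 c) U
  dzbar_fst : ∀ b, ∀ z ∈ U, dzbar b V.1 z = pairing H V.2 (ψ b) z
  dzbar_snd : ∀ b c, ∀ z ∈ U, dzbar b (V.2 c) z = 0

/-- The Hermitian form preserved by the flat connection. -/
def flatForm (k : ℝ) (H : Fin N → Fin N → Cn n → ℂ) (Q : Cn n → ℂ) (V W : Section n N)
    (z : Cn n) : ℂ :=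
  Q z * (k * V.1 z * conj (W.1 z) + pairing H V.2 W.2 z)

variable {k : ℝ} {U : Set (Cn n)} {H : Fin N → Fin N → Cn n → ℂ}
  {Γ : Fin n → Fin N → Fin N → Cn n → ℂ} {ψ : Fin n → Fin N → Cn n → ℂ} {D Q : Cn n → ℂ}

namespace SpaceFormData

variable (h : SpaceFormData k U H Γ ψ D Q)

include h

theorem conj_pairing (ξ η : Fin N → Cn n → ℂ) (z : Cn n) :
    conj (pairing H ξ η z) = pairing H η ξ z := by
  simp only [pairing, map_sum, map_mul, Complex.conj_conj]
  rw [Finset.sum_comm]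
  exact Finset.sum_congr rfl fun c _ => Finset.sum_congr rfl fun d _ => by
    rw [← h.conj_H]; ring

/-- Γ is the Chern connection of H, and ∂ kills the conjugate of a holomorphic η, so only ξ is
differentiated. -/
theorem dz_pairing {ξ η : Fin N → Cn n → ℂ} (hξ : ∀ c, ContDiffOn ℝ ∞ (ξ c) U)
    (hη : ∀ c, ContDiffOn ℝ ∞ (η c) U) (hη' : ∀ b c, ∀ z ∈ U, dzbar b (η c) z = 0) (a : Fin n)
    {z : Cn n} (hz : z ∈ U) :
    dz a (pairing H ξ η) z =
      pairing H (fun c z => dz a (ξ c) z + ∑ e, Γ a e c z * ξ e z) η z := by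
  have dH : ∀ c d, DifferentiableAt ℝ (H c d) z := fun c d =>
    differentiableAt_of_contDiffOn (h.smooth_H c d) h.isOpen hz
  have dξ : ∀ c, DifferentiableAt ℝ (ξ c) z := fun c =>
    differentiableAt_of_contDiffOn (hξ c) h.isOpen hz
  have dη : ∀ c, DifferentiableAt ℝ (η c) z := fun c =>
    differentiableAt_of_contDiffOn (hη c) h.isOpen hz
  have dη' : ∀ c, DifferentiableAt ℝ (fun z => conj (η c z)) z := fun c =>
    differentiableAt_of_contDiffOn (contDiffOn_conj (hη c)) h.isOpen hz
  have h1 : dz a (pairing H ξ η) z = ∑ c, ∑ d, ((∑ e, Γ a c e z * H e d z) * ξ c z +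
      H c d z * dz a (ξ c) z) * conj (η d z) := by
    have e0 : pairing H ξ η = fun z => ∑ c, ∑ d, H c d z * ξ c z * conj (η d z) := rfl
    rw [e0, dz_sum _ _ fun c _ => DifferentiableAt.fun_sum fun d _ =>
      ((dH c d).fun_mul (dξ c)).fun_mul (dη' d)]
    refine Finset.sum_congr rfl fun c _ => ?_
    rw [dz_sum _ _ fun d _ => ((dH c d).fun_mul (dξ c)).fun_mul (dη' d)]
    refine Finset.sum_congr rfl fun d _ => ?_
    rw [dz_mul _ ((dH c d).fun_mul (dξ c)) (dη' d), dz_mul _ (dH c d) (dξ c), dz_conj _ (dη d),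
      hη' a d z hz, h.dz_H a c d z hz, map_zero, mul_zero, add_zero]
  have h2 : ∑ c, ∑ d, (∑ e, Γ a c e z * H e d z) * ξ c z * conj (η d z) =
      ∑ e, ∑ d, H e d z * (∑ c, Γ a c e z * ξ c z) * conj (η d z) := by
    simp only [Finset.sum_mul, Finset.mul_sum]
    have e1 : ∀ c, ∑ d, ∑ e, Γ a c e z * H e d z * ξ c z * conj (η d z) =
        ∑ e, ∑ d, Γ a c e z * H e d z * ξ c z * conj (η d z) := fun c => Finset.sum_comm
    simp only [e1]
    rw [Finset.sum_comm]
    refine Finset.sum_congr rfl fun e _ => ?_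
    rw [Finset.sum_comm]
    exact Finset.sum_congr rfl fun d _ => Finset.sum_congr rfl fun c _ => by ring
  rw [h1]
  simp only [pairing, add_mul, mul_add, Finset.sum_add_distrib] at h2 ⊢
  rw [h2, add_comm]

theorem dzbar_dz_D (a b : Fin n) {z : Cn n} (hz : z ∈ U) :
    dzbar b (dz a D) z = pairing H (ψ a) (ψ b) z := by
  rw [← dz_dzbar_comm _ _ (h.smooth_D.contDiffAt (h.isOpen.mem_nhds hz)), h.dz_dzbar_D a b z hz]

/-- When k ≠ 0 this section is 1/k times the covariant derivative of the constant section (1, 0); in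
this form it also serves k = 0. -/
theorem isHolSection_start (a : Fin n) : IsHolSection U H ψ (dz a D, ψ a) where
  smooth_fst := contDiffOn_dz _ h.smooth_D h.isOpen
  smooth_snd := h.smooth_ψ a
  dzbar_fst := fun b _ hz => h.dzbar_dz_D a b hz
  dzbar_snd := h.dzbar_ψ a

/-- The mixed curvature vanishes. In the second component `dzbar_Γ` contributes -k (⟨ψ_a, ψ_b⟩ V +
⟨V, ψ_b⟩ ψ_a), while ∂̄_b of the factors k ∂_a D and k V.1 contributes exactly the opposite. -/
theorem isHolSection_connection {V : Section n N} (hV : IsHolSection U H ψ V) (a : Fin n) :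
    IsHolSection U H ψ (connection k Γ ψ D a V) := by
  have hDa := contDiffOn_dz a h.smooth_D h.isOpen
  have hV1 := contDiffOn_dz a hV.smooth_fst h.isOpen
  have hV2 := fun c => contDiffOn_dz a (hV.smooth_snd c) h.isOpen
  have sk : ContDiffOn ℝ ∞ (fun z => (k : ℂ) * dz a D z) U := contDiffOn_const.mul hDa
  have sV1 : ContDiffOn ℝ ∞ (fun z => (k : ℂ) * V.1 z) U := contDiffOn_const.mul hV.smooth_fst
  have sΓ : ∀ c, ContDiffOn ℝ ∞ (fun z => ∑ e, Γ a e c z * V.2 e z) U := fun c =>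
    ContDiffOn.sum fun e _ => (h.smooth_Γ a e c).mul (hV.smooth_snd e)
  refine ⟨hV1.add (sk.mul hV.smooth_fst), fun c => (((hV2 c).add (sΓ c)).add
    (sk.mul (hV.smooth_snd c))).add (sV1.mul (h.smooth_ψ a c)), fun b z hz => ?_,
    fun b c z hz => ?_⟩
  all_goals
    have dif : ∀ {f : Cn n → ℂ}, ContDiffOn ℝ ∞ f U → DifferentiableAt ℝ f z := fun hf =>
      differentiableAt_of_contDiffOn hf h.isOpen hz
    have cdf : ∀ {f : Cn n → ℂ}, ContDiffOn ℝ ∞ f U → ContDiffAt ℝ ∞ f z := fun hf =>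
      hf.contDiffAt (h.isOpen.mem_nhds hz)
  · simp only [connection]
    rw [dzbar_add _ (dif hV1) ((dif sk).fun_mul (dif hV.smooth_fst)),
      dzbar_mul _ (dif sk) (dif hV.smooth_fst), dzbar_const_mul _ _ (dif hDa),
      h.dzbar_dz_D a b hz, hV.dzbar_fst b z hz, ← dz_dzbar_comm _ _ (cdf hV.smooth_fst),
      dz_congr_on a h.isOpen (fun y hy => hV.dzbar_fst b y hy) hz,
      h.dz_pairing hV.smooth_snd (h.smooth_ψ b) (h.dzbar_ψ b) a hz]
    simp only [pairing, Finset.mul_sum, Finset.sum_mul, ← Finset.sum_add_distrib]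
    refine Finset.sum_congr rfl fun c _ => Finset.sum_congr rfl fun d _ => ?_
    ring
  · simp only [connection]
    rw [dzbar_add _ (((dif (hV2 c)).fun_add (dif (sΓ c))).fun_add
      ((dif sk).fun_mul (dif (hV.smooth_snd c)))) ((dif sV1).fun_mul (dif (h.smooth_ψ a c))),
      dzbar_add _ ((dif (hV2 c)).fun_add (dif (sΓ c))) ((dif sk).fun_mul (dif (hV.smooth_snd c))),
      dzbar_add _ (dif (hV2 c)) (dif (sΓ c)),
      dzbar_mul _ (dif sk) (dif (hV.smooth_snd c)), dzbar_const_mul _ _ (dif hDa),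
      dzbar_mul _ (dif sV1) (dif (h.smooth_ψ a c)), dzbar_const_mul _ _ (dif hV.smooth_fst),
      dzbar_sum _ _ fun e _ => (dif (h.smooth_Γ a e c)).fun_mul (dif (hV.smooth_snd e)),
      h.dzbar_dz_D a b hz, hV.dzbar_fst b z hz, hV.dzbar_snd b c z hz, h.dzbar_ψ a b c z hz,
      ← dz_dzbar_comm _ _ (cdf (hV.smooth_snd c)),
      dz_congr_on a h.isOpen (g := fun _ => 0) (fun y hy => hV.dzbar_snd b c y hy) hz, dz_const]
    have e1 : ∀ e, dzbar b (fun z => Γ a e c z * V.2 e z) z =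
        -k * ((if c = e then V.2 e z else 0) * pairing H (ψ a) (ψ b) z) +
        -k * ψ a c z * (∑ f, H e f z * V.2 e z * conj (ψ b f z)) := fun e => by
      rw [dzbar_mul _ (dif (h.smooth_Γ a e c)) (dif (hV.smooth_snd e)), hV.dzbar_snd b e z hz,
        h.dzbar_Γ a b e c z hz]
      have : ∑ f, H e f z * V.2 e z * conj (ψ b f z) =
          (∑ f, H e f z * conj (ψ b f z)) * V.2 e z := by
        rw [Finset.sum_mul]
        exact Finset.sum_congr rfl fun f _ => by ring
      rw [this]
      split_ifs <;> ring
    simp only [e1, Finset.sum_add_distrib, ← Finset.mul_sum, ← Finset.sum_mul, Finset.sum_ite_eq,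
      Finset.mem_univ, if_true]
    change _ + (_ + -k * ψ a c z * pairing H V.2 (ψ b) z) + _ + _ = _
    ring

theorem conj_flatForm (V W : Section n N) {z : Cn n} (hz : z ∈ U) :
    conj (flatForm k H Q V W z) = flatForm k H Q W V z := by
  simp only [flatForm, map_mul, map_add, h.conj_pairing, h.conj_Q z hz, Complex.conj_conj,
    Complex.conj_ofReal]
  ring

theorem contDiffOn_flatForm {V W : Section n N} (hV : IsHolSection U H ψ V)
    (hW : IsHolSection U H ψ W) : ContDiffOn ℝ ∞ (flatForm k H Q V W) U :=
  h.smooth_Q.mul (((contDiffOn_const.mul hV.smooth_fst).mul (contDiffOn_conj hW.smooth_fst)).add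
    (ContDiffOn.sum fun c _ => ContDiffOn.sum fun d _ => ((h.smooth_H c d).mul
      (hV.smooth_snd c)).mul (contDiffOn_conj (hW.smooth_snd d))))

/-- Compatibility of form and connection: no derivative of W survives because W is holomorphic. The
derivative of Q supplies the terms k ∂_a D, and that of conj W.1, which is ⟨ψ_a, W⟩, supplies the
term k V.1 ψ_a. -/
theorem dz_flatForm {V W : Section n N} (hV : IsHolSection U H ψ V) (hW : IsHolSection U H ψ W)
    (a : Fin n) {z : Cn n} (hz : z ∈ U) :
    dz a (flatForm k H Q V W) z = flatForm k H Q (connection k Γ ψ D a V) W z := by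
  have dif : ∀ {f : Cn n → ℂ}, ContDiffOn ℝ ∞ f U → DifferentiableAt ℝ f z := fun hf =>
    differentiableAt_of_contDiffOn hf h.isOpen hz
  have s1 : ContDiffOn ℝ ∞ (fun z => (k : ℂ) * V.1 z) U := contDiffOn_const.mul hV.smooth_fst
  have s2 := contDiffOn_conj hW.smooth_fst
  have s3 : ContDiffOn ℝ ∞ (pairing H V.2 W.2) U :=
    ContDiffOn.sum fun c _ => ContDiffOn.sum fun d _ => ((h.smooth_H c d).mul
      (hV.smooth_snd c)).mul (contDiffOn_conj (hW.smooth_snd d))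
  have e0 : flatForm k H Q V W =
    fun z => Q z * ((k * V.1 z) * conj (W.1 z) + pairing H V.2 W.2 z) := rfl
  have e1 : conj (pairing H W.2 (ψ a) z) = pairing H (ψ a) W.2 z := h.conj_pairing _ _ _
  have e2 : pairing H (connection k Γ ψ D a V).2 W.2 z =
      pairing H (fun c z => dz a (V.2 c) z + ∑ e, Γ a e c z * V.2 e z) W.2 z +
      k * dz a D z * pairing H V.2 W.2 z + k * V.1 z * pairing H (ψ a) W.2 z := by
    simp only [pairing, connection, Finset.mul_sum, ← Finset.sum_add_distrib]
    exact Finset.sum_congr rfl fun c _ => Finset.sum_congr rfl fun d _ => by ring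
  rw [e0, dz_mul _ (dif h.smooth_Q) (((dif s1).fun_mul (dif s2)).fun_add (dif s3)),
    dz_add _ ((dif s1).fun_mul (dif s2)) (dif s3), dz_mul _ (dif s1) (dif s2),
    dz_const_mul _ _ (dif hV.smooth_fst), dz_conj _ (dif hW.smooth_fst), hW.dzbar_fst a z hz,
    h.dz_Q a z hz, h.dz_pairing hV.smooth_snd hW.smooth_snd hW.dzbar_snd a hz, e1, flatForm, e2]
  simp only [connection]
  ring

theorem dzbar_flatForm {V W : Section n N} (hV : IsHolSection U H ψ V)
    (hW : IsHolSection U H ψ W) (a : Fin n) {z : Cn n} (hz : z ∈ U) :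
    dzbar a (flatForm k H Q V W) z = flatForm k H Q V (connection k Γ ψ D a W) z := by
  rw [dzbar_congr_on a h.isOpen (g := fun z => conj (flatForm k H Q W V z))
    (fun y hy => (h.conj_flatForm W V hy).symm) hz,
    dzbar_conj _ (differentiableAt_of_contDiffOn (h.contDiffOn_flatForm hW hV) h.isOpen hz),
    h.dz_flatForm hW hV a hz, h.conj_flatForm _ _ hz]

omit h in
variable (k Γ ψ D) in
/-- Iterated covariant derivatives, the head of the list first. -/
def iterConnection : List (Fin n) → Section n N → Section n N
  | [], V => V
  | a :: l, V => iterConnection l (connection k Γ ψ D a V)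

-- Derivatives in z act on V and derivatives in w on W. Holomorphy persists under the connection, so
-- the rule can be iterated without ever producing mixed terms.
omit h in
theorem diag_iterDir {r : ℝ} (h : SpaceFormData k (Metric.ball 0 r) H Γ ψ D Q)
    (l m : List (Fin n)) {G : Cn n × Cn n → ℂ} (hG : AnalyticOnNhd ℂ G (Metric.ball 0 r))
    {V W : Section n N} (hV : IsHolSection (Metric.ball 0 r) H ψ V)
    (hW : IsHolSection (Metric.ball 0 r) H ψ W)
    (hd : Set.EqOn (diag G) (flatForm k H Q V W) (Metric.ball 0 r)) :
    Set.EqOn (diag (iterDir (l.map vz) (iterDir (m.map vw) G)))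
      (flatForm k H Q (iterConnection k Γ ψ D l V) (iterConnection k Γ ψ D m W))
      (Metric.ball 0 r) := by
  induction m generalizing G W with
  | nil =>
    induction l generalizing G V with
    | nil => exact hd
    | cons a l ih =>
      refine ih (h.isHolSection_connection hV a) (analyticOnNhd_dirDeriv hG (vz a))
        fun z hz => ?_
      change diag (dirDeriv (vz a) G) z = _
      rw [← (dz_diag (hG _ (mem_ball_diag hz)) a).1, dz_congr_on a h.isOpen hd hz,
        h.dz_flatForm hV hW a hz]
  | cons b m ih =>
    refine ih (analyticOnNhd_dirDeriv hG (vw b)) (h.isHolSection_connection hW b)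
      fun z hz => ?_
    rw [← (dz_diag (hG _ (mem_ball_diag hz)) b).2, dzbar_congr_on b h.isOpen hd hz,
      h.dzbar_flatForm hV hW b hz]

omit h in
/-- The matrix of Taylor coefficients is a Gram matrix in a space of dimension `1 + N`. -/
theorem isFiniteRank {r : ℝ} (hr : 0 < r) (h : SpaceFormData k (Metric.ball 0 r) H Γ ψ D Q)
    {F : Cn n × Cn n → ℂ} (hF : AnalyticOnNhd ℂ F (Metric.ball 0 r))
    (hF0 : ∀ z ∈ Metric.ball (0 : Cn n) r, F (z, 0) = 0 ∧ F (0, z) = 0)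
    (hd : ∀ a b, Set.EqOn (diag (dirDeriv (vz a) (dirDeriv (vw b) F)))
      (flatForm k H Q (dz a D, ψ a) (dz b D, ψ b)) (Metric.ball 0 r)) :
    IsFiniteRank r F := by
  have h0 : (0 : Cn n) ∈ Metric.ball (0 : Cn n) r := Metric.mem_ball_self hr
  have h00 : (0 : Cn n × Cn n) ∈ Metric.ball (0 : Cn n × Cn n) r := Metric.mem_ball_self hr
  have hzero : ∀ (l : List (Cn n)) (f : Cn n → ℂ), Set.EqOn f 0 (Metric.ball 0 r) →
      iterDir l f 0 = 0 := by
    intro l f hf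
    rw [iterDir_congr_on Metric.isOpen_ball l
      (g := fun x => ∑ i ∈ (∅ : Finset ℕ), (0 : ℂ) * (0 : Cn n → ℂ) x) (fun y hy => by simp [hf hy]) h0,
      iterDir_finsetSum Metric.isOpen_ball ∅ _ l (F := fun _ => 0) (by simp) h0]
    simp
  -- The empty list receives the zero section, matching the absence of pure terms in F. Otherwise
  -- one derivative on each side is spent on reaching ∂_a ∂̄_b F, and the rest act as covariant
  -- derivatives.
  let sec : List (Fin n) → Section n N
    | [] => (0, 0)
    | a :: l => iterConnection k Γ ψ D l (dz a D, ψ a)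
  refine isFiniteRank_of_jets (ι := Option (Fin N)) hr hF
    (fun l i => i.elim ((sec l).1 0) fun c => (sec l).2 c 0)
    (fun m i => i.elim (Q 0 * (k * conj ((sec m).1 0)))
      fun c => Q 0 * ∑ d, H c d 0 * conj ((sec m).2 d 0)) fun l m => ?_
  have key : ∀ l m, iterDir (l.map vz) (iterDir (m.map vw) F) 0 =
      flatForm k H Q (sec l) (sec m) 0 := by
    intro l m
    rcases l with _ | ⟨a, l⟩
    · have e1 := iterDir_right hF h0 m h0
      rw [hzero _ _ fun w hw => (hF0 w hw).2] at e1
      have e2 : flatForm k H Q (sec []) (sec m) 0 = 0 := by simp [flatForm, sec, pairing]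
      rw [e2]
      exact e1.symm
    rcases m with _ | ⟨b, m⟩
    · have e1 := iterDir_left hF h0 (a :: l) h0
      rw [hzero _ _ fun w hw => (hF0 w hw).1] at e1
      have e2 : flatForm k H Q (sec (a :: l)) (sec []) 0 = 0 := by simp [flatForm, sec, pairing]
      rw [e2]
      exact e1.symm
    · have hFb := analyticOnNhd_dirDeriv hF (vw b)
      have e1 := diag_iterDir h l m (analyticOnNhd_dirDeriv hFb (vz a)) (h.isHolSection_start a)
        (h.isHolSection_start b) (hd a b) h0
      simp only [diag, star_zero] at e1
      refine Eq.trans ?_ e1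
      exact iterDir_congr_on Metric.isOpen_ball (l.map vz)
        (dirDeriv_iterDir_comm Metric.isOpen_ball hFb (vz a) (m.map vw)) h00
  rw [key, Fintype.sum_option, flatForm, pairing]
  simp only [Option.elim, mul_add, Finset.mul_sum]
  congr 1
  · ring
  · exact Finset.sum_congr rfl fun c _ => Finset.sum_congr rfl fun d _ => by ring

end SpaceFormData

end FlatBundle

/-! ### Conjugates of analytic functions -/

section ConjAnalytic

variable {n : ℕ}

/-- The multilinear form `conj (p(x̄_1, …, x̄_m))`. -/
def conjForm {m : ℕ} (p : ContinuousMultilinearMap ℂ (fun _ : Fin m => Cn n) ℂ) :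
    ContinuousMultilinearMap ℂ (fun _ : Fin m => Cn n) ℂ where
  toFun x := conj (p fun i => star (x i))
  map_update_add' x i u v := by
    have hu : ∀ [DecidableEq (Fin m)] (w : Cn n), (fun j => star (Function.update x i w j)) =
        Function.update (fun j => star (x j)) i (star w) := fun w => by
      funext j
      by_cases hj : j = i
      · subst hj; simp
      · simp [hj]
    rw [hu, hu, hu, star_add, p.map_update_add, map_add]
  map_update_smul' x i c v := by
    have hu : ∀ [DecidableEq (Fin m)] (w : Cn n), (fun j => star (Function.update x i w j)) =
        Function.update (fun j => star (x j)) i (star w) := fun w => by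
      funext j
      by_cases hj : j = i
      · subst hj; simp
      · simp [hj]
    rw [hu, hu, star_smul, p.map_update_smul]
    simp
  cont := by
    have := p.cont
    fun_prop

/-- Conjugating the Taylor coefficients preserves their norms, hence the radius. This turns a factor
g(w) at w = z̄ into the conjugate of a holomorphic function of z. -/
theorem analyticAt_conj_star {g : Cn n → ℂ} (hg : AnalyticAt ℂ g 0) :
    AnalyticAt ℂ (fun z => conj (g (star z))) 0 := by
  obtain ⟨p, R, hp⟩ := hg
  refine ⟨fun m => conjForm (p m), R, ⟨?_, hp.r_pos, fun {y} hy => ?_⟩⟩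
  · refine hp.r_le.trans ?_
    refine ENNReal.le_of_forall_nnreal_lt fun r hr => ?_
    obtain ⟨C, -, hC⟩ := p.norm_mul_pow_le_of_lt_radius hr
    refine FormalMultilinearSeries.le_radius_of_bound _ C fun m => ?_
    refine le_trans ?_ (hC m)
    gcongr
    refine ContinuousMultilinearMap.opNorm_le_bound (norm_nonneg _) fun x => ?_
    change ‖conj (p m fun i => star (x i))‖ ≤ _
    rw [RCLike.norm_conj]
    refine (ContinuousMultilinearMap.le_opNorm _ _).trans (le_of_eq ?_)
    simp
  · have hy' : star y ∈ Metric.eball (0 : Cn n) R := by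
      simpa [Metric.mem_eball, edist_zero_right, enorm] using hy
    have h1 := hp.hasSum hy'
    rw [zero_add] at h1 ⊢
    exact Complex.conjCLE.toContinuousLinearMap.hasSum h1

end ConjAnalytic

/-! ### The exponential kernel -/

section ExpKernel

variable {n : ℕ} {r : ℝ}

theorem dirDeriv_cexp_mul {E : Type*} [NormedAddCommGroup E] [NormedSpace ℂ E] {F : E → ℂ} {x : E}
    (hF : DifferentiableAt ℂ F x) (k : ℂ) (v : E) :
    dirDeriv v (fun x => Complex.exp (k * F x)) x =
      k * (Complex.exp (k * F x) * dirDeriv v F x) := by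
  rw [dirDeriv, ((hF.hasFDerivAt.const_mul k).cexp).fderiv]
  simp [dirDeriv]
  ring

theorem dirDeriv_mul {E : Type*} [NormedAddCommGroup E] [NormedSpace ℂ E] {F G : E → ℂ} {x : E}
    (hF : DifferentiableAt ℂ F x) (hG : DifferentiableAt ℂ G x) (v : E) :
    dirDeriv v (fun x => F x * G x) x = dirDeriv v F x * G x + F x * dirDeriv v G x := by
  simp only [dirDeriv, fderiv_fun_mul hF hG, add_apply, smul_apply, smul_eq_mul]
  ring

/-- The kernel `(exp (k F₀) - 1) / k`, to be read as `F₀` for `k = 0`. -/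
theorem exists_exp_kernel (k : ℝ) {F₀ : Cn n × Cn n → ℂ}
    (hF₀ : AnalyticOnNhd ℂ F₀ (Metric.ball 0 r)) :
    ∃ F : Cn n × Cn n → ℂ, AnalyticOnNhd ℂ F (Metric.ball 0 r) ∧
      (∀ x, Complex.exp (k * F₀ x) = 1 + k * F x) ∧ (∀ x, F₀ x = 0 → F x = 0) ∧
      (k = 0 → F = F₀) ∧ ∀ v, ∀ x ∈ Metric.ball (0 : Cn n × Cn n) r,
        dirDeriv v F x = Complex.exp (k * F₀ x) * dirDeriv v F₀ x := by
  by_cases hk : k = 0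
  · subst hk
    exact ⟨F₀, hF₀, by simp, fun _ h => h, fun _ => rfl, by simp⟩
  · have hk' : (k : ℂ) ≠ 0 := by exact_mod_cast hk
    have hexp : AnalyticOnNhd ℂ (fun x => Complex.exp (k * F₀ x)) (Metric.ball 0 r) := fun x hx =>
      (analyticAt_const.mul (hF₀ x hx)).cexp
    refine ⟨fun x => (k : ℂ)⁻¹ * (Complex.exp (k * F₀ x) - 1),
      analyticOnNhd_const.mul (hexp.sub analyticOnNhd_const), fun x => ?_, fun x hx => ?_,
      fun h => absurd h hk, fun v x hx => ?_⟩
    · field_simp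
      ring
    · simp [hx]
    · have h1 := dirDeriv_cexp_mul (hF₀ x hx).differentiableAt k v
      have h2 : dirDeriv v (fun x => (k : ℂ)⁻¹ * (Complex.exp (k * F₀ x) - 1)) x =
          (k : ℂ)⁻¹ * dirDeriv v (fun x => Complex.exp (k * F₀ x)) x := by
        simp only [dirDeriv]
        rw [fderiv_const_mul ((hexp x hx).differentiableAt.sub_const 1), fderiv_sub_const]
        simp
      rw [h2, h1]
      field_simp

/-- The Taylor coefficients `∂²F/∂z_a∂w_b` of a Bochner kernel are pure of the form `δ_{ab}`. -/
theorem dirDeriv_dirDeriv_bochner {F₀ : Cn n × Cn n → ℂ} (hr : 0 < r)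
    (hF₀ : AnalyticOnNhd ℂ F₀ (Metric.ball 0 r))
    (hF₁ : ∀ z ∈ Metric.ball (0 : Cn n) r, ∀ a, dirDeriv (vw a) F₀ (z, 0) = z a ∧
      dirDeriv (vz a) F₀ (0, z) = z a) (a b : Fin n) {z : Cn n} (hz : z ∈ Metric.ball 0 r) :
    dirDeriv (vz a) (dirDeriv (vw b) F₀) (z, 0) = (if a = b then 1 else 0) ∧
      dirDeriv (vz a) (dirDeriv (vw b) F₀) (0, z) = (if a = b then 1 else 0) := by
  have h0 : (0 : Cn n) ∈ Metric.ball (0 : Cn n) r := Metric.mem_ball_self hr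
  have hc : ∀ (a b : Fin n), dirDeriv (Pi.single a 1) (fun z : Cn n => z b) z =
      if a = b then 1 else 0 := fun a b => by
    have h : (fun z : Cn n => z b) = (ContinuousLinearMap.proj b : Cn n →L[ℂ] ℂ) := rfl
    rw [dirDeriv, h, ContinuousLinearMap.fderiv]
    simp [Pi.single_apply, eq_comm]
  constructor
  · rw [vz, ← dirDeriv_left (analyticOnNhd_dirDeriv hF₀ _ _ (mem_ball_prod.2 ⟨hz, h0⟩)),
      dirDeriv_congr_on Metric.isOpen_ball (g := fun z => z b) (fun y hy => (hF₁ y hy b).1) _ hz,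
      hc]
  · rw [dirDeriv_comm (hF₀ _ (mem_ball_prod.2 ⟨h0, hz⟩)), vw,
      ← dirDeriv_right (analyticOnNhd_dirDeriv hF₀ _ _ (mem_ball_prod.2 ⟨h0, hz⟩)),
      dirDeriv_congr_on Metric.isOpen_ball (g := fun z => z a) (fun y hy => (hF₁ y hy a).2) _ hz,
      hc]
    simp [eq_comm]

end ExpKernel

/-! ### Space form data of a holomorphic map -/

section Coordinates

variable {n N : ℕ} {S : Type*} [TopologicalSpace S] [ChartedSpace (Cn N) S]

theorem contDiffOn_real_of_analytic {E F : Type*} [NormedAddCommGroup E] [NormedSpace ℂ E]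
    [NormedAddCommGroup F] [NormedSpace ℂ F] [CompleteSpace F] {f : E → F} {U : Set E}
    (hU : IsOpen U) (hf : AnalyticOnNhd ℂ f U) : ContDiffOn ℝ ∞ f U :=
  (hf.analyticOn.contDiffOn (n := ∞) hU.uniqueDiffOn).restrict_scalars ℝ

theorem dz_exp {f : Cn n → ℂ} {z : Cn n} (hf : DifferentiableAt ℝ f z) (k : ℂ) (a : Fin n) :
    dz a (fun z => Complex.exp (k * f z)) z = k * dz a f z * Complex.exp (k * f z) := by
  have h : fderiv ℝ (fun z => Complex.exp (k * f z)) z = Complex.exp (k * f z) •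
      (k • fderiv ℝ f z) := ((hf.hasFDerivAt.const_mul k).cexp).fderiv
  simp only [dz, h, smul_apply, smul_eq_mul]
  ring

/-- The local data of a holomorphic map into a complex space form. -/
theorem spaceFormData_of_map (gc : PseudoKahlerMetric N S) {k : ℝ}
    (hgc : gc.IsComplexSpaceForm (2 * (2 * k))) {e : OpenPartialHomeomorph S (Cn N)}
    (he : e ∈ IsManifold.maximalAtlas 𝓘(ℂ, Cn N) ω S) {U : Set (Cn n)} (hU : IsOpen U)
    {f : Cn n → Cn N} (hf : AnalyticOnNhd ℂ f U) (hfU : Set.MapsTo f U e.target) {D : Cn n → ℂ}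
    (hD : ContDiffOn ℝ ∞ D U) (hDr : ∀ z ∈ U, conj (D z) = D z)
    (hDd : ∀ a b, ∀ z ∈ U, dz a (dzbar b D) z =
      ∑ c, ∑ d, coeff gc.form e c d (f z) * fderiv ℂ f z (Pi.single a 1) c *
        conj (fderiv ℂ f z (Pi.single b 1) d)) :
    SpaceFormData k U (fun c d z => coeff gc.form e c d (f z))
      (fun a i c z => ∑ d, christoffel gc e d i c (f z) * fderiv ℂ f z (Pi.single a 1) d)
      (fun a c z => fderiv ℂ f z (Pi.single a 1) c) D (fun z => Complex.exp (k * D z)) := by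
  have sf := contDiffOn_real_of_analytic hU hf
  have aψ : ∀ (a : Fin n) c, AnalyticOnNhd ℂ (fun z => fderiv ℂ f z (Pi.single a 1) c) U :=
    fun a c z hz => (((ContinuousLinearMap.proj (R := ℂ) (φ := fun _ : Fin N => ℂ) c).comp
      (ContinuousLinearMap.apply ℂ (Cn N) (Pi.single a 1 : Cn n))).analyticAt _).comp
        (hf.fderiv z hz)
  have sψ : ∀ (a : Fin n) c, ContDiffOn ℝ ∞ (fun z => fderiv ℂ f z (Pi.single a 1) c) U :=
    fun a c => contDiffOn_real_of_analytic hU (aψ a c)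
  have sΓ : ∀ d i c, ContDiffOn ℝ ∞ (fun z => christoffel gc e d i c (f z)) U := fun d i c =>
    (contDiffOn_christoffel gc he d i c).comp sf hfU
  have hψ : ∀ b a c, ∀ z ∈ U, dzbar b (fun z => fderiv ℂ f z (Pi.single a 1) c) z = 0 :=
    fun b a c z hz => (dz_of_differentiableAt b (aψ a c z hz).differentiableAt).2
  refine ⟨hU, fun c d => (gc.smooth e he c d).comp sf hfU,
    fun a i c => ContDiffOn.sum fun d _ => (sΓ d i c).mul (sψ a d), sψ, hD,
    (contDiffOn_const.mul hD).cexp, fun c d z => coeff_conj gc c d _, fun z hz => ?_,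
    fun a c d z hz => ?_, fun a b i c z hz => ?_, fun a b c z hz => hψ b a c z hz, hDd,
    fun a z hz => dz_exp (differentiableAt_of_contDiffOn hD hU hz) k a⟩
  · rw [← Complex.exp_conj, map_mul, hDr z hz, Complex.conj_ofReal]
  · rw [(dz_comp a (differentiableAt_of_contDiffOn (gc.smooth e he c d) e.open_target (hfU hz))
      (hf z hz).differentiableAt).1]
    simp only [← sum_christoffel_mul_coeff gc he (hfU hz), Finset.sum_mul]
    rw [Finset.sum_comm]
    exact Finset.sum_congr rfl fun i _ => Finset.sum_congr rfl fun j _ => by ring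
  · have dΓ : ∀ d, DifferentiableAt ℝ (fun z => christoffel gc e d i c (f z)) z := fun d =>
      differentiableAt_of_contDiffOn (sΓ d i c) hU hz
    have dψ : ∀ d, DifferentiableAt ℝ (fun z => fderiv ℂ f z (Pi.single a 1) d) z := fun d =>
      differentiableAt_of_contDiffOn (sψ a d) hU hz
    -- The derivatives of f are holomorphic, so ∂̄ only meets Γ ∘ f, where the chain rule and the
    -- space form formula apply.
    rw [dzbar_sum _ _ fun d _ => (dΓ d).fun_mul (dψ d)]
    have e1 : ∀ d, dzbar b (fun z => christoffel gc e d i c (f z) *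
        fderiv ℂ f z (Pi.single a 1) d) z = ∑ j,
        -k * ((if c = i then 1 else 0) * (coeff gc.form e d j (f z) *
          fderiv ℂ f z (Pi.single a 1) d * conj (fderiv ℂ f z (Pi.single b 1) j)) +
        (if c = d then fderiv ℂ f z (Pi.single a 1) d else 0) * (coeff gc.form e i j (f z) *
          conj (fderiv ℂ f z (Pi.single b 1) j))) := by
      intro d
      rw [dzbar_mul _ (dΓ d) (dψ d), hψ b a d z hz, mul_zero, add_zero,
        (dz_comp b (differentiableAt_of_contDiffOn (contDiffOn_christoffel gc he d i c)
          e.open_target (hfU hz)) (hf z hz).differentiableAt).2, Finset.sum_mul]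
      refine Finset.sum_congr rfl fun j _ => ?_
      rw [dzbar_christoffel gc hgc he (hfU hz)]
      split_ifs <;> ring
    simp only [e1, pairing, ← Finset.mul_sum, Finset.sum_add_distrib, ← Finset.sum_mul,
      Finset.sum_ite_eq, Finset.mem_univ, if_true]

end Coordinates

/-! ### The induced metric in charts -/

section Pullback

variable {n N : ℕ} {M : Type*} [TopologicalSpace M] [ChartedSpace (Cn n) M]
  {S : Type*} [TopologicalSpace S] [ChartedSpace (Cn N) S]

theorem form_congr (g : PseudoKahlerMetric N S) {x y : S} (h : x = y) (v w : Cn N) :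
    g.form x v w = g.form y v w := by
  subst h
  rfl

/-- The pulled back metric in coordinates. -/
theorem coeff_pullback {g : PseudoKahlerMetric n M} {gc : PseudoKahlerMetric N S} {φ : M → S}
    (hφ : IsKahlerImmersion g gc φ) {e : OpenPartialHomeomorph M (Cn n)}
    (he : e ∈ IsManifold.maximalAtlas 𝓘(ℂ, Cn n) ω M) {e' : OpenPartialHomeomorph S (Cn N)}
    (he' : e' ∈ IsManifold.maximalAtlas 𝓘(ℂ, Cn N) ω S) {z : Cn n} (hz : z ∈ e.target)
    (hz' : φ (e.symm z) ∈ e'.source) :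
    AnalyticAt ℂ (fun z => e' (φ (e.symm z))) z ∧ ∀ a b, coeff g.form e a b z =
      ∑ c, ∑ d, coeff gc.form e' c d (e' (φ (e.symm z))) *
        fderiv ℂ (fun z => e' (φ (e.symm z))) z (Pi.single a 1) c *
        conj (fderiv ℂ (fun z => e' (φ (e.symm z))) z (Pi.single b 1) d) := by
  set f : Cn n → Cn N := fun z => e' (φ (e.symm z)) with hfdef
  have m1 : ContMDiffAt 𝓘(ℂ, Cn n) 𝓘(ℂ, Cn n) ω e.symm z := contMDiffAt_symm_of_mem_maximalAtlas
    he hz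
  have m2 : ContMDiffAt 𝓘(ℂ, Cn n) 𝓘(ℂ, Cn N) ω (fun z => φ (e.symm z)) z :=
    (hφ.1 (e.symm z)).comp z m1
  have m3 : ContMDiffAt 𝓘(ℂ, Cn n) 𝓘(ℂ, Cn N) ω f z :=
    (contMDiffAt_of_mem_maximalAtlas he' hz').comp z m2
  have hfa : AnalyticAt ℂ f z := (contMDiffAt_iff_contDiffAt.1 m3).analyticAt
  refine ⟨hfa, fun a b => ?_⟩
  have hfz : f z ∈ e'.target := e'.map_source hz'
  have hback : e'.symm (f z) = φ (e.symm z) := e'.left_inv hz'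
  have m4 : MDifferentiableAt 𝓘(ℂ, Cn N) 𝓘(ℂ, Cn N) e'.symm (f z) :=
    (contMDiffAt_symm_of_mem_maximalAtlas he' hfz).mdifferentiableAt (by simp)
  have hev : (fun z => φ (e.symm z)) =ᶠ[𝓝 z] fun z => e'.symm (f z) := by
    have := m2.continuousAt.preimage_mem_nhds (e'.open_source.mem_nhds hz')
    filter_upwards [this] with y hy
    exact (e'.left_inv hy).symm
  have c1 : mfderiv 𝓘(ℂ, Cn n) 𝓘(ℂ, Cn N) (fun z => φ (e.symm z)) z =
      (mfderiv 𝓘(ℂ, Cn n) 𝓘(ℂ, Cn N) φ (e.symm z)).comp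
        (mfderiv 𝓘(ℂ, Cn n) 𝓘(ℂ, Cn n) e.symm z) :=
    mfderiv_comp z ((hφ.1 (e.symm z)).mdifferentiableAt (by simp)) (m1.mdifferentiableAt (by simp))
  have c2 : mfderiv 𝓘(ℂ, Cn n) 𝓘(ℂ, Cn N) (fun z => e'.symm (f z)) z =
      (mfderiv 𝓘(ℂ, Cn N) 𝓘(ℂ, Cn N) e'.symm (f z)).comp
        (mfderiv 𝓘(ℂ, Cn n) 𝓘(ℂ, Cn N) f z) :=
    mfderiv_comp z m4 (m3.mdifferentiableAt (by simp))
  have key : ∀ v : Cn n, (mfderiv 𝓘(ℂ, Cn n) 𝓘(ℂ, Cn N) φ (e.symm z)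
      (mfderiv 𝓘(ℂ, Cn n) 𝓘(ℂ, Cn n) e.symm z v) : Cn N) =
      mfderiv 𝓘(ℂ, Cn N) 𝓘(ℂ, Cn N) e'.symm (f z) (fderiv ℂ f z v) := by
    intro v
    have h1 : (mfderiv 𝓘(ℂ, Cn n) 𝓘(ℂ, Cn N) (fun z => φ (e.symm z)) z v : Cn N) =
        mfderiv 𝓘(ℂ, Cn n) 𝓘(ℂ, Cn N) (fun z => e'.symm (f z)) z v :=
      congrArg (fun L : Cn n →L[ℂ] Cn N => L v) hev.mfderiv_eq
    rw [c1, c2, mfderiv_eq_fderiv] at h1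
    exact h1
  have h2 := hφ.2 (e.symm z) (mfderiv 𝓘(ℂ, Cn n) 𝓘(ℂ, Cn n) e.symm z (Pi.single b (1 : ℂ) : Cn n))
    (mfderiv 𝓘(ℂ, Cn n) 𝓘(ℂ, Cn n) e.symm z (Pi.single a (1 : ℂ) : Cn n))
  rw [← form_mfderiv_symm gc (e := e') (f z)]
  refine h2.symm.trans ?_
  refine Eq.trans ?_ (form_congr gc hback.symm _ _)
  exact congrArg₂ (fun v w : Cn N => gc.form (φ (e.symm z)) v w) (key _) (key _)

end Pullback

/-! ### From finite-rank kernels to Λ̃ -/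

section Germs

variable {n : ℕ} {M : Type*} [TopologicalSpace M] [ChartedSpace (Cn n) M] {p : M}

theorem IsHolVanishing.add {f g : M → ℂ} (hf : IsHolVanishing n p f)
    (hg : IsHolVanishing n p g) : IsHolVanishing n p (fun x => f x + g x) := by
  refine ⟨?_, by simp [hf.2, hg.2]⟩
  have h : ContDiff ℂ ω (fun q : ℂ × ℂ => q.1 + q.2) := contDiff_fst.add contDiff_snd
  exact h.contMDiff.contMDiffAt.comp p (hf.1.prodMk_space hg.1)

theorem coe_mem_tildeLambda {F : M → ℂ} (hF : F ∈ tildeLambdaAdd n p) :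
    (F : Filter.Germ (𝓝 p) ℂ) ∈ tildeLambda n p := ⟨F, hF, rfl⟩

variable (n p) in
/-- The complexification `Λ̃_p + i Λ̃_p`. -/
def complexLambda : Subring (Filter.Germ (𝓝 p) ℂ) where
  carrier := {f | ∃ u ∈ tildeLambda n p, ∃ v ∈ tildeLambda n p,
    f = u + ((fun _ => Complex.I : M → ℂ) : Filter.Germ (𝓝 p) ℂ) * v}
  zero_mem' := ⟨0, zero_mem _, 0, zero_mem _, by simp⟩
  one_mem' := ⟨1, one_mem _, 0, zero_mem _, by simp⟩
  add_mem' := by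
    rintro _ _ ⟨u, hu, v, hv, rfl⟩ ⟨u', hu', v', hv', rfl⟩
    exact ⟨u + u', add_mem hu hu', v + v', add_mem hv hv', by ring⟩
  neg_mem' := by
    rintro _ ⟨u, hu, v, hv, rfl⟩
    exact ⟨-u, neg_mem hu, -v, neg_mem hv, by ring⟩
  mul_mem' := by
    rintro _ _ ⟨u, hu, v, hv, rfl⟩ ⟨u', hu', v', hv', rfl⟩
    have hI : ((fun _ => Complex.I : M → ℂ) : Filter.Germ (𝓝 p) ℂ) *
        ((fun _ => Complex.I : M → ℂ) : Filter.Germ (𝓝 p) ℂ) = -1 := by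
      rw [← Filter.Germ.coe_mul, ← Filter.Germ.coe_one, ← Filter.Germ.coe_neg]
      congr 1
      funext x
      simp
    refine ⟨u * u' - v * v', sub_mem (mul_mem hu hu') (mul_mem hv hv'), u * v' + v * u',
      add_mem (mul_mem hu hv') (mul_mem hv hu'), ?_⟩
    linear_combination (v * v') * hI

theorem const_mem_complexLambda (w : ℂ) :
    ((fun _ => w : M → ℂ) : Filter.Germ (𝓝 p) ℂ) ∈ complexLambda n p := by
  refine ⟨_, coe_mem_tildeLambda (const_mem_tildeLambdaAdd p w.re), _,
    coe_mem_tildeLambda (const_mem_tildeLambdaAdd p w.im), ?_⟩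
  rw [← Filter.Germ.coe_mul, ← Filter.Germ.coe_add]
  congr 1
  funext x
  simp [mul_comm Complex.I]

/-- Re(f k̄) = |(f + k)/2|² - |(f - k)/2|². -/
theorem re_mul_conj_mem {f k : M → ℂ} (hf : IsHolVanishing n p f) (hk : IsHolVanishing n p k) :
    (fun x => ((f x * conj (k x)).re : ℂ)) ∈ tildeLambdaAdd n p := by
  have h1 := normSq_mem_tildeLambdaAdd ((hf.add hk).const_mul (1 / 2))
  have h2 := normSq_mem_tildeLambdaAdd ((hf.add (hk.const_mul (-1))).const_mul (1 / 2))
  convert sub_mem h1 h2 using 1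
  funext x
  simp only [Pi.sub_apply]
  rw [← Complex.ofReal_sub]
  congr 1
  simp only [← Complex.normSq_eq_norm_sq, Complex.normSq_apply, Complex.mul_re, Complex.mul_im,
    Complex.add_re, Complex.add_im, Complex.conj_re, Complex.conj_im]
  norm_num
  ring

/-- The imaginary part of f k̄ is the real part of (-i f) k̄, so both parts lie in Λ̃. -/
theorem mul_conj_mem_complexLambda {f k : M → ℂ} (hf : IsHolVanishing n p f)
    (hk : IsHolVanishing n p k) :
    ((fun x => f x * conj (k x) : M → ℂ) : Filter.Germ (𝓝 p) ℂ) ∈ complexLambda n p := by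
  refine ⟨_, coe_mem_tildeLambda (re_mul_conj_mem hf hk), _,
    coe_mem_tildeLambda (re_mul_conj_mem (hf.const_mul (-Complex.I)) hk), ?_⟩
  rw [← Filter.Germ.coe_mul, ← Filter.Germ.coe_add]
  congr 1
  funext x
  have h : (-Complex.I * f x * conj (k x)).re = (f x * conj (k x)).im := by
    rw [mul_assoc]
    simp
  simp only [Pi.add_apply, Pi.mul_apply, h]
  rw [mul_comm Complex.I]
  exact (Complex.re_add_im _).symm

/-- Real-valued elements of `Λ̃_p + i Λ̃_p` lie in `Λ̃_p`. -/
theorem mem_tildeLambda_of_real {F : M → ℂ}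
    (hF : (F : Filter.Germ (𝓝 p) ℂ) ∈ complexLambda n p)
    (hr : ∀ᶠ x in 𝓝 p, conj (F x) = F x) : (F : Filter.Germ (𝓝 p) ℂ) ∈ tildeLambda n p := by
  obtain ⟨u, hu, v, hv, h⟩ := hF
  obtain ⟨A, hA, rfl⟩ := (mem_tildeLambda n).1 hu
  obtain ⟨B, hB, rfl⟩ := (mem_tildeLambda n).1 hv
  rw [← Filter.Germ.coe_mul, ← Filter.Germ.coe_add] at h
  have h' := Filter.Germ.coe_eq.1 h
  have : (F : Filter.Germ (𝓝 p) ℂ) = A := by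
    refine Filter.Germ.coe_eq.2 ?_
    filter_upwards [h', hr] with x hx hxr
    obtain ⟨a, m, α, l, -, -, -, hA⟩ := hA
    obtain ⟨a', m', α', l', -, -, -, hB⟩ := hB
    -- Elements of Λ̃ are real-valued, so B is the imaginary part of F and vanishes near p.
    have him : (F x).im = 0 := Complex.conj_eq_iff_im.1 hxr
    simp only [Pi.add_apply, Pi.mul_apply] at hx
    rw [hx, hA, hB] at him
    have hB0 : B x = 0 := by
      rw [hB]
      exact_mod_cast (by simpa using him : a' + signedNormSq l' α' x = 0)
    rw [hx, hB0]
    simp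
  rw [this]
  exact hu

/-- A kernel of finite rank without pure terms represents an element of `Λ̃_p + i Λ̃_p`. -/
theorem diag_mem_complexLambda {e : OpenPartialHomeomorph M (Cn n)}
    (he : e ∈ IsManifold.maximalAtlas 𝓘(ℂ, Cn n) ω M) (hp : p ∈ e.source) (hp0 : e p = 0) {r : ℝ}
    (hr : 0 < r) {G : Cn n × Cn n → ℂ} (hG : IsFiniteRank r G)
    (h1 : ∀ z ∈ Metric.ball (0 : Cn n) r, G (z, 0) = G 0)
    (h2 : ∀ w ∈ Metric.ball (0 : Cn n) r, G (0, w) = G 0) :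
    ((fun x => diag G (e x) : M → ℂ) : Filter.Germ (𝓝 p) ℂ) ∈ complexLambda n p := by
  obtain ⟨m, f, k, hf, hk, hf0, hk0, h⟩ := hG.exists_vanishing hr h1 h2
  have h0 : (0 : Cn n) ∈ Metric.ball (0 : Cn n) r := Metric.mem_ball_self hr
  have hol : ∀ f : Cn n → ℂ, AnalyticAt ℂ f 0 → f 0 = 0 → IsHolVanishing n p fun x => f (e x) := by
    intro f hf hf0
    refine ⟨?_, by simp [hp0, hf0]⟩
    have h3 : ContMDiffAt 𝓘(ℂ, Cn n) 𝓘(ℂ, ℂ) ω f (e p) := by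
      rw [hp0]
      exact contMDiffAt_iff_contDiffAt.2 hf.contDiffAt
    exact h3.comp p (contMDiffAt_of_mem_maximalAtlas he hp)
  -- The double conjugation displays k_i(z̄) as the conjugate of the holomorphic function z ↦
  -- conj(k_i(z̄)).
  have hev : ((fun x => diag G (e x) : M → ℂ) : Filter.Germ (𝓝 p) ℂ) =
      ((fun _ => G 0 : M → ℂ) : Filter.Germ (𝓝 p) ℂ) +
        ∑ i, ((fun x => f i (e x) * conj (conj (k i (star (e x)))) : M → ℂ) :
          Filter.Germ (𝓝 p) ℂ) := by
    have e1 : ∑ i, ((fun x => f i (e x) * conj (conj (k i (star (e x)))) : M → ℂ) :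
          Filter.Germ (𝓝 p) ℂ) = ((∑ i, fun x => f i (e x) * conj (conj (k i (star (e x)))) :
          M → ℂ) : Filter.Germ (𝓝 p) ℂ) :=
      (map_sum (Filter.Germ.coeRingHom (𝓝 p)) _ _).symm
    rw [e1, ← Filter.Germ.coe_add]
    refine Filter.Germ.coe_eq.2 ?_
    have hc : Filter.Tendsto e (𝓝 p) (𝓝 0) := hp0 ▸ e.continuousAt hp
    filter_upwards [hc.eventually (Metric.ball_mem_nhds 0 hr)] with x hx
    have hx' : star (e x) ∈ Metric.ball (0 : Cn n) r := (mem_ball_prod.1 (mem_ball_diag hx)).2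
    simp [diag, h _ hx _ hx', Finset.sum_apply]
  rw [hev]
  refine add_mem (const_mem_complexLambda _) (sum_mem fun i _ => ?_)
  exact mul_conj_mem_complexLambda (hol _ (hf i 0 h0) (hf0 i))
    (hol (fun z => conj (k i (star z))) (analyticAt_conj_star (hk i 0 h0)) (by simp [hk0]))

end Germs

/-! ### The kernels of a Kähler submanifold and the proposition -/

section Main

variable {n N : ℕ} {M : Type*} [TopologicalSpace M] [ChartedSpace (Cn n) M]
  {S : Type*} [TopologicalSpace S] [ChartedSpace (Cn N) S] [IsManifold 𝓘(ℂ, Cn N) ω S]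

/-- The polarised potential of a Kähler submanifold of a complex space form in Bochner
coordinates, and the kernel `(exp (k F₀) - 1) / k`. -/
theorem exists_kernels {g : PseudoKahlerMetric n M} {k : ℝ} {gc : PseudoKahlerMetric N S}
    (hgc : gc.IsComplexSpaceForm (2 * (2 * k))) {φ : M → S} (hφ : IsKahlerImmersion g gc φ)
    {p : M} {D : M → ℝ} (hD : g.IsDiastasis p D) {e : OpenPartialHomeomorph M (Cn n)}
    (he : IsBochnerChart p D e) :
    ∃ r > 0, ∃ F₀ F : Cn n × Cn n → ℂ, AnalyticOnNhd ℂ F₀ (Metric.ball 0 r) ∧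
      AnalyticOnNhd ℂ F (Metric.ball 0 r) ∧ IsFiniteRank r F ∧
      (∀ x, Complex.exp (k * F₀ x) = 1 + k * F x) ∧ (k = 0 → F = F₀) ∧
      (∀ v, ∀ x ∈ Metric.ball (0 : Cn n × Cn n) r,
        dirDeriv v F x = Complex.exp (k * F₀ x) * dirDeriv v F₀ x) ∧
      (∀ z ∈ Metric.ball (0 : Cn n) r, F₀ (z, 0) = 0 ∧ F₀ (0, z) = 0 ∧ F (z, 0) = 0 ∧
        F (0, z) = 0 ∧ ∀ a, dirDeriv (vw a) F₀ (z, 0) = z a ∧ dirDeriv (vz a) F₀ (0, z) = z a) ∧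
      (∀ z ∈ Metric.ball (0 : Cn n) r, (D (e.symm z) : ℂ) = diag F₀ z ∧
        g.matrix e z = complexHessian D e z ∧ ∀ a b,
        complexHessian D e z a b = diag (dirDeriv (vz a) (dirDeriv (vw b) F₀)) z) := by
  obtain ⟨hea, hp, hp0, B, hB, hBs⟩ := he
  obtain ⟨hmat, -⟩ := hD e hea hp hp0
  obtain ⟨r₀, hr₀, F₀, hF₀, hdiag, hpure⟩ := exists_bochner_kernel
    (f := fun z => (D (e.symm z) : ℂ)) hB (by
      filter_upwards [hBs] with z hz
      convert hz using 1
      push_cast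
      congr 1
      refine Finset.sum_congr rfl fun i _ => ?_
      rw [Complex.mul_conj, Complex.normSq_eq_norm_sq]
      norm_cast)
  let e' : OpenPartialHomeomorph S (Cn N) := chartAt (Cn N) (φ p)
  have he' : e' ∈ IsManifold.maximalAtlas 𝓘(ℂ, Cn N) ω S := IsManifold.chart_mem_maximalAtlas _
  have h0t : (0 : Cn n) ∈ e.target := hp0 ▸ e.map_source hp
  have hsymm0 : e.symm 0 = p := by rw [← hp0, e.left_inv hp]
  have hsrc : ∀ᶠ z in 𝓝 (0 : Cn n), φ (e.symm z) ∈ e'.source := by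
    have hc : ContinuousAt (fun z => φ (e.symm z)) 0 :=
      (hφ.1.continuous.continuousAt).comp (e.continuousAt_symm h0t)
    refine hc.preimage_mem_nhds (e'.open_source.mem_nhds ?_)
    rw [hsymm0]
    exact mem_chart_source _ _
  obtain ⟨r₁, hr₁, hball⟩ := Metric.eventually_nhds_iff_ball.1
    (hmat.and (hsrc.and (e.open_target.mem_nhds h0t)))
  set r := min r₀ r₁ with hr
  have hr0 : 0 < r := lt_min hr₀ hr₁
  have hb₀ : Metric.ball (0 : Cn n) r ⊆ Metric.ball 0 r₀ :=
    Metric.ball_subset_ball (min_le_left _ _)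
  have hb₁ : Metric.ball (0 : Cn n) r ⊆ Metric.ball 0 r₁ :=
    Metric.ball_subset_ball (min_le_right _ _)
  have hF₀r : AnalyticOnNhd ℂ F₀ (Metric.ball 0 r) := hF₀.mono (Metric.ball_subset_ball (min_le_left _ _))
  obtain ⟨F, hF, hexp, hzero, hk0, hder⟩ := exists_exp_kernel k hF₀r
  have hhess : ∀ z ∈ Metric.ball (0 : Cn n) r, ∀ a b,
      complexHessian D e z a b = diag (dirDeriv (vz a) (dirDeriv (vw b) F₀)) z := by
    intro z hz a b
    have h1 : Set.EqOn (dzbar b fun w => (D (e.symm w) : ℂ)) (diag (dirDeriv (vw b) F₀))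
        (Metric.ball 0 r) := fun y hy =>
      (dzbar_congr_on b Metric.isOpen_ball (fun w hw => hdiag w (hb₀ hw)) hy).trans
        (dz_diag (hF₀r _ (mem_ball_diag hy)) b).2
    exact (dz_congr_on a Metric.isOpen_ball h1 hz).trans
      (dz_diag (analyticOnNhd_dirDeriv hF₀r _ _ (mem_ball_diag hz)) a).1
  have hDsm : ContDiffOn ℝ ∞ (diag F₀) (Metric.ball 0 r) := contDiffOn_diag hF₀r
  have hDr : ∀ z ∈ Metric.ball (0 : Cn n) r, conj (diag F₀ z) = diag F₀ z := fun z hz => by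
    rw [← hdiag z (hb₀ hz), Complex.conj_ofReal]
  have hpull := fun z (hz : z ∈ Metric.ball (0 : Cn n) r) => coeff_pullback hφ hea he'
    (hball z (hb₁ hz)).2.2 (hball z (hb₁ hz)).2.1
  have hdd : ∀ a b, ∀ z ∈ Metric.ball (0 : Cn n) r, dz a (dzbar b (diag F₀)) z =
      diag (dirDeriv (vz a) (dirDeriv (vw b) F₀)) z := fun a b z hz =>
    (dz_congr_on a Metric.isOpen_ball (fun y hy => (dz_diag (hF₀r _ (mem_ball_diag hy)) b).2)
      hz).trans (dz_diag (analyticOnNhd_dirDeriv hF₀r _ _ (mem_ball_diag hz)) a).1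
  have hdata := spaceFormData_of_map gc hgc he' (U := Metric.ball (0 : Cn n) r)
    Metric.isOpen_ball (f := fun z => e' (φ (e.symm z)))
    (fun z hz => (hpull z hz).1) (fun z hz => e'.map_source (hball z (hb₁ hz)).2.1)
    hDsm hDr (fun a b z hz => by
      rw [hdd a b z hz, ← hhess z hz, ← (hball z (hb₁ hz)).1]
      exact (hpull z hz).2 a b)
  refine ⟨r, hr0, F₀, F, hF₀r, hF, ?_, hexp, hk0, hder, fun z hz => ?_, fun z hz =>
    ⟨hdiag z (hb₀ hz), (hball z (hb₁ hz)).1, hhess z hz⟩⟩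
  · refine hdata.isFiniteRank hr0 hF (fun z hz => ?_) fun a b z hz => ?_
    · obtain ⟨h1, h2, -⟩ := hpure z (hb₀ hz)
      exact ⟨hzero _ h1, hzero _ h2⟩
    · have hm := mem_ball_diag hz
      have hFb := analyticOnNhd_dirDeriv hF₀r (vw b)
      have hexpa : AnalyticOnNhd ℂ (fun x => Complex.exp (k * F₀ x)) (Metric.ball 0 r) :=
        fun x hx => (analyticAt_const.mul (hF₀r x hx)).cexp
      -- With D real, conj(∂_b D) = ∂̄_b D. So the form on the starting sections is exp(k D)(k ∂_a D
      -- ∂̄_b D + ∂_a ∂̄_b D), which is ∂_a∂_b F on w = z̄.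
      have hconj : conj (dz b (diag F₀) z) = diag (dirDeriv (vw b) F₀) z := by
        rw [← dzbar_conj _ (differentiableAt_of_contDiffOn hDsm Metric.isOpen_ball hz),
          dzbar_congr_on b Metric.isOpen_ball hDr hz]
        exact (dz_diag (hF₀r _ hm) b).2
      have e1 : dirDeriv (vz a) (dirDeriv (vw b) F) (z, star z) =
          dirDeriv (vz a) (fun x => Complex.exp (k * F₀ x) * dirDeriv (vw b) F₀ x)
            (z, star z) :=
        dirDeriv_congr_on Metric.isOpen_ball (fun x hx => hder (vw b) x hx) _ hm
      rw [dirDeriv_mul (hexpa _ hm).differentiableAt (hFb _ hm).differentiableAt,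
        dirDeriv_cexp_mul (hF₀r _ hm).differentiableAt] at e1
      rw [flatForm, ← hdata.dz_dzbar_D a b z hz, hdd a b z hz, hconj]
      simp only [(dz_diag (hF₀r _ hm) a).1]
      simp only [diag] at e1 ⊢
      rw [e1]
      ring
  · obtain ⟨h1, h2, h3⟩ := hpure z (hb₀ hz)
    exact ⟨h1, h2, hzero _ h1, hzero _ h2, h3⟩

theorem det_mem_complexLambda {m : Type*} [Fintype m] [DecidableEq m] {p : M}
    {A : M → Matrix m m ℂ}
    (hA : ∀ i j, ((fun x => A x i j : M → ℂ) : Filter.Germ (𝓝 p) ℂ) ∈ complexLambda n p) :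
    ((fun x => (A x).det : M → ℂ) : Filter.Germ (𝓝 p) ℂ) ∈ complexLambda n p := by
  have h : (fun x => (A x).det : M → ℂ) =
      ∑ σ : Equiv.Perm m, (Equiv.Perm.sign σ : ℤ) • ∏ i, fun x => A x (σ i) i := by
    funext x
    rw [Matrix.det_apply]
    simp only [Finset.sum_apply, Pi.smul_apply, Finset.prod_apply]
    rfl
  change Filter.Germ.coeRingHom (𝓝 p) _ ∈ _
  rw [h, map_sum]
  refine sum_mem fun σ _ => ?_
  rw [map_zsmul, map_prod]
  exact zsmul_mem (prod_mem fun i _ => hA _ _) _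

end Main

/-- The kernel `exp (k F₀)² ∂²F₀/∂z_a∂w_b` has finite rank together with `(exp (k F₀) - 1) / k`. -/
theorem isFiniteRank_hessian {n : ℕ} {r k : ℝ} {F₀ F : Cn n × Cn n → ℂ}
    (hF₀ : AnalyticOnNhd ℂ F₀ (Metric.ball 0 r)) (hF : AnalyticOnNhd ℂ F (Metric.ball 0 r))
    (hfr : IsFiniteRank r F) (hexp : ∀ x, Complex.exp (k * F₀ x) = 1 + k * F x)
    (hder : ∀ v, ∀ x ∈ Metric.ball (0 : Cn n × Cn n) r,
      dirDeriv v F x = Complex.exp (k * F₀ x) * dirDeriv v F₀ x) (a b : Fin n) :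
    IsFiniteRank r fun x =>
      Complex.exp (k * F₀ x) ^ 2 * dirDeriv (vz a) (dirDeriv (vw b) F₀) x := by
  have hFb := analyticOnNhd_dirDeriv hF₀ (vw b)
  -- The identity used is exp(2k F₀) ∂_a∂_b F₀ = (1 + kF) ∂_a∂_b F - k ∂_a F ∂_b F; the square of
  -- the exponential clears both denominators.
  refine (((isFiniteRank_const 1).add ((isFiniteRank_const (k : ℂ)).mul hfr)).mul
    ((hfr.dirDeriv_vw hF b).dirDeriv_vz (analyticOnNhd_dirDeriv hF _) a)).add
    ((isFiniteRank_const (-k : ℂ)).mul ((hfr.dirDeriv_vz hF a).mul (hfr.dirDeriv_vw hF b)))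
    |>.congr fun x hx => ?_
  have e1 : dirDeriv (vz a) (dirDeriv (vw b) F) x =
      dirDeriv (vz a) (fun x => Complex.exp (k * F₀ x) * dirDeriv (vw b) F₀ x) x :=
    dirDeriv_congr_on Metric.isOpen_ball (fun x hx => hder (vw b) x hx) _ hx
  have hexpa : AnalyticAt ℂ (fun x => Complex.exp (k * F₀ x)) x :=
    (analyticAt_const.mul (hF₀ x hx)).cexp
  rw [dirDeriv_mul hexpa.differentiableAt
    (hFb x hx).differentiableAt, dirDeriv_cexp_mul (hF₀ x hx).differentiableAt] at e1
  simp only [e1, hder _ x hx, ← hexp]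
  ring

end KahlerImm

end

open KahlerImm

theorem proposition3p1 {n N : ℕ}
    {M : Type*} [TopologicalSpace M] [ChartedSpace (KahlerImm.Cn n) M]
    [IsManifold 𝓘(ℂ, KahlerImm.Cn n) ω M]
    {S : Type*} [TopologicalSpace S] [ChartedSpace (KahlerImm.Cn N) S]
    [IsManifold 𝓘(ℂ, KahlerImm.Cn N) ω S]
    (g : KahlerImm.PseudoKahlerMetric n M) (hg : g.IsKahler)
    (c : ℝ) (gc : KahlerImm.PseudoKahlerMetric N S) (hgc : gc.IsComplexSpaceForm (2 * c))
    (φ : M → S) (hφ : KahlerImm.IsKahlerImmersion g gc φ)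
    (p : M) (D : M → ℝ) (hD : g.IsDiastasis p D)
    (e : OpenPartialHomeomorph M (KahlerImm.Cn n)) (he : KahlerImm.IsBochnerChart p D e) :
    (((fun x => (KahlerImm.complexHessian D e (e x)).det : M → ℂ) : Filter.Germ (𝓝 p) ℂ)
        ∈ KahlerImm.tildeK n p) ∧
    (c = 0 →
      ((fun x => (D x : ℂ) : M → ℂ) : Filter.Germ (𝓝 p) ℂ) ∈ KahlerImm.tildeLambda n p) ∧
    (c ≠ 0 →
      ((fun x => (Real.exp (c / 2 * D x) : ℂ) : M → ℂ) : Filter.Germ (𝓝 p) ℂ)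
        ∈ KahlerImm.tildeLambda n p) := by
  -- The parameter is k = c/2, so that exp(k D) is the function of the statement.
  have hc2 : (2 * c : ℝ) = 2 * (2 * (c / 2)) := by ring
  rw [hc2] at hgc
  obtain ⟨r, hr, F₀, F, hF₀, hF, hfr, hexp, hk0, hder, hpure, hdiag⟩ :=
    exists_kernels hgc hφ hD he
  obtain ⟨hea, hp, hp0, -⟩ := he
  have h0 : (0 : Cn n) ∈ Metric.ball (0 : Cn n) r := Metric.mem_ball_self hr
  have hball : ∀ᶠ x in 𝓝 p, e x ∈ Metric.ball (0 : Cn n) r := by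
    have hc : Filter.Tendsto e (𝓝 p) (𝓝 0) := hp0 ▸ e.continuousAt hp
    exact hc.eventually (Metric.ball_mem_nhds 0 hr)
  have hDF : ∀ᶠ x in 𝓝 p, (D x : ℂ) = diag F₀ (e x) := by
    filter_upwards [hball, e.open_source.mem_nhds hp] with x hx hxs
    rw [← (hdiag _ hx).1, e.left_inv hxs]
  have hQker : IsFiniteRank r fun x => Complex.exp ((c / 2 : ℝ) * F₀ x) :=
    ((isFiniteRank_const 1).add ((isFiniteRank_const ((c / 2 : ℝ) : ℂ)).mul hfr)).congr
      fun x _ => hexp x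
  have hF00 : F₀ 0 = 0 := (hpure 0 h0).1
  have hQ : ((fun x => (Real.exp (c / 2 * D x) : ℂ) : M → ℂ) : Filter.Germ (𝓝 p) ℂ)
      ∈ tildeLambda n p := by
    refine mem_tildeLambda_of_real ?_ (Filter.Eventually.of_forall fun x => Complex.conj_ofReal _)
    have h := diag_mem_complexLambda hea hp hp0 hr hQker
      (fun z hz => by rw [(hpure z hz).1, hF00]) (fun z hz => by rw [(hpure z hz).2.1, hF00])
    convert h using 1
    refine Filter.Germ.coe_eq.2 ?_
    filter_upwards [hDF] with x hx
    rw [Complex.ofReal_exp, Complex.ofReal_mul, hx]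
    rfl
  refine ⟨?_, fun hc => ?_, fun _ => hQ⟩
  -- A is the Hessian with every entry multiplied by exp(cD/2)²; its determinant is the numerator
  -- and exp(cD/2)^(2n) the denominator.
  · let A : M → Matrix (Fin n) (Fin n) ℂ := fun x => Matrix.of fun a b => diag
      (fun y => Complex.exp ((c / 2 : ℝ) * F₀ y) ^ 2 * dirDeriv (vz a) (dirDeriv (vw b) F₀) y) (e x)
    have hA : ∀ᶠ x in 𝓝 p, A x =
        (Real.exp (c / 2 * D x) : ℂ) ^ 2 • complexHessian D e (e x) := by
      filter_upwards [hball, hDF] with x hx hxD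
      ext a b
      rw [Matrix.smul_apply, (hdiag _ hx).2.2 a b, Complex.ofReal_exp, Complex.ofReal_mul, hxD]
      rfl
    have hdet : ∀ᶠ x in 𝓝 p, (A x).det =
        (Real.exp (c / 2 * D x) : ℂ) ^ (2 * n) * (complexHessian D e (e x)).det := by
      filter_upwards [hA] with x hx
      rw [hx, Matrix.det_smul, Fintype.card_fin, pow_mul]
    refine ⟨((fun x => (A x).det : M → ℂ) : Filter.Germ (𝓝 p) ℂ), ?_,
      ((fun x => (Real.exp (c / 2 * D x) : ℂ) : M → ℂ) : Filter.Germ (𝓝 p) ℂ) ^ (2 * n),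
      pow_mem hQ _, ?_, ?_⟩
    · refine mem_tildeLambda_of_real (det_mem_complexLambda fun a b => ?_) ?_
      -- On both axes F₀ vanishes and, in Bochner coordinates, its mixed derivative is δ_ab; hence
      -- each entry is constant there and has no pure terms.
      · have hδ := fun z hz => dirDeriv_dirDeriv_bochner hr hF₀
          (fun z hz => (hpure z hz).2.2.2.2) a b (z := z) hz
        have hδ0 := (hδ 0 h0).1
        rw [Prod.mk_zero_zero] at hδ0
        exact diag_mem_complexLambda hea hp hp0 hr
          (isFiniteRank_hessian hF₀ hF hfr hexp hder a b)
          (fun z hz => by rw [(hpure z hz).1, (hδ z hz).1, hF00, hδ0])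
          (fun z hz => by rw [(hpure z hz).2.1, (hδ z hz).2, hF00, hδ0])
      · filter_upwards [hball, hdet] with x hx hxd
        -- The Hessian is the Hermitian matrix of the metric, so its determinant is real.
        have hH : (g.matrix e (e x)).conjTranspose = g.matrix e (e x) := by
          ext a b
          exact (coeff_conj g a b (e x)).symm
        have hreal : conj ((complexHessian D e (e x)).det) = (complexHessian D e (e x)).det := by
          rw [← (hdiag _ hx).2.1]
          conv_rhs => rw [← hH, Matrix.det_conjTranspose]
          rfl
        rw [hxd, map_mul, map_pow, Complex.conj_ofReal, hreal]
    · rw [← Filter.Germ.coe_pow]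
      intro h
      have h' := (Filter.Germ.coe_eq.1 h).self_of_nhds
      exact pow_ne_zero (2 * n) (Complex.ofReal_ne_zero.2 (Real.exp_pos _).ne') h'
    · rw [← Filter.Germ.coe_pow, ← Filter.Germ.coe_mul]
      refine Filter.Germ.coe_eq.2 ?_
      filter_upwards [hdet] with x hx
      rw [hx, mul_comm]
      rfl
  · have hF0 : F = F₀ := hk0 (by rw [hc, zero_div])
    refine mem_tildeLambda_of_real ?_ (Filter.Eventually.of_forall fun x => Complex.conj_ofReal _)
    have h := diag_mem_complexLambda hea hp hp0 hr (hF0 ▸ hfr)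
      (fun z hz => by rw [(hpure z hz).1, hF00]) (fun z hz => by rw [(hpure z hz).2.1, hF00])
    convert h using 1
    exact Filter.Germ.coe_eq.2 hDF
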